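/- **Setting.** Space-time is $\mathbb R^2\times\mathbb R$ and $\hat f(\xi,\tau)=\int f(x,t)e^{-i(x\cdot\xi+t\tau)}\,dx\,dt$. Put $|(\xi,\tau)|=(|\tau|+|\xi|^2)^{1/2}$ and $\langle s\rangle=(1+s^2)^{1/2}$. Let $\varphi_0:[0,\infty)\to[0,\infty)$ be smooth with $\varphi_0=1$ on $[0,1]$ and $\varphi_0=0$ on $[2,\infty)$, and let $\varphi_i(r)=\varphi_0(2^{-i}r)-\varphi_0(2^{-i+1}r)$ for $i\ge1$. For $d\in I_i=\{2^{-i},2^{-i+1},\dots,2^{i+2}\}$ let $\varphi_{i,d}(\xi,\tau)=\varphi_i(|(\xi,\tau)|)\,\varphi_{i+\log_2 d}(|\tau-|\xi|^2|)$. Let $S_i$ and $S_{i,d}$ be the Fourier multipliers with symbols $\varphi_i(|(\xi,\tau)|)$ and $\varphi_{i,d}$, and let $S_{i,\le d}=\sum_{d'\in I_i,\,d'\le d}S_{i,d'}$ and $S_{i,\ge d}=S_i-S_{i,\le d}$. Let $A_i,\ A_{i,\le d},\ A_{i,\ge d}$ be the supports of the symbols of $S_i,\ S_{i,\le d},\ S_{i,\ge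 d}$. Define $$\|f\|_{X^{0,b}}=\|\langle\tau-|\xi|^2\rangle^{b}\hat f\|_{L^2},\qquad \|f\|_{X^{0,1/2,1}}^2=\sum_{i\ge0}\Big(\sum_{d\in I_i}\|S_{i,d}S_if\|_{X^{0,1/2}}\Big)^2 ,$$ and $\|f\|_{X^{0,-1/2}_{j,\ge d}}=\|\mathbf 1_{A_{j,\ge d}}\langle\tau-|\xi|^2\rangle^{-1/2}\hat f\|_{L^2}$ (only the part of $f$ with Fourier transform in $A_{j,\ge d}$ is measured). Let $\Xi\subset\mathbb R^2$ be the set of points with polar coordinates $r=n$, $\theta=\frac{\pi}{2}\frac kn$, with $n,k$ positive integers, and let $(\phi_\xi)_{\xi\in\Xi}$ be a smooth partition of unity on $\mathbb R^2$ with $\phi_\xi\ge 0$ supported within a fixed distance of $\xi$ and derivatives of each order bounded uniformly in $\xi$. Let $f_\xi$ be the localization of $f$ by $\phi_\xi$ in the spatial frequency. Let $Q^m$ be the unit cube of $\mathbb R^2$ centred at $m\in\mathbb Z^2$ and $T^{m,l}_\xi=\{(x-2t\xi,t):x\in Q^m,\ t\in[l,l+1]\}$. Define $$\|f\|_Y^2=\sum_{\xi\in\Xi}\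 \sum_{(m,l)\in\mathbb Z^2\times\mathbb Z}\|f_\xi\|^2_{L^\infty_tL^2_x(T^{m,l}_\xi)},\qquad \|f\|_{\mathcal Y}^2=\sum_{\xi\in\Xi}\ \sum_{(m,l)\in\mathbb Z^2\times\mathbb Z}\|f_\xi\|^2_{L^1_tL^2_x(T^{m,l}_\xi)} .$$ **Proposition.** There is a constant $C$, depending only on the cut-offs $\varphi_0$ and $(\phi_\xi)$, such that the following holds for all integers $i\ge1$ and $j\ge5i$ and every $u_i\in L^2(\mathbb R^2\times\mathbb R)$ with $\hat u_i$ supported in $A_i$. 1. For every $v\in L^2$ with $\hat v$ supported in $A_{j,\le2^{-i}}$, the product $v\,u_i$ belongs to $L^2$ and $$\|v\,u_i\|_{X^{0,-1/2}_{j,\ge2^{-i}}}\le C\,2^{i-j}\,i^{1/2}\,\|v\|_{Y}\,\|u_i\|_{X^{0,1/2,1}} .$$ 2. For every $v\in L^2$ with $\hat v$ supported in $A_{j,\ge2^{-i}}$, the product $v\,u_i$ belongs to $L^2$ and $$\|S_{j,\le2^{-i}}(v\,u_i)\|_{\mathcal Y}\le C\,2^{i-j}\,i^{1/2}\,\|v\|_{X^{0,1/2,1}}\,\|u_i\|_{X^{0,1/2,1}}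 .$$ (The norms take the value $+\infty$ outside the corresponding spaces; distributions of finite $X^{0,1/2,1}$ or $Y$ norm are in $L^2$.) -/

import Mathlib

open MeasureTheory Set
open scoped FourierTransform ENNReal ContDiff

noncomputable section

namespace DNLS

/-- The plane of spatial variables (and of spatial frequencies `ξ`). -/
abbrev Plane := EuclideanSpace ℝ (Fin 2)

/-- Space-time `ℝ² × ℝ`: the coordinates `0, 1` are spatial and the coordinate `2` is time.
The same type is used for the Fourier variables `(ξ, τ)`. -/
abbrev SpaceTime := EuclideanSpace ℝ (Fin 3)

/-- Complex-valued square integrable functions on space-time. -/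
abbrev L2 := Lp ℂ 2 (volume : Measure SpaceTime)

/-- The point `(x, t)` of space-time. -/
def pt (x : Plane) (t : ℝ) : SpaceTime := !₂[x 0, x 1, t]

/-- The spatial part `ξ` of `ζ = (ξ, τ)`. -/
def spatial (ζ : SpaceTime) : Plane := !₂[ζ 0, ζ 1]

/-- The parabolic size `|(ξ, τ)| = (|τ| + |ξ|²)^{1/2}`. -/
def parabolicSize (ζ : SpaceTime) : ℝ := Real.sqrt (|ζ 2| + ‖spatial ζ‖ ^ 2)

/-- The modulation `τ - |ξ|²`. -/
def modulation (ζ : SpaceTime) : ℝ := ζ 2 - ‖spatial ζ‖ ^ 2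

/-! ### Fourier transform and Fourier multipliers -/

/-- The space-time Fourier transform `û(ξ, τ) = ∫ u(x, t) e^{-i(x·ξ + tτ)} dx dt`, extended to
`L²`. Mathlib's transform has the phase `e^{-2πi(x·ξ + tτ)}`, hence the dilation. -/
def hat (f : L2) : SpaceTime → ℂ := fun ζ => (𝓕 f : L2) ((2 * Real.pi)⁻¹ • ζ)

/-- A bounded measurable multiplier maps `L²` to `L²`; so in `fourierMul` below the first
alternative holds for such a multiplier. -/
theorem memLp_mul_fourier {m : SpaceTime → ℝ} (hm : Measurable m) {B : ℝ}
    (hB : ∀ ζ, |m ζ| ≤ B) (f : L2) :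
    MemLp (fun ζ => (m ((2 * Real.pi) • ζ) : ℂ) * (𝓕 f : L2) ζ) 2 volume := by
  refine (Lp.memLp (𝓕 f : L2)).of_le_mul (c := B) ?_ ?_
  · refine AEStronglyMeasurable.mul ?_ (Lp.aestronglyMeasurable _)
    have h : Measurable fun ζ : SpaceTime => m ((2 * Real.pi) • ζ) :=
      hm.comp (measurable_const_smul _)
    exact (Complex.measurable_ofReal.comp h).aestronglyMeasurable
  · refine Filter.Eventually.of_forall fun ζ => ?_
    rw [norm_mul, Complex.norm_real, Real.norm_eq_abs]
    exact mul_le_mul_of_nonneg_right (hB _) (norm_nonneg _)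

open Classical in
/-- The Fourier multiplier operator with (bounded measurable) symbol `m(ξ, τ)`, i.e.
`u ↦ 𝓕⁻¹(m û)`. -/
def fourierMul (m : SpaceTime → ℝ) (f : L2) : L2 :=
  if h : MemLp (fun ζ => (m ((2 * Real.pi) • ζ) : ℂ) * (𝓕 f : L2) ζ) 2 volume then
    𝓕⁻ (h.toLp _)
  else 0

/-- `û` is supported in the (closed) set `A`. -/
def FourierSupportedIn (f : L2) (A : Set SpaceTime) : Prop := ∀ᵐ ζ, ζ ∉ A → hat f ζ = 0

/-! ### Dyadic localization in frequency and in the distance to the paraboloid -/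

/-- The basic cut-off: nonnegative and smooth on `[0, ∞)`, equal to `1` on `[0, 1]` and to `0` on
`[2, ∞)`. Values at negative arguments are never used. -/
structure IsBasicCutoff (φ₀ : ℝ → ℝ) : Prop where
  smooth : ContDiffOn ℝ ∞ φ₀ (Ici 0)
  nonneg : ∀ x, 0 ≤ x → 0 ≤ φ₀ x
  eq_one : ∀ x, 0 ≤ x → x ≤ 1 → φ₀ x = 1
  eq_zero : ∀ x, 2 ≤ x → φ₀ x = 0

/-- `φ_i`: it is `φ₀` for `i = 0`, and `φ₀(2^{-i} x) - φ₀(2^{-i+1} x)` for `i ≥ 1`. -/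
def dyadic (φ₀ : ℝ → ℝ) : ℕ → ℝ → ℝ
  | 0, x => φ₀ x
  | i + 1, x => φ₀ (x / 2 ^ (i + 1)) - φ₀ (x / 2 ^ i)

/-- The symbol `φ_i(|(ξ, τ)|)` of `S_i`. -/
def symb (φ₀ : ℝ → ℝ) (i : ℕ) (ζ : SpaceTime) : ℝ := dyadic φ₀ i (parabolicSize ζ)

/-- The exponents `a` of the dyadic numbers `d = 2^a` in `I_i = {2^{-i}, …, 2^{i+2}}`. -/
def distExps (i : ℕ) : Finset ℤ := Finset.Icc (-(i : ℤ)) (i + 2)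

/-- The symbol `φ_{i,d}` of `S_{i,d}`, for `d = 2^a` in `I_i`. -/
def symbDist (φ₀ : ℝ → ℝ) (i : ℕ) (a : ℤ) (ζ : SpaceTime) : ℝ :=
  symb φ₀ i ζ * dyadic φ₀ (i + a).toNat |modulation ζ|

/-- The symbol of `S_{i,≤d}`, for `d = 2^a`. -/
def symbBelow (φ₀ : ℝ → ℝ) (i : ℕ) (a : ℤ) (ζ : SpaceTime) : ℝ :=
  ∑ b ∈ distExps i with b ≤ a, symbDist φ₀ i b ζ

/-- The symbol of `S_{i,≥d} = S_i - S_{i,≤d}`, for `d = 2^a`. -/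
def symbAbove (φ₀ : ℝ → ℝ) (i : ℕ) (a : ℤ) (ζ : SpaceTime) : ℝ :=
  symb φ₀ i ζ - symbBelow φ₀ i a ζ

/-- `A_i`. -/
def regionA (φ₀ : ℝ → ℝ) (i : ℕ) : Set SpaceTime := tsupport (symb φ₀ i)

/-- `A_{i,≤d}`, for `d = 2^a`. -/
def regionBelow (φ₀ : ℝ → ℝ) (i : ℕ) (a : ℤ) : Set SpaceTime := tsupport (symbBelow φ₀ i a)

/-- `A_{i,≥d}`, for `d = 2^a`. -/
def regionAbove (φ₀ : ℝ → ℝ) (i : ℕ) (a : ℤ) : Set SpaceTime := tsupport (symbAbove φ₀ i a)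

/-! ### The spaces `X^{0,b}` and `X^{0,1/2,1}` -/

/-- The `X^{0,b}` norm of the part of `f` with Fourier transform in `A`:
`‖1_A ⟨τ - |ξ|²⟩^b f̂‖_{L²}`. -/
def normX0On (b : ℝ) (A : Set SpaceTime) (f : L2) : ℝ≥0∞ :=
  (∫⁻ ζ in A, ENNReal.ofReal ((1 + modulation ζ ^ 2) ^ b) * ‖hat f ζ‖ₑ ^ 2) ^ (1 / 2 : ℝ)

/-- The `X^{0,b}` norm `‖⟨τ - |ξ|²⟩^b f̂‖_{L²}`. -/
def normX0 (b : ℝ) (f : L2) : ℝ≥0∞ := normX0On b univ f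

/-- The norm of `X_i^{0,1/2,1}`: `∑_{d ∈ I_i} ‖S_{i,d} f‖_{X^{0,1/2}}`. -/
def normXi (φ₀ : ℝ → ℝ) (i : ℕ) (f : L2) : ℝ≥0∞ :=
  ∑ a ∈ distExps i, normX0 (1 / 2) (fourierMul (symbDist φ₀ i a) f)

/-- The norm of `X^{0,1/2,1}`: `(∑_i ‖S_i f‖²_{X_i^{0,1/2,1}})^{1/2}`. -/
def normX (φ₀ : ℝ → ℝ) (f : L2) : ℝ≥0∞ :=
  (∑' i : ℕ, normXi φ₀ i (fourierMul (symb φ₀ i) f) ^ 2) ^ (1 / 2 : ℝ)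

/-! ### The wave packet spaces `Y` and `𝒴` -/

/-- The polar lattice `Ξ`: the points with polar coordinates `r = n`, `θ = (π/2)(k/n)`, with
positive integers `n, k`. -/
def lattice : Set Plane :=
  {ξ | ∃ n k : ℕ, 0 < n ∧ 0 < k ∧
    ξ = !₂[n * Real.cos (Real.pi / 2 * (k / n)), n * Real.sin (Real.pi / 2 * (k / n))]}

/-- A smooth partition of unity `(φ_ξ)_{ξ ∈ Ξ}` adapted to the unit cells of `Ξ`: `φ_ξ` is
nonnegative and supported within a fixed distance of `ξ`, with derivatives of each order bounded
uniformly in `ξ`. -/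
structure IsLatticePartition (φ : lattice → Plane → ℝ) : Prop where
  smooth : ∀ ξ, ContDiff ℝ ∞ (φ ξ)
  nonneg : ∀ ξ x, 0 ≤ φ ξ x
  support : ∃ R : ℝ, ∀ (ξ : lattice) (x : Plane), R < dist x ξ → φ ξ x = 0
  deriv_bound : ∀ k : ℕ, ∃ B : ℝ, ∀ ξ x, ‖iteratedFDeriv ℝ k (φ ξ) x‖ ≤ B
  sum_eq_one : ∀ x, HasSum (fun ξ => φ ξ x) 1

/-- `f_ξ`, the localization of `f` by `φ_ξ` in the spatial frequency. -/
def packet (φ : lattice → Plane → ℝ) (ξ : lattice) (f : L2) : L2 :=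
  fourierMul (fun ζ => φ ξ (spatial ζ)) f

/-- The unit cube `Q^m` centred at `m ∈ ℤ²`. -/
def unitCube (m : Fin 2 → ℤ) : Set Plane :=
  {x | ∀ k, x k ∈ Ico ((m k : ℝ) - 1 / 2) ((m k : ℝ) + 1 / 2)}

/-- The slice `Q^m - 2tξ` of the tube `T_ξ^{m,l}` at time `t ∈ [l, l + 1]`. -/
def tubeSlice (ξ : Plane) (m : Fin 2 → ℤ) (t : ℝ) : Set Plane :=
  {x | x + (2 * t) • ξ ∈ unitCube m}

/-- `‖f(·, t)‖_{L²(Q^m - 2tξ)}`. -/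
def sliceNorm (ξ : Plane) (m : Fin 2 → ℤ) (f : L2) (t : ℝ) : ℝ≥0∞ :=
  (∫⁻ x in tubeSlice ξ m t, ‖f (pt x t)‖ₑ ^ 2) ^ (1 / 2 : ℝ)

/-- The `L^∞_t L²_x` norm on the tube `T_ξ^{m,l}`. -/
def tubeNormSup (ξ : Plane) (m : Fin 2 → ℤ) (l : ℤ) (f : L2) : ℝ≥0∞ :=
  essSup (sliceNorm ξ m f) (volume.restrict (Icc (l : ℝ) (l + 1)))

/-- The `L¹_t L²_x` norm on the tube `T_ξ^{m,l}`. -/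
def tubeNormOne (ξ : Plane) (m : Fin 2 → ℤ) (l : ℤ) (f : L2) : ℝ≥0∞ :=
  ∫⁻ t in Icc (l : ℝ) (l + 1), sliceNorm ξ m f t

/-- The norm of `Y = Y⁰`: `‖f‖²_Y = ∑_ξ ‖f_ξ‖²_{Y_ξ}`, where
`‖g‖²_{Y_ξ} = ∑_{m,l} ‖g‖²_{L^∞_t L²_x(T_ξ^{m,l})}`. -/
def normY (φ : lattice → Plane → ℝ) (f : L2) : ℝ≥0∞ :=
  (∑' (ξ : lattice) (m : Fin 2 → ℤ) (l : ℤ), tubeNormSup ξ m l (packet φ ξ f) ^ 2) ^ (1 / 2 : ℝ)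

/-- The norm of `𝒴 = 𝒴⁰`: `‖f‖²_𝒴 = ∑_ξ ‖f_ξ‖²_{𝒴_ξ}`, where
`‖g‖²_{𝒴_ξ} = ∑_{m,l} ‖g‖²_{L¹_t L²_x(T_ξ^{m,l})}`. -/
def normCalY (φ : lattice → Plane → ℝ) (f : L2) : ℝ≥0∞ :=
  (∑' (ξ : lattice) (m : Fin 2 → ℤ) (l : ℤ), tubeNormOne ξ m l (packet φ ξ f) ^ 2) ^ (1 / 2 : ℝ)

end DNLS

end

open MeasureTheory Set
open scoped FourierTransform ENNReal ContDiff

noncomputable section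

namespace DNLS

/-! ### The `L²` Fourier transform tested against Schwartz functions. -/

section FourierLp

variable {E : Type*} [NormedAddCommGroup E] [InnerProductSpace ℝ E] [FiniteDimensional ℝ E]
  [MeasurableSpace E] [BorelSpace E]

open SchwartzMap

/-! Both bounds combine a local smoothing estimate for the low-frequency factor `u` on fast tubes
with a count of the frequency interactions that end near the paraboloid.

Slice `û` along the paraboloids `τ = λ + |η|²`; `modNorm` is the integral over `λ` of the `L²` norms
of the slices. Cauchy–Schwarz on dyadic ranges of `λ`, together with the `ℓ¹` sum over modulations,
bounds it by the `X^{0,1/2,1}` norm (`modNorm_hat_le`). So `u` behaves like a superposition of free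
solutions. Cut it into unit frequency cells `n`. Along a tube of velocity `-2ξ` the phase of a free
solution is `t (λ + |η|² - 2 ξ·η)`. For `|ξ| ≳ 2^j` and `|η| ≲ 2^i` its `t`-coefficient has
derivative `≳ 2^j` in the direction of a large coordinate of `ξ`. Changing variables and using
Plancherel in `t` gains `2^{-j/2}` in `L²_t`, and a Taylor expansion makes this uniform over the
unit cube. The outcome is a majorant `U(t)` of the cell piece on the tube, with `‖U‖²_{L²} ≲ 2^{-j}
modNorm²` (`exists_majorant`).

The count (`card_interacts_le`): if `ζ ± ζᵤ` is within `O(2^{j-i})` of the paraboloid at size `2^j`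
and `ζᵤ` has size `≲ 2^i`, then `ζ` fixes the radius of `spatial (ζ ± ζᵤ)` up to `O(1)` and its
position up to `O(2^i)`. Hence only `O(2^i)` pairs (packet `ξ`, cell `n`) interact at a given `ζ`.

In the first estimate, Cauchy–Schwarz over the interacting pairs costs `2^i`. Each product of a
packet with a cell piece is bounded on the tubes of the packet by `L^∞_t L²_x` times `L²_t L^∞_x`,
with gain `2^{-j}`, and the weight contributes `2^{-(j-i)}`. The product of the three factors is
`(2^{i-j})²`.

The second estimate is dual. A packet of the output sees, for each cell `n`, only the frequencies of
`v` interacting with `(ξ, n)`, and these sets overlap `O(2^i)` times. On tubes, Cauchy–Schwarz in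
`n` and `t` gives the gain `2^{-j}`, while the `L²` norm of `v` gains `2^{-(j-i)/2}` from its
modulation. The localization to a packet near the paraboloid is convolution with a measure of
bounded mass: after a Galilean change of frequency its symbol is smooth at unit scale, uniformly in
all parameters (`exists_packet_kernel`), and translations are bounded on `𝒴_ξ`
(`calSq_translate_le`). -/

theorem integral_fourier_mul_schwartz (f : Lp ℂ 2 (volume : Measure E)) (h : 𝓢(E, ℂ)) :
    ∫ x, h x * (𝓕 f : Lp ℂ 2 (volume : Measure E)) x = ∫ x, (𝓕 h) x * f x := by
  have h1 := DFunLike.congr_fun (Lp.fourier_toTemperedDistribution_eq f) h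
  rw [TemperedDistribution.fourier_apply, Lp.toTemperedDistribution_apply,
    Lp.toTemperedDistribution_apply] at h1
  simpa using h1.symm

theorem locallyIntegrable_of_memLp_two {f : E → ℂ} (hf : MemLp f 2 (volume : Measure E)) :
    LocallyIntegrable f volume :=
  hf.locallyIntegrable (by norm_num)

/-- Two locally integrable functions with equal integrals against all Schwartz functions agree. -/
theorem ae_eq_of_integral_schwartz {f g : E → ℂ} (hf : LocallyIntegrable f volume)
    (hg : LocallyIntegrable g volume)
    (h : ∀ k : 𝓢(E, ℂ), ∫ x, k x * f x = ∫ x, k x * g x) : f =ᵐ[volume] g := by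
  refine ae_eq_of_integral_contDiff_smul_eq hf hg fun k hk hc => ?_
  have hc' : HasCompactSupport fun x => (k x : ℂ) := hc.comp_left (g := fun r : ℝ => (r : ℂ)) (by simp)
  have h1 := h (hc'.toSchwartzMap (Complex.ofRealCLM.contDiff.comp hk))
  have h2 : ∀ x, hc'.toSchwartzMap (Complex.ofRealCLM.contDiff.comp hk) x = (k x : ℂ) := fun x => rfl
  simpa only [h2, Complex.real_smul] using h1

theorem memLp_two_mul_integrable {f g : E → ℂ} (hf : MemLp f 2 (volume : Measure E))
    (hg : MemLp g 2 (volume : Measure E)) : Integrable (fun x => f x * g x) volume :=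
  hf.integrable_mul hg

theorem integral_fourier_mul_schwartz_of_integrable {f : E → ℂ} (hf : Integrable f volume)
    (h : 𝓢(E, ℂ)) : ∫ x, h x * 𝓕 f x = ∫ x, (𝓕 h) x * f x := by
  have := VectorFourier.integral_fourierIntegral_smul_eq_flip (L := innerₗ E) (μ := volume)
    (ν := volume) (e := Real.fourierChar) (f := h) (g := f) Real.continuous_fourierChar
    continuous_inner h.integrable hf
  simp only [smul_eq_mul, flip_innerₗ] at this
  exact this.symm

/-- Both transforms have the same pairing with every Schwartz function: one by the distributional
definition, the other by Fubini. -/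
theorem fourier_Lp_ae_eq (f : Lp ℂ 2 (volume : Measure E)) (hf : Integrable f volume) :
    (𝓕 f : Lp ℂ 2 (volume : Measure E)) =ᵐ[volume] 𝓕 (f : E → ℂ) := by
  refine ae_eq_of_integral_schwartz (locallyIntegrable_of_memLp_two (Lp.memLp _)) ?_ fun h => ?_
  · exact (VectorFourier.fourierIntegral_continuous Real.continuous_fourierChar
      (by exact continuous_inner) hf).locallyIntegrable
  · rw [integral_fourier_mul_schwartz, integral_fourier_mul_schwartz_of_integrable hf]

end FourierLp

/-! ### Minkowski and Cauchy–Schwarz inequalities for `ℝ≥0∞`-valued functions. -/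

section Minkowski

theorem ENNReal_sq_rpow_half (a : ℝ≥0∞) : (a ^ 2) ^ (1 / 2 : ℝ) = a := by
  rw [← ENNReal.rpow_natCast, ← ENNReal.rpow_mul]; norm_num

theorem ENNReal_rpow_half_sq (a : ℝ≥0∞) : (a ^ (1 / 2 : ℝ)) ^ 2 = a := by
  rw [← ENNReal.rpow_natCast, ← ENNReal.rpow_mul]; norm_num

theorem ENNReal_rpow_half_le_iff {a b : ℝ≥0∞} : a ^ (1 / 2 : ℝ) ≤ b ↔ a ≤ b ^ 2 := by
  constructor
  · intro h
    calc a = (a ^ (1 / 2 : ℝ)) ^ 2 := (ENNReal_rpow_half_sq a).symm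
      _ ≤ b ^ 2 := by gcongr
  · intro h
    calc a ^ (1 / 2 : ℝ) ≤ (b ^ 2) ^ (1 / 2 : ℝ) := by gcongr
      _ = b := ENNReal_sq_rpow_half b

theorem lintegral_mul_le_sqrt {α : Type*} [MeasurableSpace α] {μ : Measure α} {f g : α → ℝ≥0∞}
    (hf : AEMeasurable f μ) (hg : AEMeasurable g μ) :
    ∫⁻ x, f x * g x ∂μ ≤ (∫⁻ x, f x ^ 2 ∂μ) ^ (1 / 2 : ℝ) * (∫⁻ x, g x ^ 2 ∂μ) ^ (1 / 2 : ℝ) := by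
  have := ENNReal.lintegral_mul_le_Lp_mul_Lq μ Real.HolderConjugate.two_two hf hg
  simpa using this

theorem sq_lintegral_mul_le {α : Type*} [MeasurableSpace α] {μ : Measure α} {f g : α → ℝ≥0∞}
    (hf : AEMeasurable f μ) (hg : AEMeasurable g μ) :
    (∫⁻ x, f x * g x ∂μ) ^ 2 ≤ (∫⁻ x, f x ^ 2 ∂μ) * (∫⁻ x, g x ^ 2 ∂μ) := by
  calc _ ≤ ((∫⁻ x, f x ^ 2 ∂μ) ^ (1 / 2 : ℝ) * (∫⁻ x, g x ^ 2 ∂μ) ^ (1 / 2 : ℝ)) ^ 2 := by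
        gcongr; exact lintegral_mul_le_sqrt hf hg
    _ = _ := by rw [mul_pow, ENNReal_rpow_half_sq, ENNReal_rpow_half_sq]

/-- Minkowski's integral inequality in `L²`. -/
theorem lintegral_minkowski {α β : Type*} [MeasurableSpace α] [MeasurableSpace β]
    {μ : Measure α} {ν : Measure β} [SFinite μ] [SFinite ν] {F : α → β → ℝ≥0∞}
    (hF : Measurable (Function.uncurry F)) :
    (∫⁻ x, (∫⁻ y, F x y ∂ν) ^ 2 ∂μ) ^ (1 / 2 : ℝ) ≤
      ∫⁻ y, (∫⁻ x, F x y ^ 2 ∂μ) ^ (1 / 2 : ℝ) ∂ν := by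
  set G : β → ℝ≥0∞ := fun y => (∫⁻ x, F x y ^ 2 ∂μ) ^ (1 / 2 : ℝ) with hG
  have hFx : ∀ x, Measurable (F x) := fun x => hF.comp measurable_prodMk_left
  have hFy : ∀ y, Measurable fun x => F x y := fun y => hF.comp measurable_prodMk_right
  have hS : Measurable fun x => ∫⁻ y, F x y ∂ν := hF.lintegral_prod_right'
  have hGm : Measurable G := by
    refine Measurable.pow_const ?_ _
    exact (hF.pow_const 2).lintegral_prod_left'
  -- The square of the left side is a double integral over `(y, y')` of `∫ F x y * F x y'`, and
  -- Cauchy–Schwarz applies to each pair. This avoids dividing by a norm that may be `0` or `∞`.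
  have key : ∀ y, ∫⁻ x, F x y * ∫⁻ y', F x y' ∂ν ∂μ ≤ G y * ∫⁻ y', G y' ∂ν := by
    intro y
    calc ∫⁻ x, F x y * ∫⁻ y', F x y' ∂ν ∂μ = ∫⁻ x, ∫⁻ y', F x y * F x y' ∂ν ∂μ := by
          refine lintegral_congr fun x => ?_
          rw [lintegral_const_mul _ (hFx x)]
      _ = ∫⁻ y', ∫⁻ x, F x y * F x y' ∂μ ∂ν := by
          rw [lintegral_lintegral_swap]
          exact (((hFy y).comp measurable_fst).mul hF).aemeasurable
      _ ≤ ∫⁻ y', G y * G y' ∂ν := by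
          refine lintegral_mono fun y' => ?_
          exact lintegral_mul_le_sqrt (hFy y).aemeasurable (hFy y').aemeasurable
      _ = _ := lintegral_const_mul _ hGm
  rw [ENNReal_rpow_half_le_iff]
  calc ∫⁻ x, (∫⁻ y, F x y ∂ν) ^ 2 ∂μ = ∫⁻ x, ∫⁻ y, F x y * ∫⁻ y', F x y' ∂ν ∂ν ∂μ := by
        refine lintegral_congr fun x => ?_
        rw [lintegral_mul_const _ (hFx x), sq]
    _ = ∫⁻ y, ∫⁻ x, F x y * ∫⁻ y', F x y' ∂ν ∂μ ∂ν := by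
        rw [lintegral_lintegral_swap]
        exact (hF.mul (hS.comp measurable_fst)).aemeasurable
    _ ≤ ∫⁻ y, G y * ∫⁻ y', G y' ∂ν ∂ν := lintegral_mono key
    _ = (∫⁻ y, G y ∂ν) ^ 2 := by rw [lintegral_mul_const _ hGm, sq]

/-- Minkowski with the counting measure as the outer measure. -/
theorem tsum_lintegral_minkowski {ι β : Type*} [Countable ι] [MeasurableSpace β]
    {ν : Measure β} [SFinite ν] {F : ι → β → ℝ≥0∞} (hF : ∀ i, Measurable (F i)) :
    (∑' i, (∫⁻ y, F i y ∂ν) ^ 2) ^ (1 / 2 : ℝ) ≤ ∫⁻ y, (∑' i, F i y ^ 2) ^ (1 / 2 : ℝ) ∂ν := by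
  let _ : MeasurableSpace ι := ⊤
  have : MeasurableSingletonClass ι := ⟨fun _ => trivial⟩
  have := lintegral_minkowski (μ := (Measure.count : Measure ι)) (ν := ν) (F := F)
    (measurable_from_prod_countable_right hF)
  simpa [lintegral_count] using this

end Minkowski

/-- `e^{ir}`. -/
def expi (r : ℝ) : ℂ := Complex.exp (r * Complex.I)

@[simp]
theorem norm_expi (r : ℝ) : ‖expi r‖ = 1 := Complex.norm_exp_ofReal_mul_I r

@[simp]
theorem enorm_expi (r : ℝ) : ‖expi r‖ₑ = 1 := by
  rw [← ofReal_norm, norm_expi, ENNReal.ofReal_one]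

theorem expi_add (r s : ℝ) : expi (r + s) = expi r * expi s := by
  simp [expi, add_mul, Complex.exp_add]

@[simp]
theorem expi_zero : expi 0 = 1 := by simp [expi]

@[fun_prop]
theorem continuous_expi : Continuous expi := by unfold expi; fun_prop

@[fun_prop]
theorem measurable_expi : Measurable expi := continuous_expi.measurable

@[fun_prop]
theorem contDiff_expi : ContDiff ℝ ∞ expi := by
  unfold expi
  exact ((Complex.ofRealCLM.contDiff).mul contDiff_const).cexp

theorem fourierChar_eq_expi (r : ℝ) : (Real.fourierChar r : ℂ) = expi (2 * Real.pi * r) := by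
  rw [Real.fourierChar_apply, expi]

/-! ### Superpositions of translates and their Fourier transforms. -/

section FourierLp

variable {E : Type*} [NormedAddCommGroup E] [InnerProductSpace ℝ E] [FiniteDimensional ℝ E]
  [MeasurableSpace E] [BorelSpace E]

open SchwartzMap

/-- `∫ |Σ_z κ(z) f(x - p(z))|² dx ≤ ‖κ‖₁² ‖f‖₂²`. -/
theorem lintegral_superposition_le {κ f : E → ℂ} (hκ : Measurable κ) (hf : Measurable f)
    {p : E → E} (hp : Measurable p) :
    ∫⁻ x, (∫⁻ z, ‖κ z‖ₑ * ‖f (x - p z)‖ₑ) ^ 2 ≤ (∫⁻ z, ‖κ z‖ₑ) ^ 2 * ∫⁻ x, ‖f x‖ₑ ^ 2 := by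
  rw [← ENNReal_rpow_half_sq (∫⁻ x, ‖f x‖ₑ ^ 2), ← mul_pow, ← ENNReal_rpow_half_le_iff]
  refine (lintegral_minkowski ?_).trans ?_
  · exact ((hκ.comp measurable_snd).enorm).mul
      ((hf.comp (measurable_fst.sub (hp.comp measurable_snd))).enorm)
  · rw [← lintegral_mul_const _ hκ.enorm]
    refine lintegral_mono fun z => le_of_eq ?_
    simp_rw [mul_pow]
    rw [lintegral_const_mul _ (by fun_prop),
      ENNReal.mul_rpow_of_nonneg _ _ (by norm_num), ENNReal_sq_rpow_half,
      lintegral_sub_right_eq_self (fun x => ‖f x‖ₑ ^ 2)]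

theorem lintegral_sq_eq_eLpNorm {α : Type*} [MeasurableSpace α] {μ : Measure α} (f : α → ℂ) :
    ∫⁻ x, ‖f x‖ₑ ^ 2 ∂μ = eLpNorm f 2 μ ^ 2 := by
  rw [eLpNorm_eq_lintegral_rpow_enorm_toReal (by norm_num) (by norm_num)]
  simp only [ENNReal.toReal_ofNat, ENNReal.rpow_ofNat]
  rw [ENNReal_rpow_half_sq]

theorem memLp_two_iff {α : Type*} [MeasurableSpace α] {μ : Measure α} {f : α → ℂ}
    (hf : AEStronglyMeasurable f μ) : MemLp f 2 μ ↔ ∫⁻ x, ‖f x‖ₑ ^ 2 ∂μ < ⊤ := by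
  rw [lintegral_sq_eq_eLpNorm]
  simp [MemLp, hf]

theorem enorm_superposition_le {κ f : E → ℂ} {p : E → E} (x : E) :
    ‖∫ z, κ z * f (x - p z)‖ₑ ≤ ∫⁻ z, ‖κ z‖ₑ * ‖f (x - p z)‖ₑ := by
  refine (enorm_integral_le_lintegral_enorm _).trans_eq ?_
  simp [enorm_mul]

theorem memLp_superposition {κ f : E → ℂ} (hκ : Measurable κ) (hκi : Integrable κ volume)
    (hf : Measurable f) (hf2 : MemLp f 2 volume) {p : E → E} (hp : Measurable p) :
    MemLp (fun x => ∫ z, κ z * f (x - p z)) 2 volume := by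
  have hm : StronglyMeasurable fun x => ∫ z, κ z * f (x - p z) := by
    refine StronglyMeasurable.integral_prod_right' (f := fun q : E × E => κ q.2 * f (q.1 - p q.2)) ?_
    exact ((hκ.comp measurable_snd).mul
      (hf.comp (measurable_fst.sub (hp.comp measurable_snd)))).stronglyMeasurable
  rw [memLp_two_iff hm.aestronglyMeasurable]
  refine lt_of_le_of_lt ((lintegral_mono fun x => ?_).trans (lintegral_superposition_le hκ hf hp)) ?_
  · exact pow_le_pow_left' (enorm_superposition_le x) 2
  · refine ENNReal.mul_lt_top (ENNReal.pow_lt_top hκi.2) ?_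
    exact (memLp_two_iff hf2.1).1 hf2

/-- The Fourier transform of a superposition of translates. -/
theorem fourier_superposition {κ : E → ℂ} (hκ : Measurable κ) (hκi : Integrable κ volume)
    {p : E → E} (hp : Measurable p) (f g : Lp ℂ 2 (volume : Measure E))
    (hg : g =ᵐ[volume] fun x => ∫ z, κ z * f (x - p z)) :
    (𝓕 g : Lp ℂ 2 (volume : Measure E)) =ᵐ[volume]
      fun ζ => (∫ z, κ z * expi (2 * Real.pi * -inner ℝ (p z) ζ)) *
        (𝓕 f : Lp ℂ 2 (volume : Measure E)) ζ := by
  set F : E → ℂ := ⇑(𝓕 f : Lp ℂ 2 (volume : Measure E)) with hF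
  have hFm : StronglyMeasurable F := Lp.stronglyMeasurable _
  have hF2 : MemLp F 2 volume := Lp.memLp _
  have hfm : Measurable f := (Lp.stronglyMeasurable f).measurable
  have hf2 : MemLp f 2 volume := Lp.memLp _
  have hcm : Measurable fun q : E × E => expi (2 * Real.pi * -inner ℝ (p q.2) q.1) := by
    fun_prop
  have hmm : StronglyMeasurable fun ζ => ∫ z, κ z * expi (2 * Real.pi * -inner ℝ (p z) ζ) :=
    StronglyMeasurable.integral_prod_right'
      (f := fun q : E × E => κ q.2 * expi (2 * Real.pi * -inner ℝ (p q.2) q.1))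
      ((hκ.comp measurable_snd).mul hcm).stronglyMeasurable
  have hmb : ∀ ζ, ‖∫ z, κ z * expi (2 * Real.pi * -inner ℝ (p z) ζ)‖ ≤ ∫ z, ‖κ z‖ := by
    intro ζ
    refine (norm_integral_le_integral_norm _).trans_eq ?_
    simp
  have hR2 : MemLp (fun ζ => (∫ z, κ z * expi (2 * Real.pi * -inner ℝ (p z) ζ)) * F ζ) 2 volume := by
    refine hF2.of_le_mul (c := ∫ z, ‖κ z‖) (hmm.mul hFm).aestronglyMeasurable ?_
    refine Filter.Eventually.of_forall fun ζ => ?_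
    rw [norm_mul]
    exact mul_le_mul_of_nonneg_right (hmb ζ) (norm_nonneg _)
  refine ae_eq_of_integral_contDiff_smul_eq (locallyIntegrable_of_memLp_two (Lp.memLp _))
    (locallyIntegrable_of_memLp_two hR2) fun k hk hc => ?_
  have hc' : HasCompactSupport fun x => (k x : ℂ) := hc.comp_left (g := fun r : ℝ => (r : ℂ)) (by simp)
  have hk' : ContDiff ℝ ∞ fun x => (k x : ℂ) := Complex.ofRealCLM.contDiff.comp hk
  let h : 𝓢(E, ℂ) := hc'.toSchwartzMap hk'
  have hh : ∀ x, h x = (k x : ℂ) := fun x => rfl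
  -- the modulated test functions
  have hcd : ∀ z, ContDiff ℝ ∞ fun ζ : E => expi (2 * Real.pi * -inner ℝ z ζ) := by
    intro z
    exact contDiff_expi.comp (contDiff_const.mul (contDiff_const.inner ℝ contDiff_id).neg)
  let e : E → 𝓢(E, ℂ) := fun z =>
    (show HasCompactSupport fun ζ => expi (2 * Real.pi * -inner ℝ z ζ) * (k ζ : ℂ) from
      hc'.mul_left).toSchwartzMap ((hcd z).mul hk')
  have he : ∀ z ζ, e z ζ = expi (2 * Real.pi * -inner ℝ z ζ) * (k ζ : ℂ) := fun z ζ => rfl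
  have hshift : ∀ z x, (𝓕 (e z)) x = (𝓕 h) (x + z) := by
    intro z x
    rw [SchwartzMap.fourier_coe, SchwartzMap.fourier_coe, Real.fourier_eq, Real.fourier_eq]
    refine integral_congr_ae (Filter.Eventually.of_forall fun ζ => ?_)
    simp only [he, hh, Circle.smul_def, smul_eq_mul]
    rw [fourierChar_eq_expi, fourierChar_eq_expi, ← mul_assoc, ← expi_add, inner_add_right,
      real_inner_comm z ζ]
    congr 2; ring
  set H : E → ℂ := ⇑(𝓕 h : 𝓢(E, ℂ)) with hH
  have hHm : Measurable H := (𝓕 h : 𝓢(E, ℂ)).continuous.measurable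
  have hH2 : MemLp H 2 volume := (𝓕 h : 𝓢(E, ℂ)).memLp 2 volume
  -- A translation of `f` becomes a modulation of the test function; integrating this identity
  -- against `κ` is what remains.
  have key : ∀ z, ∫ x, H x * f (x - z) = ∫ ζ, expi (2 * Real.pi * -inner ℝ z ζ) * (k ζ : ℂ) * F ζ := by
    intro z
    have := integral_fourier_mul_schwartz f (e z)
    simp only [he, hshift] at this
    rw [this, ← integral_add_right_eq_self _ z]
    simp [hH]
  simp only [Complex.real_smul]
  have h1 := integral_fourier_mul_schwartz g h
  simp only [hh] at h1
  rw [h1]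
  have h2 : ∫ x, (𝓕 h) x * g x = ∫ x, ∫ z, H x * (κ z * f (x - p z)) := by
    refine integral_congr_ae ?_
    filter_upwards [hg] with x hx
    rw [hx, integral_const_mul]
  rw [h2, integral_integral_swap]
  · have h3 : ∀ z, ∫ x, H x * (κ z * f (x - p z)) =
        ∫ ζ, κ z * (expi (2 * Real.pi * -inner ℝ (p z) ζ) * (k ζ : ℂ) * F ζ) := by
      intro z
      rw [integral_const_mul, ← key, ← integral_const_mul]
      congr 1; ext x; ring
    simp_rw [h3]
    rw [integral_integral_swap]
    · refine integral_congr_ae (Filter.Eventually.of_forall fun ζ => ?_)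
      simp only
      rw [← integral_mul_const, ← integral_const_mul]
      congr 1; ext z; ring
    · have hi : Integrable (fun q : E × E => κ q.1 * ((k q.2 : ℂ) * F q.2))
          (volume.prod volume) :=
        hκi.mul_prod (memLp_two_mul_integrable (f := fun x => (k x : ℂ)) (h.memLp 2 volume) hF2)
      refine (hi.bdd_mul (c := 1) (f := fun q : E × E =>
        expi (2 * Real.pi * -inner ℝ (p q.1) q.2)) ?_ ?_).congr ?_
      · exact (hcm.comp measurable_swap).aestronglyMeasurable
      · exact Filter.Eventually.of_forall fun q => by simp
      · refine Filter.Eventually.of_forall fun q => ?_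
        simp only [Function.uncurry]; ring
  -- Absolute integrability for the first exchange: Cauchy–Schwarz in `x` reduces it to the `L²`
  -- bound for superpositions.
  · have hm : Measurable (Function.uncurry fun x z => H x * (κ z * f (x - p z))) :=
      (hHm.comp measurable_fst).mul ((hκ.comp measurable_snd).mul
        (hfm.comp (measurable_fst.sub (hp.comp measurable_snd))))
    refine ⟨hm.aestronglyMeasurable, ?_⟩
    rw [HasFiniteIntegral, lintegral_prod _ hm.enorm.aemeasurable]
    simp only [Function.uncurry, enorm_mul]
    have : ∀ x, ∫⁻ z, ‖H x‖ₑ * (‖κ z‖ₑ * ‖f (x - p z)‖ₑ) =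
        ‖H x‖ₑ * ∫⁻ z, ‖κ z‖ₑ * ‖f (x - p z)‖ₑ := fun x => by
      rw [lintegral_const_mul]
      exact hκ.enorm.mul (hfm.comp (measurable_const.sub hp)).enorm
    simp_rw [this]
    refine lt_of_le_of_lt (lintegral_mul_le_sqrt hHm.enorm.aemeasurable ?_) ?_
    · refine Measurable.aemeasurable ?_
      refine Measurable.lintegral_prod_right' (f := fun q : E × E => ‖κ q.2‖ₑ * ‖f (q.1 - p q.2)‖ₑ) ?_
      exact ((hκ.comp measurable_snd).enorm).mul
        ((hfm.comp (measurable_fst.sub (hp.comp measurable_snd))).enorm)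
    · refine ENNReal.mul_lt_top ?_ ?_
      · exact ENNReal.rpow_lt_top_of_nonneg (by norm_num) ((memLp_two_iff hH2.1).1 hH2).ne
      · refine ENNReal.rpow_lt_top_of_nonneg (by norm_num) (ne_of_lt ?_)
        refine (lintegral_superposition_le hκ hfm hp).trans_lt ?_
        exact ENNReal.mul_lt_top (ENNReal.pow_lt_top hκi.2) ((memLp_two_iff hf2.1).1 hf2)

end FourierLp

/-! ### Inversion and the convolution theorem in `L²`. -/

section FourierLp

variable {E : Type*} [NormedAddCommGroup E] [InnerProductSpace ℝ E] [FiniteDimensional ℝ E]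
  [MeasurableSpace E] [BorelSpace E]

open SchwartzMap

/-- Both transforms are moved onto the Schwartz test function, where inversion is available. -/
theorem fourier_fourier_Lp (f : Lp ℂ 2 (volume : Measure E)) :
    (𝓕 (𝓕 f : Lp ℂ 2 (volume : Measure E)) : Lp ℂ 2 (volume : Measure E)) =ᵐ[volume]
      fun x => f (-x) := by
  have hf : MemLp (fun x => f (-x)) 2 volume :=
    (Lp.memLp f).comp_measurePreserving (Measure.measurePreserving_neg volume)
  refine ae_eq_of_integral_schwartz (locallyIntegrable_of_memLp_two (Lp.memLp _))
    (locallyIntegrable_of_memLp_two hf) fun h => ?_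
  rw [integral_fourier_mul_schwartz, integral_fourier_mul_schwartz,
    ← integral_neg_eq_self (fun x => h x * f (-x))]
  refine integral_congr_ae (Filter.Eventually.of_forall fun x => ?_)
  have h1 : (𝓕 (𝓕 h)) x = h (-x) := by
    have h2 : (𝓕⁻ (𝓕 h)) (-x) = (𝓕 (𝓕 h)) x := by
      rw [SchwartzMap.fourierInv_coe, SchwartzMap.fourier_coe (𝓕 h), Real.fourierInv_eq_fourier_neg,
        neg_neg]
    rw [← h2, FourierTransform.fourierInv_fourier_eq]
  simp [h1]

theorem fourier_eq_integral_expi (f : E → ℂ) (ζ : E) :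
    𝓕 f ζ = ∫ z, f z * expi (2 * Real.pi * -inner ℝ z ζ) := by
  rw [Real.fourier_eq]
  refine integral_congr_ae (Filter.Eventually.of_forall fun z => ?_)
  simp only [Circle.smul_def, smul_eq_mul]
  rw [fourierChar_eq_expi, mul_comm]

theorem fourier_inversion_Lp (f : Lp ℂ 2 (volume : Measure E))
    (hf : Integrable (𝓕 f : Lp ℂ 2 (volume : Measure E)) volume) :
    f =ᵐ[volume] fun x => ∫ z, (𝓕 f : Lp ℂ 2 (volume : Measure E)) z *
      expi (2 * Real.pi * inner ℝ z x) := by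
  have h1 := fourier_fourier_Lp f
  have h2 := fourier_Lp_ae_eq _ hf
  have h3 : (fun x => f (-x)) =ᵐ[volume] 𝓕 (⇑(𝓕 f : Lp ℂ 2 (volume : Measure E))) :=
    h1.symm.trans h2
  have h4 := (Measure.measurePreserving_neg (volume : Measure E)).quasiMeasurePreserving.ae_eq_comp h3
  filter_upwards [h4] with x hx
  simp only [Function.comp_apply, neg_neg] at hx
  rw [hx, fourier_eq_integral_expi]
  simp

/-- The convolution on the right is a superposition of translates of `𝓕 v`, so its own transform is
the product of `𝓕 𝓕 u` and `𝓕 𝓕 v`. This is the reflection of `v u`, that is `𝓕 𝓕 w`; injectivity of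
`𝓕` concludes. -/
theorem fourier_mul_Lp (v u w : Lp ℂ 2 (volume : Measure E))
    (hu : Integrable (𝓕 u : Lp ℂ 2 (volume : Measure E)) volume)
    (hw : w =ᵐ[volume] fun x => v x * u x) :
    (𝓕 w : Lp ℂ 2 (volume : Measure E)) =ᵐ[volume]
      fun ζ => ∫ z, (𝓕 u : Lp ℂ 2 (volume : Measure E)) z *
        (𝓕 v : Lp ℂ 2 (volume : Measure E)) (ζ - z) := by
  have hU : Measurable (𝓕 u : Lp ℂ 2 (volume : Measure E)) := (Lp.stronglyMeasurable _).measurable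
  have hV : Measurable (𝓕 v : Lp ℂ 2 (volume : Measure E)) := (Lp.stronglyMeasurable _).measurable
  have hmem := memLp_superposition hU hu hV (Lp.memLp _) measurable_id
  set g : Lp ℂ 2 (volume : Measure E) := hmem.toLp _ with hg
  have hgc := hmem.coeFn_toLp
  have h1 := fourier_superposition hU hu measurable_id (𝓕 v) g hgc
  have h2 : (𝓕 g : Lp ℂ 2 (volume : Measure E)) = 𝓕 (𝓕 w) := by
    refine Lp.ext ?_
    have hq := (Measure.measurePreserving_neg (volume : Measure E)).quasiMeasurePreserving
    filter_upwards [h1, fourier_fourier_Lp w, fourier_fourier_Lp v, fourier_fourier_Lp u,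
      fourier_Lp_ae_eq _ hu, hq.ae hw] with x a1 a2 a3 a4 a5 a6
    rw [a1, a2, a6, a3, ← a4, a5, fourier_eq_integral_expi, mul_comm]
    rfl
  have h3 : g = 𝓕 w := by
    have := congrArg (fun k : Lp ℂ 2 (volume : Measure E) => (𝓕⁻ k : Lp ℂ 2 (volume : Measure E))) h2
    simpa using this
  rw [← h3]
  exact hgc

theorem lintegral_comp_smul {s : ℝ} (hs : s ≠ 0) (f : E → ℝ≥0∞) :
    ∫⁻ ζ, f (s • ζ) = ENNReal.ofReal |(s ^ Module.finrank ℝ E)⁻¹| * ∫⁻ ζ, f ζ := by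
  have h := (Homeomorph.smulOfNeZero s hs : E ≃ₜ E).measurableEmbedding.lintegral_map
    (μ := volume) f
  have h2 : Measure.map (Homeomorph.smulOfNeZero s hs : E ≃ₜ E) volume
      = ENNReal.ofReal |(s ^ Module.finrank ℝ E)⁻¹| • (volume : Measure E) :=
    Measure.map_addHaar_smul (volume : Measure E) hs
  rw [h2, lintegral_smul_measure] at h
  exact h.symm

end FourierLp

/-! ### The same facts in the normalization of `hat`. -/

section Hat

theorem measurePreserving_smul_two_pi {s : ℝ} (hs : s ≠ 0) :
    Measure.QuasiMeasurePreserving (fun ζ : SpaceTime => s • ζ) volume volume := by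
  refine ⟨measurable_const_smul _, ?_⟩
  rw [Measure.map_addHaar_smul _ hs]
  exact Measure.smul_absolutelyContinuous

theorem lintegral_comp_smul_spaceTime {s : ℝ} (hs : 0 < s) (f : SpaceTime → ℝ≥0∞) :
    ∫⁻ ζ, f (s • ζ) = ENNReal.ofReal ((s ^ 3)⁻¹) * ∫⁻ ζ, f ζ := by
  rw [lintegral_comp_smul hs.ne', show Module.finrank ℝ SpaceTime = 3 by simp,
    abs_of_pos (by positivity)]

theorem measurable_coe_L2 (f : L2) : Measurable f := (Lp.stronglyMeasurable f).measurable

theorem measurable_hat (f : L2) : Measurable (hat f) :=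
  (measurable_coe_L2 _).comp (measurable_const_smul _)

theorem lintegral_L2_lt_top (f : L2) : ∫⁻ z, ‖f z‖ₑ ^ 2 < ⊤ :=
  (memLp_two_iff (Lp.memLp f).1).1 (Lp.memLp f)

theorem lintegral_fourier_sq (f : L2) : ∫⁻ z, ‖(𝓕 f : L2) z‖ₑ ^ 2 = ∫⁻ z, ‖f z‖ₑ ^ 2 := by
  have h := Lp.norm_fourier_eq f
  rw [Lp.norm_def, Lp.norm_def, ENNReal.toReal_eq_toReal_iff' (Lp.eLpNorm_ne_top _)
    (Lp.eLpNorm_ne_top _)] at h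
  rw [lintegral_sq_eq_eLpNorm, lintegral_sq_eq_eLpNorm, h]

theorem two_pi_inv_pos : 0 < (2 * Real.pi)⁻¹ := by positivity

/-- Plancherel's theorem for `hat`. -/
theorem lintegral_hat_sq (f : L2) :
    ∫⁻ ζ, ‖hat f ζ‖ₑ ^ 2 = ENNReal.ofReal ((2 * Real.pi) ^ 3) * ∫⁻ z, ‖f z‖ₑ ^ 2 := by
  unfold hat
  rw [lintegral_comp_smul_spaceTime two_pi_inv_pos (fun ζ => ‖(𝓕 f : L2) ζ‖ₑ ^ 2),
    lintegral_fourier_sq]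
  congr 2
  rw [inv_pow, inv_inv]

theorem memLp_hat (f : L2) : MemLp (hat f) 2 volume := by
  rw [memLp_two_iff (measurable_hat f).aestronglyMeasurable, lintegral_hat_sq]
  exact ENNReal.mul_lt_top ENNReal.ofReal_lt_top (lintegral_L2_lt_top f)

/-- Passes almost everywhere identities from the phase `e^{-2πi x·ζ}` to the phase `e^{-i x·ζ}`;
dilations preserve null sets. -/
theorem ae_hat_iff {P : SpaceTime → SpaceTime → Prop}
    (h : ∀ᵐ z : SpaceTime, P z ((2 * Real.pi) • z)) :
    ∀ᵐ ζ : SpaceTime, P ((2 * Real.pi)⁻¹ • ζ) ζ := by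
  have := (measurePreserving_smul_two_pi two_pi_inv_pos.ne').ae h
  filter_upwards [this] with ζ hζ
  rwa [smul_smul, mul_inv_cancel₀ (by positivity), one_smul] at hζ

theorem hat_fourierMul {m : SpaceTime → ℝ} (hm : Measurable m) {B : ℝ} (hB : ∀ ζ, |m ζ| ≤ B)
    (f : L2) : hat (fourierMul m f) =ᵐ[volume] fun ζ => m ζ * hat f ζ := by
  have h := memLp_mul_fourier hm hB f
  have h1 : (𝓕 (fourierMul m f) : L2) = h.toLp _ := by
    rw [fourierMul, dif_pos h, FourierTransform.fourier_fourierInv_eq]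
  have h2 := h.coeFn_toLp
  rw [← h1] at h2
  exact ae_hat_iff (P := fun z ζ => (𝓕 (fourierMul m f) : L2) z = m ζ * (𝓕 f : L2) z) h2

theorem exists_hat_eq {F : SpaceTime → ℂ} (hF : MemLp F 2 volume) :
    ∃ f : L2, hat f =ᵐ[volume] F := by
  have hs : MemLp (fun z : SpaceTime => F ((2 * Real.pi) • z)) 2 volume := by
    have hq := measurePreserving_smul_two_pi (s := 2 * Real.pi) (by positivity)
    rw [memLp_two_iff (f := fun z : SpaceTime => F ((2 * Real.pi) • z))
      (hF.1.comp_quasiMeasurePreserving hq),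
      lintegral_comp_smul_spaceTime (by positivity) (fun ζ => ‖F ζ‖ₑ ^ 2)]
    exact ENNReal.mul_lt_top ENNReal.ofReal_lt_top ((memLp_two_iff hF.1).1 hF)
  refine ⟨𝓕⁻ (hs.toLp _), ?_⟩
  have h1 : ⇑(𝓕 (𝓕⁻ (hs.toLp _) : L2) : L2) =ᵐ[volume]
      fun z : SpaceTime => F ((2 * Real.pi) • z) := by
    rw [FourierTransform.fourier_fourierInv_eq]
    exact hs.coeFn_toLp
  exact ae_hat_iff (P := fun z ζ => (𝓕 (𝓕⁻ (hs.toLp _) : L2) : L2) z = F ζ) h1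

theorem L2_ext_hat {f g : L2} (h : hat f =ᵐ[volume] hat g) : f = g := by
  have h1 : (𝓕 f : L2) = 𝓕 g := by
    refine Lp.ext ?_
    have := (measurePreserving_smul_two_pi (s := 2 * Real.pi) (by positivity)).ae h
    filter_upwards [this] with z hz
    have e : (2 * Real.pi)⁻¹ • (2 * Real.pi) • z = z := by
      rw [smul_smul, inv_mul_cancel₀ (by positivity), one_smul]
    simpa only [hat, e] using hz
  have := congrArg (fun k : L2 => (𝓕⁻ k : L2)) h1
  simpa using this

theorem integrable_fourier_of_hat {f : L2} (h : Integrable (hat f) volume) :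
    Integrable (𝓕 f : L2) volume := by
  have h1 := (integrable_comp_smul_iff volume (𝓕 f : L2) two_pi_inv_pos.ne').1 h
  exact h1

theorem integral_comp_smul_spaceTime {s : ℝ} (hs : 0 < s) (f : SpaceTime → ℂ) :
    ∫ ζ, f (s • ζ) = ((s ^ 3)⁻¹ : ℝ) * ∫ ζ, f ζ := by
  rw [Measure.integral_comp_smul, show Module.finrank ℝ SpaceTime = 3 by simp,
    abs_of_pos (by positivity), Complex.real_smul]

theorem hat_inversion {f : L2} (hf : Integrable (hat f) volume) :
    f =ᵐ[volume] fun x => (((2 * Real.pi) ^ 3)⁻¹ : ℝ) * ∫ ζ, hat f ζ * expi (inner ℝ ζ x) := by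
  filter_upwards [fourier_inversion_Lp f (integrable_fourier_of_hat hf)] with x hx
  rw [hx]
  have h := integral_comp_smul_spaceTime two_pi_inv_pos
    (fun z => (𝓕 f : L2) z * expi (2 * Real.pi * inner ℝ z x))
  have e : ∀ ζ : SpaceTime, 2 * Real.pi * inner ℝ ((2 * Real.pi)⁻¹ • ζ) x = inner ℝ ζ x := by
    intro ζ
    rw [inner_smul_left]; simp; field_simp
  simp only [e] at h
  change ∫ ζ, hat f ζ * expi (inner ℝ ζ x) = _ at h
  rw [h, ← mul_assoc, ← Complex.ofReal_mul]
  simp only [inv_pow, inv_inv]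
  rw [inv_mul_cancel₀ (by positivity)]
  simp

theorem hat_mul {v u w : L2} (hu : Integrable (hat u) volume)
    (hw : w =ᵐ[volume] fun x => v x * u x) :
    hat w =ᵐ[volume] fun ζ => (((2 * Real.pi) ^ 3)⁻¹ : ℝ) * ∫ ζ', hat u ζ' * hat v (ζ - ζ') := by
  have h1 := fourier_mul_Lp v u w (integrable_fourier_of_hat hu) hw
  have h2 := (measurePreserving_smul_two_pi two_pi_inv_pos.ne').ae h1
  filter_upwards [h2] with ζ hζ
  unfold hat
  rw [hζ]
  have h := integral_comp_smul_spaceTime two_pi_inv_pos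
    (fun z => (𝓕 u : L2) z * (𝓕 v : L2) ((2 * Real.pi)⁻¹ • ζ - z))
  simp only [← smul_sub] at h
  rw [h, ← mul_assoc, ← Complex.ofReal_mul]
  simp only [inv_pow, inv_inv]
  rw [inv_mul_cancel₀ (by positivity)]
  simp

theorem hat_superposition {κ : SpaceTime → ℂ} (hκ : Measurable κ) (hκi : Integrable κ volume)
    {p : SpaceTime → SpaceTime} (hp : Measurable p) (f g : L2)
    (hg : g =ᵐ[volume] fun x => ∫ z, κ z * f (x - p z)) :
    hat g =ᵐ[volume] fun ζ => (∫ z, κ z * expi (-inner ℝ (p z) ζ)) * hat f ζ := by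
  have h1 := fourier_superposition hκ hκi hp f g hg
  have h2 := (measurePreserving_smul_two_pi two_pi_inv_pos.ne').ae h1
  filter_upwards [h2] with ζ hζ
  unfold hat
  rw [hζ]
  have e : ∀ z : SpaceTime, 2 * Real.pi * -inner ℝ (p z) ((2 * Real.pi)⁻¹ • ζ)
      = -inner ℝ (p z) ζ := by
    intro z
    rw [inner_smul_right]; field_simp
  simp only [e]

end Hat

/-! ### Space-time coordinates and the shear along the paraboloid. -/

section Coordinates

@[simp] theorem pt_zero (x : Plane) (t : ℝ) : pt x t 0 = x 0 := rfl
@[simp] theorem pt_one (x : Plane) (t : ℝ) : pt x t 1 = x 1 := rfl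
@[simp] theorem pt_two (x : Plane) (t : ℝ) : pt x t 2 = t := rfl
@[simp] theorem spatial_zero (ζ : SpaceTime) : spatial ζ 0 = ζ 0 := rfl
@[simp] theorem spatial_one (ζ : SpaceTime) : spatial ζ 1 = ζ 1 := rfl

@[simp] theorem spatial_pt (x : Plane) (t : ℝ) : spatial (pt x t) = x := by
  ext k; fin_cases k <;> rfl

@[simp] theorem pt_spatial (ζ : SpaceTime) : pt (spatial ζ) (ζ 2) = ζ := by
  ext k; fin_cases k <;> rfl

theorem inner_spaceTime (z ζ : SpaceTime) :
    inner ℝ z ζ = inner ℝ (spatial z) (spatial ζ) + z 2 * ζ 2 := by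
  simp [PiLp.inner_apply, Fin.sum_univ_succ]; ring

theorem inner_plane (x y : Plane) : inner ℝ x y = x 0 * y 0 + x 1 * y 1 := by
  simp [PiLp.inner_apply, Fin.sum_univ_succ]; ring

theorem norm_sq_plane (x : Plane) : ‖x‖ ^ 2 = x 0 ^ 2 + x 1 ^ 2 := by
  rw [EuclideanSpace.norm_sq_eq]; simp

@[fun_prop]
theorem continuous_spatial : Continuous spatial := by
  unfold spatial; fun_prop

theorem continuous_pt : Continuous fun q : Plane × ℝ => pt q.1 q.2 := by
  unfold pt; fun_prop

@[fun_prop]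
theorem measurable_spatial : Measurable spatial := continuous_spatial.measurable

@[fun_prop]
theorem measurable_pt' {α : Type*} [MeasurableSpace α] {f : α → Plane} {g : α → ℝ}
    (hf : Measurable f) (hg : Measurable g) : Measurable fun a => pt (f a) (g a) :=
  continuous_pt.measurable.comp (hf.prodMk hg)

/-- Space-time as a product of time and space. -/
theorem measurePreserving_pt :
    MeasurePreserving (fun q : ℝ × Plane => pt q.2 q.1) (volume.prod volume) volume := by
  have h1 := ((MeasurePreserving.id (volume : Measure ℝ)).prod
    (EuclideanSpace.volume_preserving_symm_measurableEquiv_toLp (Fin 2)))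
  have h2 := (volume_preserving_piFinSuccAbove (fun _ : Fin 3 => ℝ) 2).symm
  have h3 := (EuclideanSpace.volume_preserving_symm_measurableEquiv_toLp (Fin 3)).symm
  have h4 := h3.comp (h2.comp h1)
  convert! h4 using 1
  ext q k
  fin_cases k <;> rfl

theorem lintegral_spaceTime {g : SpaceTime → ℝ≥0∞} (hg : Measurable g) :
    ∫⁻ z, g z = ∫⁻ t, ∫⁻ x : Plane, g (pt x t) := by
  rw [← measurePreserving_pt.lintegral_comp hg, lintegral_prod]
  exact (hg.comp measurePreserving_pt.measurable).aemeasurable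

theorem ae_ae_of_ae_spaceTime {P : SpaceTime → Prop} (h : ∀ᵐ z, P z) :
    ∀ᵐ t : ℝ, ∀ᵐ x : Plane, P (pt x t) :=
  Measure.ae_ae_of_ae_prod (measurePreserving_pt.quasiMeasurePreserving.ae h)

/-- The point of the plane with coordinate `x` in direction `k` and `y` in the other direction. -/
def planePoint (k : Fin 2) (x y : ℝ) : Plane := if k = 0 then !₂[x, y] else !₂[y, x]

theorem planePoint_self (k : Fin 2) (x y : ℝ) : planePoint k x y k = x := by
  fin_cases k <;> simp [planePoint]

theorem planePoint_other (k : Fin 2) (x y : ℝ) : planePoint k x y (1 - k) = y := by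
  fin_cases k <;> simp [planePoint]

theorem continuous_planePoint (k : Fin 2) :
    Continuous fun q : ℝ × ℝ => planePoint k q.1 q.2 := by
  fin_cases k
  · simp only [planePoint]; simp; fun_prop
  · simp only [planePoint]; simp; fun_prop

theorem measurePreserving_planePoint (k : Fin 2) :
    MeasurePreserving (fun q : ℝ × ℝ => planePoint k q.1 q.2) (volume.prod volume) volume := by
  have h1 := (volume_preserving_piFinTwo (fun _ : Fin 2 => ℝ)).symm
  have h2 := (EuclideanSpace.volume_preserving_symm_measurableEquiv_toLp (Fin 2)).symm
  have h3 := h2.comp h1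
  fin_cases k
  · convert! h3 using 1
  · have h4 := h3.comp (Measure.measurePreserving_swap (μ := (volume : Measure ℝ)) (ν := (volume : Measure ℝ)))
    convert! h4 using 1

theorem lintegral_plane (k : Fin 2) {g : Plane → ℝ≥0∞} (hg : Measurable g) :
    ∫⁻ z, g z = ∫⁻ y, ∫⁻ x, g (planePoint k x y) := by
  rw [← (measurePreserving_planePoint k).lintegral_comp hg, lintegral_prod_symm]
  exact (hg.comp (measurePreserving_planePoint k).measurable).aemeasurable

/-- Frequency coordinates adapted to the paraboloid: `((λ, y), x) ↦ (ξ, λ + |ξ|²)` where `ξ` has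
the coordinate `x` in direction `k` and `y` in the other one. -/
def parabolicCoord (k : Fin 2) (q : (ℝ × ℝ) × ℝ) : SpaceTime :=
  pt (planePoint k q.2 q.1.2) (q.1.1 + ‖planePoint k q.2 q.1.2‖ ^ 2)

/-- The shear `λ ↦ λ + |ξ|²` is a translation for each fixed `ξ`; the rest permutes coordinates. -/
theorem measurePreserving_parabolicCoord (k : Fin 2) :
    MeasurePreserving (parabolicCoord k)
      (((volume : Measure ℝ).prod (volume : Measure ℝ)).prod (volume : Measure ℝ)) volume := by
  have hp := measurePreserving_planePoint k
  have hpm := (continuous_planePoint k)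
  -- rearrangement
  have h1 : MeasurePreserving (fun q : (ℝ × ℝ) × ℝ => ((q.2, q.1.2), q.1.1))
      (((volume : Measure ℝ).prod (volume : Measure ℝ)).prod (volume : Measure ℝ))
      (((volume : Measure ℝ).prod (volume : Measure ℝ)).prod (volume : Measure ℝ)) := by
    have a := Measure.measurePreserving_swap (μ := (volume : Measure ℝ).prod (volume : Measure ℝ))
      (ν := (volume : Measure ℝ))
    have b := (MeasurePreserving.id (volume : Measure ℝ)).prod
      (Measure.measurePreserving_swap (μ := (volume : Measure ℝ)) (ν := (volume : Measure ℝ)))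
    have c := (measurePreserving_prodAssoc (volume : Measure ℝ) (volume : Measure ℝ)
      (volume : Measure ℝ)).symm
    exact c.comp (b.comp a)
  have h2 : MeasurePreserving (fun q : (ℝ × ℝ) × ℝ =>
      (planePoint k q.1.1 q.1.2, q.2 + ‖planePoint k q.1.1 q.1.2‖ ^ 2))
      (((volume : Measure ℝ).prod (volume : Measure ℝ)).prod (volume : Measure ℝ))
      ((volume : Measure Plane).prod (volume : Measure ℝ)) := by
    refine hp.skew_product (g := fun (q : ℝ × ℝ) (l : ℝ) => l + ‖planePoint k q.1 q.2‖ ^ 2) ?_ ?_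
    · refine Continuous.measurable ?_
      exact continuous_snd.add ((hpm.comp continuous_fst).norm.pow 2)
    · refine Filter.Eventually.of_forall fun q => ?_
      exact (measurePreserving_add_right volume _).map_eq
  exact measurePreserving_pt.comp (Measure.measurePreserving_swap.comp (h2.comp h1))

theorem measurableEmbedding_parabolicCoord (k : Fin 2) :
    MeasurableEmbedding (parabolicCoord k) := by
  refine (measurePreserving_parabolicCoord k).measurable.measurableEmbedding ?_
  rintro ⟨⟨l, y⟩, x⟩ ⟨⟨l', y'⟩, x'⟩ h
  have h1 := congrArg spatial h
  simp only [parabolicCoord, spatial_pt] at h1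
  have hx : x = x' := by
    have := congrArg (fun z : Plane => z k) h1
    simpa [planePoint_self] using this
  have hy : y = y' := by
    have := congrArg (fun z : Plane => z (1 - k)) h1
    simpa [planePoint_other] using this
  have h2 := congrArg (fun z : SpaceTime => z 2) h
  simp only [parabolicCoord, pt_two] at h2
  subst hx hy
  simpa using h2

/-- The norm `∫ ‖F(·, λ + |·|²)‖_{L²} dλ` of a function on the frequency side. -/
def modNorm (F : SpaceTime → ℂ) : ℝ≥0∞ :=
  ∫⁻ l : ℝ, (∫⁻ y : Plane, ‖F (pt y (l + ‖y‖ ^ 2))‖ₑ ^ 2) ^ (1 / 2 : ℝ)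

theorem measurable_shear : Measurable fun q : ℝ × Plane => pt q.2 (q.1 + ‖q.2‖ ^ 2) := by
  fun_prop

theorem lintegral_spaceTime_shear {g : SpaceTime → ℝ≥0∞} (hg : Measurable g) :
    ∫⁻ z, g z = ∫⁻ l : ℝ, ∫⁻ y : Plane, g (pt y (l + ‖y‖ ^ 2)) := by
  have h1 : ∫⁻ t : ℝ, ∫⁻ x : Plane, g (pt x t) = ∫⁻ x : Plane, ∫⁻ t : ℝ, g (pt x t) :=
    lintegral_lintegral_swap
      (hg.comp (by fun_prop : Measurable fun q : ℝ × Plane => pt q.2 q.1)).aemeasurable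
  have h2 : ∫⁻ l : ℝ, ∫⁻ y : Plane, g (pt y (l + ‖y‖ ^ 2)) =
      ∫⁻ y : Plane, ∫⁻ l : ℝ, g (pt y (l + ‖y‖ ^ 2)) :=
    lintegral_lintegral_swap (hg.comp measurable_shear).aemeasurable
  rw [lintegral_spaceTime hg, h1, h2]
  refine lintegral_congr fun y => ?_
  rw [lintegral_add_right_eq_self (fun t => g (pt y t))]

end Coordinates

/-! ### A one-dimensional quadratic phase without critical points. -/

section TubeBound

/-- Plancherel's theorem on the line. -/
theorem lintegral_sq_fourier_line {g : ℝ → ℂ} (hg : Integrable g volume)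
    (hg2 : MemLp g 2 volume) :
    ∫⁻ t : ℝ, ‖∫ x, g x * expi (t * x)‖ₑ ^ 2 =
      ENNReal.ofReal (2 * Real.pi) * ∫⁻ x, ‖g x‖ₑ ^ 2 := by
  have hc := hg2.coeFn_toLp
  have h1 : Integrable (hg2.toLp g) volume := hg.congr hc.symm
  have h2 := fourier_Lp_ae_eq _ h1
  have h3 : ∫⁻ z, ‖(𝓕 (hg2.toLp g) : Lp ℂ 2 (volume : Measure ℝ)) z‖ₑ ^ 2 =
      ∫⁻ x, ‖g x‖ₑ ^ 2 := by
    have h := Lp.norm_fourier_eq (hg2.toLp g)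
    rw [Lp.norm_def, Lp.norm_def, ENNReal.toReal_eq_toReal_iff' (Lp.eLpNorm_ne_top _)
      (Lp.eLpNorm_ne_top _)] at h
    rw [lintegral_sq_eq_eLpNorm, lintegral_sq_eq_eLpNorm, h, eLpNorm_congr_ae hc]
  rw [← h3]
  have h4 : ∀ z : ℝ, 𝓕 (⇑(hg2.toLp g)) z = ∫ x, g x * expi ((-(2 * Real.pi)) • z * x) := by
    intro z
    rw [fourier_eq_integral_expi]
    refine integral_congr_ae ?_
    filter_upwards [hc] with x hx
    rw [hx]; congr 2; simp; ring
  have h5 : ∫⁻ z, ‖(𝓕 (hg2.toLp g) : Lp ℂ 2 (volume : Measure ℝ)) z‖ₑ ^ 2 =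
      ∫⁻ z : ℝ, ‖∫ x, g x * expi ((-(2 * Real.pi)) • z * x)‖ₑ ^ 2 := by
    refine lintegral_congr_ae ?_
    filter_upwards [h2] with z hz
    rw [hz, h4]
  rw [h5, lintegral_comp_smul (neg_ne_zero.2 Real.two_pi_pos.ne')
    (fun t => ‖∫ x, g x * expi (t * x)‖ₑ ^ 2), ← mul_assoc, ← ENNReal.ofReal_mul (by positivity)]
  have : 2 * Real.pi * |((-(2 * Real.pi)) ^ Module.finrank ℝ ℝ)⁻¹| = 1 := by
    rw [Module.finrank_self, pow_one, abs_inv, abs_neg, abs_of_pos Real.two_pi_pos,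
      mul_inv_cancel₀ Real.two_pi_pos.ne']
  rw [this]; simp

theorem integrable_of_sq_of_bounded {b : ℝ → ℂ} {N : ℝ}
    (hs : ∀ x, b x ≠ 0 → |x| ≤ N) (h2 : MemLp b 2 volume) : Integrable b volume := by
  have h3 : MemLp (Set.indicator (Icc (-N) N) fun _ => (1 : ℂ)) 2 (volume : Measure ℝ) :=
    memLp_indicator_const 2 measurableSet_Icc 1 (Or.inr (by simp))
  refine (memLp_two_mul_integrable h3 h2).congr (Filter.Eventually.of_forall fun x => ?_)
  by_cases hx : b x = 0
  · simp [hx]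
  · have := abs_le.1 (hs x hx)
    simp [indicator_of_mem (show x ∈ Icc (-N) N from this)]

/-- An oscillatory integral with a quadratic phase without critical points, in `L²`. -/
theorem lintegral_sq_quadratic_phase {b : ℝ → ℂ} (hb : Measurable b) {a N : ℝ} (hN : 0 < N)
    (ha : N ≤ |a|) (hs : ∀ x, b x ≠ 0 → |x| ≤ N / 2) :
    ∫⁻ t : ℝ, ‖∫ x, b x * expi (t * (x ^ 2 - 2 * a * x))‖ₑ ^ 2 ≤
      ENNReal.ofReal (2 * Real.pi / N) * ∫⁻ x, ‖b x‖ₑ ^ 2 := by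
  by_cases hfin : ∫⁻ x, ‖b x‖ₑ ^ 2 = ⊤
  · rw [hfin, ENNReal.mul_top]
    · exact le_top
    · simpa using div_pos Real.two_pi_pos hN
  have hb2 : MemLp b 2 volume :=
    (memLp_two_iff hb.aestronglyMeasurable).2 (lt_top_iff_ne_top.2 hfin)
  have hbi := integrable_of_sq_of_bounded hs hb2
  -- `e` is a sign of `a`. Since `|x| ≤ N / 2` and `|a| ≥ N`, the quantity `e * (a - x)` stays at
  -- least `N / 2` on the support.
  obtain ⟨e, he, hea⟩ : ∃ e : ℝ, e * e = 1 ∧ e * a = |a| := by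
    rcases le_total 0 a with h | h
    · exact ⟨1, by norm_num, by rw [abs_of_nonneg h]; ring⟩
    · exact ⟨-1, by norm_num, by rw [abs_of_nonpos h]; ring⟩
  have heabs : |e| = 1 := by
    rcases mul_self_eq_one_iff.1 he with h | h <;> simp [h]
  set s : Set ℝ := Icc (-(N / 2)) (N / 2) with hsdef
  set q : ℝ → ℝ := fun x => x ^ 2 - 2 * a * x with hq
  -- The inverse of `q` on `s`: `(a - x)² = q x + a²`, and the sign of `a - x` there is `e`.
  set r : ℝ → ℝ := fun σ => a - e * Real.sqrt (σ + a ^ 2) with hr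
  have hgap : ∀ x ∈ s, N / 2 ≤ e * (a - x) := by
    intro x hx
    have h1 : |x| ≤ N / 2 := abs_le.2 hx
    have h2 : e * x ≤ |x| := by
      calc e * x ≤ |e * x| := le_abs_self _
        _ = |x| := by rw [abs_mul, heabs, one_mul]
    rw [mul_sub, hea]; linarith
  have habs : ∀ x ∈ s, |2 * x - 2 * a| = 2 * (e * (a - x)) := by
    intro x hx
    have h1 := hgap x hx
    rw [← abs_of_pos (show 0 < 2 * (e * (a - x)) by linarith), abs_mul, abs_mul, heabs, one_mul,
      ← abs_mul, ← abs_neg]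
    congr 1; ring
  have hrq : ∀ x ∈ s, r (q x) = x := by
    intro x hx
    have h1 : q x + a ^ 2 = (e * (a - x)) ^ 2 := by
      have : (e * (a - x)) ^ 2 = (e * e) * (a - x) ^ 2 := by ring
      rw [this, he]; simp only [hq]; ring
    simp only [hr]
    rw [h1, Real.sqrt_sq (by linarith [hgap x hx]), ← mul_assoc, he]; ring
  have hderiv : ∀ x ∈ s, HasDerivWithinAt q (2 * x - 2 * a) s x := by
    intro x _
    have := ((hasDerivAt_id x).pow 2).sub ((hasDerivAt_id x).const_mul (2 * a))
    simp only [id, Nat.cast_ofNat, mul_one] at this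
    exact (this.congr_deriv (by norm_num)).hasDerivWithinAt
  have hinj : InjOn q s := fun x hx y hy h => by rw [← hrq x hx, ← hrq y hy, h]
  have hms : MeasurableSet s := measurableSet_Icc
  have hqs : MeasurableSet (q '' s) :=
    (isCompact_Icc.image (by fun_prop)).isClosed.measurableSet
  have hrm : Measurable r := by fun_prop
  set g0 : ℝ → ℂ := fun σ => b (r σ) / (|2 * r σ - 2 * a| : ℝ) with hg0
  have hg0m : Measurable g0 := by
    refine (hb.comp hrm).div ?_
    fun_prop
  set g : ℝ → ℂ := (q '' s).indicator g0 with hg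
  have hgm : Measurable g := hg0m.indicator hqs
  have hbs : ∀ x, x ∉ s → b x = 0 := fun x hx => by
    by_contra h
    exact hx (abs_le.1 (hs x h))
  -- The amplitude in the variable `σ = q x` is `b / |q'|`. Its square times the Jacobian `|q'|`
  -- leaves `1 / |q'| ≤ 1 / N`, which is the whole gain.
  have hsq : ∫⁻ σ, ‖g σ‖ₑ ^ 2 ≤ ENNReal.ofReal (1 / N) * ∫⁻ x, ‖b x‖ₑ ^ 2 := by
    have h1 : ∫⁻ σ, ‖g σ‖ₑ ^ 2 = ∫⁻ σ in q '' s, ‖g0 σ‖ₑ ^ 2 := by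
      rw [← lintegral_indicator hqs]
      refine lintegral_congr fun σ => ?_
      by_cases h : σ ∈ q '' s <;> simp [hg, h]
    rw [h1, lintegral_image_eq_lintegral_abs_deriv_mul hms hderiv hinj]
    calc _ ≤ ∫⁻ x in s, ENNReal.ofReal (1 / N) * ‖b x‖ₑ ^ 2 := by
          refine setLIntegral_mono' hms fun x hx => ?_
          have hd : 0 < |2 * x - 2 * a| := by rw [habs x hx]; linarith [hgap x hx]
          have hdN : N ≤ |2 * x - 2 * a| := by rw [habs x hx]; linarith [hgap x hx]
          simp only [hg0, hrq x hx]
          rw [← ofReal_norm, ← ofReal_norm, norm_div, Complex.norm_real, Real.norm_eq_abs, abs_abs,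
            ← ENNReal.ofReal_pow (by positivity), ← ENNReal.ofReal_pow (by positivity),
            ← ENNReal.ofReal_mul (by positivity), ← ENNReal.ofReal_mul (by positivity)]
          refine ENNReal.ofReal_le_ofReal ?_
          rw [div_pow, show |2 * x - 2 * a| * (‖b x‖ ^ 2 / |2 * x - 2 * a| ^ 2)
            = (1 / |2 * x - 2 * a|) * ‖b x‖ ^ 2 by field_simp]
          gcongr
      _ ≤ ∫⁻ x, ENNReal.ofReal (1 / N) * ‖b x‖ₑ ^ 2 := setLIntegral_le_lintegral _ _
      _ = _ := lintegral_const_mul _ (by fun_prop)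
  have hg2 : MemLp g 2 volume := by
    rw [memLp_two_iff hgm.aestronglyMeasurable]
    exact hsq.trans_lt (ENNReal.mul_lt_top ENNReal.ofReal_lt_top (lt_top_iff_ne_top.2 hfin))
  have hcv : ∀ t, ∀ x ∈ s, |2 * x - 2 * a| • (g0 (q x) * expi (t * q x)) =
      b x * expi (t * (x ^ 2 - 2 * a * x)) := by
    intro t x hx
    have hd : 0 < |2 * x - 2 * a| := by rw [habs x hx]; linarith [hgap x hx]
    change |2 * x - 2 * a| • (b (r (q x)) / ((|2 * r (q x) - 2 * a| : ℝ) : ℂ) * expi (t * q x)) =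
      b x * expi (t * q x)
    rw [hrq x hx, Complex.real_smul]
    have : ((|2 * x - 2 * a| : ℝ) : ℂ) ≠ 0 := by exact_mod_cast hd.ne'
    rw [← mul_assoc, mul_div_cancel₀ _ this]
  have hint : ∀ t, ∫ x, b x * expi (t * (x ^ 2 - 2 * a * x)) = ∫ σ, g σ * expi (t * σ) := by
    intro t
    have h1 : ∫ σ, g σ * expi (t * σ) = ∫ σ in q '' s, g0 σ * expi (t * σ) := by
      rw [← integral_indicator hqs]
      refine integral_congr_ae (Filter.Eventually.of_forall fun σ => ?_)
      by_cases h : σ ∈ q '' s <;> simp [hg, h]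
    rw [h1, integral_image_eq_integral_abs_deriv_smul hms hderiv hinj,
      setIntegral_congr_fun hms (hcv t), setIntegral_eq_integral_of_forall_compl_eq_zero]
    intro x hx
    simp [hbs x hx]
  have hgi : Integrable g volume := by
    rw [hg, integrable_indicator_iff hqs,
      integrableOn_image_iff_integrableOn_abs_deriv_smul hms hderiv hinj]
    refine (hbi.integrableOn (s := s)).congr_fun (fun x hx => ?_) hms
    have := hcv 0 x hx
    simpa using this.symm
  simp_rw [hint]
  rw [lintegral_sq_fourier_line hgi hg2]
  calc _ ≤ ENNReal.ofReal (2 * Real.pi) * (ENNReal.ofReal (1 / N) * ∫⁻ x, ‖b x‖ₑ ^ 2) := by gcongr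
    _ = _ := by
      rw [← mul_assoc, ← ENNReal.ofReal_mul (by positivity)]
      congr 2; ring

end TubeBound

/-! ### Local smoothing in time along a tube, for frequencies in a unit cell. -/

section TubeBound

theorem modNorm_mono {F G : SpaceTime → ℂ} (h : ∀ ζ, ‖F ζ‖ ≤ ‖G ζ‖) : modNorm F ≤ modNorm G := by
  unfold modNorm
  refine lintegral_mono fun l => ?_
  dsimp only
  gcongr with y
  exact enorm_le_iff_norm_le.2 (h _)

theorem modNorm_congr {F G : SpaceTime → ℂ} (h : F =ᵐ[volume] G) : modNorm F = modNorm G := by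
  have h1 : ∀ᵐ q : ℝ × Plane, F (pt q.2 (q.1 + ‖q.2‖ ^ 2)) = G (pt q.2 (q.1 + ‖q.2‖ ^ 2)) := by
    have h0 : MeasurePreserving (fun q : Plane × ℝ => (q.1, q.2 + ‖q.1‖ ^ 2))
        ((volume : Measure Plane).prod (volume : Measure ℝ))
        ((volume : Measure Plane).prod (volume : Measure ℝ)) := by
      refine (MeasurePreserving.id _).skew_product (g := fun (y : Plane) (l : ℝ) => l + ‖y‖ ^ 2)
        (by fun_prop) (Filter.Eventually.of_forall fun y => ?_)
      exact (measurePreserving_add_right volume _).map_eq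
    have h2 := measurePreserving_pt.comp (Measure.measurePreserving_swap.comp
      (h0.comp Measure.measurePreserving_swap))
    exact h2.quasiMeasurePreserving.ae h
  have h2 := Measure.ae_ae_of_ae_prod h1
  refine lintegral_congr_ae ?_
  filter_upwards [h2] with l hl
  congr 1
  refine lintegral_congr_ae ?_
  filter_upwards [hl] with y hy
  exact congrArg (fun z => ‖z‖ₑ ^ 2) hy

/-- The phase `t ↦ τ - 2 ξ·η` seen along a tube with velocity `-2ξ`. -/
def tubePhase (ξ : Plane) (ζ : SpaceTime) : ℝ := ζ 2 - 2 * inner ℝ ξ (spatial ζ)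

@[fun_prop]
theorem measurable_tubePhase (ξ : Plane) : Measurable (tubePhase ξ) := by
  unfold tubePhase; fun_prop

theorem norm_sq_planePoint (k : Fin 2) (x y : ℝ) : ‖planePoint k x y‖ ^ 2 = x ^ 2 + y ^ 2 := by
  rw [norm_sq_plane]; fin_cases k <;> simp [planePoint]; ring

theorem inner_planePoint (k : Fin 2) (ξ : Plane) (x y : ℝ) :
    inner ℝ ξ (planePoint k x y) = ξ k * x + ξ (1 - k) * y := by
  rw [inner_plane]; fin_cases k <;> simp [planePoint]; ring

/-- Cauchy–Schwarz on an interval of length one. -/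
theorem lintegral_sqrt_le_of_support {h : ℝ → ℝ≥0∞} (hh : Measurable h) (n : ℝ)
    (hs : ∀ y, h y ≠ 0 → |y - n| ≤ 1 / 2) :
    ∫⁻ y, h y ^ (1 / 2 : ℝ) ≤ (∫⁻ y, h y) ^ (1 / 2 : ℝ) := by
  set I : ℝ → ℝ≥0∞ := (Icc (n - 1 / 2) (n + 1 / 2)).indicator 1 with hI
  have hIm : Measurable I := measurable_one.indicator measurableSet_Icc
  have h1 : ∀ y, h y ^ (1 / 2 : ℝ) = I y * h y ^ (1 / 2 : ℝ) := by
    intro y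
    by_cases hy : h y = 0
    · simp [hy]
    · have h2 := abs_le.1 (hs y hy)
      rw [hI, indicator_of_mem (show y ∈ Icc (n - 1 / 2) (n + 1 / 2) from
        ⟨by linarith [h2.1], by linarith [h2.2]⟩)]
      simp
  rw [lintegral_congr h1]
  refine (lintegral_mul_le_sqrt hIm.aemeasurable (hh.pow_const _).aemeasurable).trans ?_
  simp_rw [ENNReal_rpow_half_sq]
  have h3 : ∫⁻ y, I y ^ 2 = 1 := by
    have : ∀ y, I y ^ 2 = (Icc (n - 1 / 2) (n + 1 / 2)).indicator 1 y := by
      intro y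
      by_cases hy : y ∈ Icc (n - 1 / 2) (n + 1 / 2) <;> simp only [hI, hy, indicator_of_mem,
        indicator_of_notMem, not_false_eq_true] <;> simp
    simp_rw [this]
    rw [lintegral_indicator_one measurableSet_Icc, Real.volume_Icc]
    norm_num
  rw [h3]; simp

/-- On `τ = λ + |η|²` the tube phase is a function of `(λ, y)` plus `x² - 2 ξ_k x`, with `x` the
coordinate in the direction `k` where `ξ` is large. Minkowski in `(λ, y)` discards the first part,
the one-dimensional estimate treats `x`, and the cell confines `y` to a unit interval, so that
integrating the norms in `y` costs nothing. -/
theorem lintegral_sq_tubePhase_le {F : SpaceTime → ℂ} (hF : Measurable F) {ξ : Plane}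
    {n : Fin 2 → ℤ} {k : Fin 2} {N : ℝ} (hN : 0 < N) (hξ : N ≤ |ξ k|)
    (hs : ∀ ζ, F ζ ≠ 0 → (∀ k', |spatial ζ k' - n k'| ≤ 1 / 2) ∧ |spatial ζ k| ≤ N / 2) :
    (∫⁻ t : ℝ, ‖∫ ζ, F ζ * expi (t * tubePhase ξ ζ)‖ₑ ^ 2) ^ (1 / 2 : ℝ) ≤
      ENNReal.ofReal (2 * Real.pi / N) ^ (1 / 2 : ℝ) * modNorm F := by
  by_cases hFi : Integrable F volume
  swap
  -- If `F` is not integrable, neither is its product with a unimodular function, and the integral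
  -- takes the default value `0`.
  · have h0 : ∀ t : ℝ, ∫ ζ, F ζ * expi (t * tubePhase ξ ζ) = 0 := by
      intro t
      refine integral_undef fun h => hFi ?_
      have h1 := h.mul_bdd (c := 1) (g := fun ζ => expi (-(t * tubePhase ξ ζ)))
        (by fun_prop) (Filter.Eventually.of_forall fun ζ => by simp)
      refine h1.congr (Filter.Eventually.of_forall fun ζ => ?_)
      simp only
      rw [mul_assoc, ← expi_add]; simp
    simp [h0]
  set W := parabolicCoord k with hW
  have hWm : Measurable W := (measurePreserving_parabolicCoord k).measurable
  have hWe := measurableEmbedding_parabolicCoord k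
  set B : ℝ → ℝ × ℝ → ℝ≥0∞ := fun t q =>
    ‖∫ x, F (W (q, x)) * expi (t * (x ^ 2 - 2 * ξ k * x))‖ₑ with hB
  have hphase : ∀ (q : ℝ × ℝ) (x : ℝ), tubePhase ξ (W (q, x)) =
      (q.1 + q.2 ^ 2 - 2 * ξ (1 - k) * q.2) + (x ^ 2 - 2 * ξ k * x) := by
    intro q x
    simp only [hW, parabolicCoord, tubePhase, pt_two, spatial_pt, norm_sq_planePoint,
      inner_planePoint]
    ring
  have h1 : ∀ t, ‖∫ ζ, F ζ * expi (t * tubePhase ξ ζ)‖ₑ ≤ ∫⁻ q, B t q := by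
    intro t
    have hi : Integrable (fun ζ => F ζ * expi (t * tubePhase ξ ζ)) volume :=
      hFi.mul_bdd (c := 1) (by fun_prop) (Filter.Eventually.of_forall fun ζ => by simp)
    rw [← (measurePreserving_parabolicCoord k).integral_comp hWe, integral_prod]
    · refine (enorm_integral_le_lintegral_enorm _).trans (le_of_eq ?_)
      refine lintegral_congr fun q => ?_
      simp only [hB]
      have : ∀ x, F (parabolicCoord k (q, x)) * expi (t * tubePhase ξ (parabolicCoord k (q, x))) =
          expi (t * (q.1 + q.2 ^ 2 - 2 * ξ (1 - k) * q.2)) *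
            (F (W (q, x)) * expi (t * (x ^ 2 - 2 * ξ k * x))) := by
        intro x
        have h2 := hphase q x
        rw [← hW, h2, mul_add, expi_add]; ring
      simp_rw [this]
      rw [integral_const_mul, enorm_mul, enorm_expi, one_mul]
    · exact ((measurePreserving_parabolicCoord k).integrable_comp_emb hWe).2 hi
  have hBm : Measurable (Function.uncurry B) := by
    have : StronglyMeasurable fun p : ℝ × (ℝ × ℝ) =>
        ∫ x, F (W (p.2, x)) * expi (p.1 * (x ^ 2 - 2 * ξ k * x)) := by
      refine StronglyMeasurable.integral_prod_right'
        (f := fun p : (ℝ × (ℝ × ℝ)) × ℝ =>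
          F (W (p.1.2, p.2)) * expi (p.1.1 * (p.2 ^ 2 - 2 * ξ k * p.2))) ?_
      refine Measurable.stronglyMeasurable ?_
      refine (hF.comp (hWm.comp (by fun_prop))).mul (by fun_prop)
    exact this.measurable.enorm
  have hFW : Measurable fun p : (ℝ × ℝ) × ℝ => ‖F (W p)‖ₑ ^ 2 :=
    ((hF.comp hWm).enorm).pow_const 2
  have h2 : ∀ q, (∫⁻ t, B t q ^ 2) ^ (1 / 2 : ℝ) ≤ ENNReal.ofReal (2 * Real.pi / N) ^ (1 / 2 : ℝ) *
      (∫⁻ x, ‖F (W (q, x))‖ₑ ^ 2) ^ (1 / 2 : ℝ) := by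
    intro q
    rw [← ENNReal.mul_rpow_of_nonneg _ _ (by norm_num)]
    gcongr
    refine lintegral_sq_quadratic_phase (b := fun x => F (W (q, x))) ?_ hN hξ ?_
    · exact hF.comp (hWm.comp measurable_prodMk_left)
    · intro x hx
      have := (hs _ hx).2
      simpa [hW, parabolicCoord, planePoint_self] using this
  have h3 : ∫⁻ q : ℝ × ℝ, (∫⁻ x, ‖F (W (q, x))‖ₑ ^ 2) ^ (1 / 2 : ℝ) ≤ modNorm F := by
    have hm : Measurable fun q : ℝ × ℝ => ∫⁻ x, ‖F (W (q, x))‖ₑ ^ 2 := hFW.lintegral_prod_right'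
    rw [Measure.volume_eq_prod, lintegral_prod _ (hm.pow_const _).aemeasurable]
    refine lintegral_mono fun l => ?_
    refine (lintegral_sqrt_le_of_support (hm.comp measurable_prodMk_left) (n (1 - k)) ?_).trans
      (le_of_eq ?_)
    · intro y hy
      by_contra hcon
      refine hy ?_
      change ∫⁻ x, ‖F (W ((l, y), x))‖ₑ ^ 2 = 0
      have h5 : ∀ x, F (W ((l, y), x)) = 0 := by
        intro x
        by_contra h4
        have := (hs _ h4).1 (1 - k)
        simp only [hW, parabolicCoord, spatial_pt, planePoint_other] at this
        exact hcon this
      simp [h5]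
    · congr 1
      rw [lintegral_plane k]
      · rfl
      · have : Measurable fun y : Plane => F (pt y (l + ‖y‖ ^ 2)) := hF.comp (by fun_prop)
        fun_prop
  calc _ ≤ (∫⁻ t : ℝ, (∫⁻ q, B t q) ^ 2) ^ (1 / 2 : ℝ) := by
        gcongr with t; exact h1 t
    _ ≤ ∫⁻ q, (∫⁻ t, B t q ^ 2) ^ (1 / 2 : ℝ) := lintegral_minkowski hBm
    _ ≤ ∫⁻ q : ℝ × ℝ, ENNReal.ofReal (2 * Real.pi / N) ^ (1 / 2 : ℝ) *
        (∫⁻ x, ‖F (W (q, x))‖ₑ ^ 2) ^ (1 / 2 : ℝ) := lintegral_mono h2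
    _ = ENNReal.ofReal (2 * Real.pi / N) ^ (1 / 2 : ℝ) *
        ∫⁻ q : ℝ × ℝ, (∫⁻ x, ‖F (W (q, x))‖ₑ ^ 2) ^ (1 / 2 : ℝ) :=
        lintegral_const_mul _ ((hFW.lintegral_prod_right').pow_const _)
    _ ≤ _ := by gcongr

end TubeBound

/-! ### A majorant uniform over the cross-sections of a tube. -/

section TubeBound

/-- The Taylor coefficients of a product of two exponentials. -/
def expCoeff (p : ℕ × ℕ) : ℝ := 1 / (p.1.factorial * p.2.factorial)

theorem expCoeff_nonneg (p : ℕ × ℕ) : 0 ≤ expCoeff p := by unfold expCoeff; positivity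

theorem summable_expCoeff : Summable expCoeff := by
  have h := Real.summable_pow_div_factorial 1
  have := h.mul_of_nonneg h (fun n => by positivity) (fun n => by positivity)
  refine this.congr fun p => ?_
  simp [expCoeff]; ring

/-- The sum of all `expCoeff`, that is `e²`. -/
def tubeConst : ℝ≥0∞ := ∑' p, ENNReal.ofReal (expCoeff p)

theorem tubeConst_ne_top : tubeConst ≠ ⊤ := by
  rw [tubeConst, ← ENNReal.ofReal_tsum_of_nonneg expCoeff_nonneg summable_expCoeff]
  exact ENNReal.ofReal_ne_top

theorem hasSum_expi (r : ℝ) :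
    HasSum (fun n : ℕ => ((r : ℂ) * Complex.I) ^ n / n.factorial) (expi r) := by
  have := NormedSpace.expSeries_div_hasSum_exp ((r : ℂ) * Complex.I)
  rw [← Complex.exp_eq_exp_ℂ] at this
  exact this

theorem summable_norm_expi (r : ℝ) :
    Summable fun n : ℕ => ‖((r : ℂ) * Complex.I) ^ n / n.factorial‖ :=
  NormedSpace.norm_expSeries_div_summable _

theorem hasSum_mul_prod {f g : ℕ → ℂ} {a b : ℂ} (hf : HasSum f a) (hg : HasSum g b)
    (hf' : Summable fun n => ‖f n‖) (hg' : Summable fun n => ‖g n‖) :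
    HasSum (fun p : ℕ × ℕ => f p.1 * g p.2) (a * b) :=
  hf.mul hg (summable_mul_of_summable_norm hf' hg')

theorem hasSum_expi_add (a b : ℝ) :
    HasSum (fun p : ℕ × ℕ => (expCoeff p : ℂ) * ((a * Complex.I) ^ p.1 * (b * Complex.I) ^ p.2))
      (expi (a + b)) := by
  rw [expi_add]
  have h1 := hasSum_mul_prod (hasSum_expi a) (hasSum_expi b) (summable_norm_expi a)
    (summable_norm_expi b)
  have h2 : (fun p : ℕ × ℕ => (expCoeff p : ℂ) * ((a * Complex.I) ^ p.1 * (b * Complex.I) ^ p.2)) =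
      fun p => ((a : ℂ) * Complex.I) ^ p.1 / p.1.factorial *
        (((b : ℂ) * Complex.I) ^ p.2 / p.2.factorial) := by
    funext p
    simp only [expCoeff]
    push_cast
    ring
  rw [h2]
  exact h1
-- The countable triangle inequality in `L²`, from Minkowski with the counting measure inside.
theorem summable_lintegral_mul_le {α : Type*} [MeasurableSpace α] {μ : Measure α} [SFinite μ]
    {ι : Type*} [Countable ι] {f : ι → α → ℝ≥0∞} (hf : ∀ i, Measurable (f i)) :
    (∫⁻ x, (∑' i, f i x) ^ 2 ∂μ) ^ (1 / 2 : ℝ) ≤ ∑' i, (∫⁻ x, f i x ^ 2 ∂μ) ^ (1 / 2 : ℝ) := by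
  let _ : MeasurableSpace ι := ⊤
  have : MeasurableSingletonClass ι := ⟨fun _ => trivial⟩
  have := lintegral_minkowski (μ := μ) (ν := (Measure.count : Measure ι)) (F := fun x i => f i x)
    (measurable_from_prod_countable_left fun i => hf i)
  simpa [lintegral_count] using this

theorem abs_pow_le_one_of_abs_le {x : ℝ} (h : |x| ≤ 1 / 2) (p : ℕ) : |x ^ p| ≤ 1 := by
  rw [abs_pow]; exact pow_le_one₀ (abs_nonneg x) (by linarith)

/-- On a tube of velocity `-2ξ`, a function with Fourier transform `F` in a unit cell is bounded
by a function of time with an `L²` gain. -/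
theorem exists_tube_majorant {F : SpaceTime → ℂ} (hF : Measurable F) (hFi : Integrable F volume)
    {ξ : Plane} {n : Fin 2 → ℤ} {k : Fin 2} {N : ℝ} (hN : 0 < N) (hξ : N ≤ |ξ k|)
    (hs : ∀ ζ, F ζ ≠ 0 → (∀ k', |spatial ζ k' - n k'| ≤ 1 / 2) ∧ |spatial ζ k| ≤ N / 2)
    (m : Fin 2 → ℤ) :
    ∃ U : ℝ → ℝ≥0∞, Measurable U ∧
      (∀ t, ∀ x ∈ tubeSlice ξ m t, ‖∫ ζ, F ζ * expi (inner ℝ ζ (pt x t))‖ₑ ≤ U t) ∧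
      (∫⁻ t, U t ^ 2) ^ (1 / 2 : ℝ) ≤
        tubeConst * (ENNReal.ofReal (2 * Real.pi / N) ^ (1 / 2 : ℝ) * modNorm F) := by
  set h : SpaceTime → Fin 2 → ℝ := fun ζ k' => spatial ζ k' - n k' with hh
  set μm : SpaceTime → ℝ := fun ζ => spatial ζ 0 * m 0 + spatial ζ 1 * m 1 with hμ
  have hm0 : ∀ k', Measurable fun ζ => h ζ k' := fun k' => by simp only [hh]; fun_prop
  have hmμ : Measurable μm := by simp only [hμ]; fun_prop
  -- Everything in the `p`-th Taylor term that depends on `ζ` but not on the position in the slice.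
  -- The size and support of `F` are not increased, because the offsets `h` from the centre of the
  -- cell are at most `1 / 2`.
  set G : ℕ × ℕ → SpaceTime → ℂ := fun p ζ =>
    F ζ * ((h ζ 0 ^ p.1 * h ζ 1 ^ p.2 : ℝ) * expi (μm ζ)) with hG
  have hGm : ∀ p, Measurable (G p) := by
    intro p
    have := hm0 0; have := hm0 1
    simp only [hG]; fun_prop
  have hGF : ∀ p ζ, ‖G p ζ‖ ≤ ‖F ζ‖ := by
    intro p ζ
    by_cases h0 : F ζ = 0
    · simp [hG, h0]
    · have h1 := (hs ζ h0).1
      simp only [hG, norm_mul, norm_expi, mul_one, Complex.norm_real, Real.norm_eq_abs]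
      have h2 := abs_pow_le_one_of_abs_le (h1 0) p.1
      have h3 := abs_pow_le_one_of_abs_le (h1 1) p.2
      exact mul_le_of_le_one_right (norm_nonneg _) (mul_le_one₀ h2 (abs_nonneg _) h3)
  set A : ℕ × ℕ → ℝ → ℝ≥0∞ := fun p t => ‖∫ ζ, G p ζ * expi (t * tubePhase ξ ζ)‖ₑ with hA
  have hAm : ∀ p, Measurable (A p) := by
    intro p
    have : StronglyMeasurable fun t : ℝ => ∫ ζ, G p ζ * expi (t * tubePhase ξ ζ) := by
      refine StronglyMeasurable.integral_prod_right'
        (f := fun q : ℝ × SpaceTime => G p q.2 * expi (q.1 * tubePhase ξ q.2)) ?_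
      have := hGm p
      exact (show Measurable _ by fun_prop).stronglyMeasurable
    exact this.measurable.enorm
  have hA2 : ∀ p, (∫⁻ t, A p t ^ 2) ^ (1 / 2 : ℝ) ≤
      ENNReal.ofReal (2 * Real.pi / N) ^ (1 / 2 : ℝ) * modNorm F := by
    intro p
    refine (lintegral_sq_tubePhase_le (hGm p) (n := n) hN hξ fun ζ hζ => hs ζ ?_).trans ?_
    · intro h0; exact hζ (by simp [hG, h0])
    · gcongr; exact modNorm_mono (hGF p)
  refine ⟨fun t => ∑' p, ENNReal.ofReal (expCoeff p) * A p t, ?_, ?_, ?_⟩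
  · exact Measurable.tsum fun p => (hAm p).const_mul _
  · intro t x hx
    set w : Fin 2 → ℝ := fun k' => x k' + 2 * t * ξ k' - m k' with hw
    have hwb : ∀ k', |w k'| ≤ 1 / 2 := by
      intro k'
      have h1 := hx k'
      simp only [PiLp.add_apply, PiLp.smul_apply, smul_eq_mul, mem_Ico] at h1
      rw [abs_le]; constructor <;> simp only [hw] <;> linarith [h1.1, h1.2]
    set c : ℝ := n 0 * w 0 + n 1 * w 1 with hc
    -- With `x = m - 2tξ + w` and frequency `n + h`, the only coupling of `x` with `ζ` is `h·w`.
    -- Both vectors have coordinates at most `1 / 2`, so expanding `e^{i h·w}` separates the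
    -- variables with summable coefficients.
    have hphase : ∀ ζ, inner ℝ ζ (pt x t) =
        c + (μm ζ + (t * tubePhase ξ ζ + (h ζ 0 * w 0 + h ζ 1 * w 1))) := by
      intro ζ
      rw [inner_spaceTime, inner_plane]
      simp only [tubePhase, inner_plane, hμ, hh, hw, hc, spatial_pt, pt_two]
      ring
    set f : ℕ × ℕ → SpaceTime → ℂ := fun p ζ =>
      (expCoeff p * ((w 0 * Complex.I) ^ p.1 * (w 1 * Complex.I) ^ p.2) * expi c) *
        (G p ζ * expi (t * tubePhase ξ ζ)) with hf
    have hsum : ∀ ζ, HasSum (fun p => f p ζ) (F ζ * expi (inner ℝ ζ (pt x t))) := by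
      intro ζ
      have h1 := (hasSum_expi_add (h ζ 0 * w 0) (h ζ 1 * w 1)).mul_left
        (F ζ * (expi c * (expi (μm ζ) * expi (t * tubePhase ξ ζ))))
      rw [hphase, expi_add c, expi_add (μm ζ), expi_add (t * tubePhase ξ ζ)]
      convert! h1 using 1
      · ext p
        simp only [hf, hG]; push_cast; ring
      · ring
    have hGi : ∀ p, Integrable (fun ζ => G p ζ * expi (t * tubePhase ξ ζ)) volume := by
      intro p
      have : Integrable (G p) volume :=
        hFi.mono (hGm p).aestronglyMeasurable (Filter.Eventually.of_forall (hGF p))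
      exact this.mul_bdd (c := 1) (by fun_prop) (Filter.Eventually.of_forall fun ζ => by simp)
    have hcoef : ∀ p, ‖(expCoeff p * ((w 0 * Complex.I) ^ p.1 * (w 1 * Complex.I) ^ p.2) * expi c :
        ℂ)‖ ≤ expCoeff p := by
      intro p
      rw [norm_mul, norm_mul, norm_expi, mul_one, Complex.norm_real, Real.norm_eq_abs,
        abs_of_nonneg (expCoeff_nonneg p), norm_mul, norm_pow, norm_pow, norm_mul, norm_mul,
        Complex.norm_I, Complex.norm_real, Complex.norm_real, Real.norm_eq_abs, Real.norm_eq_abs,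
        mul_one, mul_one, ← abs_pow, ← abs_pow]
      exact mul_le_of_le_one_right (expCoeff_nonneg p)
        (mul_le_one₀ (abs_pow_le_one_of_abs_le (hwb 0) _) (abs_nonneg _)
          (abs_pow_le_one_of_abs_le (hwb 1) _))
    have hfs : Summable fun p => ∫ ζ, ‖f p ζ‖ := by
      refine Summable.of_nonneg_of_le (fun p => integral_nonneg fun ζ => norm_nonneg _) (fun p => ?_)
        (summable_expCoeff.mul_right (∫ ζ, ‖F ζ‖))
      rw [← integral_const_mul]
      refine integral_mono ((hGi p).const_mul _).norm (hFi.norm.const_mul _) fun ζ => ?_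
      simp only [hf]
      rw [norm_mul, norm_mul (G p ζ), norm_expi, mul_one]
      exact mul_le_mul (hcoef p) (hGF p ζ) (norm_nonneg _) (expCoeff_nonneg p)
    have hS := hasSum_integral_of_summable_integral_norm (fun p => (hGi p).const_mul _) hfs
    have heq : ∫ ζ, ∑' p, f p ζ = ∫ ζ, F ζ * expi (inner ℝ ζ (pt x t)) :=
      integral_congr_ae (Filter.Eventually.of_forall fun ζ => (hsum ζ).tsum_eq)
    rw [← heq, ← hS.tsum_eq]
    refine enorm_tsum_le_tsum_enorm.trans (ENNReal.tsum_le_tsum fun p => ?_)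
    rw [integral_const_mul, enorm_mul]
    gcongr
    rw [← ofReal_norm]
    exact ENNReal.ofReal_le_ofReal (hcoef p)
  · refine (summable_lintegral_mul_le fun p => (hAm p).const_mul _).trans ?_
    rw [tubeConst, ← ENNReal.tsum_mul_right]
    refine ENNReal.tsum_le_tsum fun p => ?_
    simp_rw [mul_pow]
    rw [lintegral_const_mul _ ((hAm p).pow_const 2), ENNReal.mul_rpow_of_nonneg _ _ (by norm_num),
      ENNReal_sq_rpow_half]
    gcongr
    exact hA2 p

end TubeBound

/-! ### Geometry of the polar lattice and the count of interactions. -/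

section Counting

theorem parabolicSize_sq (ζ : SpaceTime) : parabolicSize ζ ^ 2 = |ζ 2| + ‖spatial ζ‖ ^ 2 :=
  Real.sq_sqrt (by positivity)

theorem parabolicSize_nonneg (ζ : SpaceTime) : 0 ≤ parabolicSize ζ := Real.sqrt_nonneg _

/-- The point of the polar lattice with radius `ρ` and angle `(π/2)(k/ρ)`. -/
def latticePoint (ρ k : ℕ) : Plane :=
  !₂[ρ * Real.cos (Real.pi / 2 * (k / ρ)), ρ * Real.sin (Real.pi / 2 * (k / ρ))]

/-- Increasing `k` by `4ρ` adds `2π` to the angle, so `k` may be reduced modulo `4ρ`. -/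
theorem exists_latticePoint (ξ : lattice) :
    ∃ q : ℕ × ℕ, 0 < q.1 ∧ q.2 < 4 * q.1 ∧ (ξ : Plane) = latticePoint q.1 q.2 := by
  obtain ⟨ξ, ρ, k, hρ, _, rfl⟩ := ξ
  refine ⟨(ρ, k % (4 * ρ)), hρ, Nat.mod_lt _ (by omega), ?_⟩
  have hρ' : (ρ : ℝ) ≠ 0 := by positivity
  have h1 : Real.pi / 2 * ((k : ℝ) / ρ) =
      Real.pi / 2 * (((k % (4 * ρ) : ℕ) : ℝ) / ρ) + (k / (4 * ρ) : ℕ) * (2 * Real.pi) := by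
    have h2 : (k : ℝ) = ((k % (4 * ρ) : ℕ) : ℝ) + 4 * ρ * ((k / (4 * ρ) : ℕ) : ℝ) := by
      exact_mod_cast (Nat.mod_add_div k (4 * ρ)).symm
    rw [h2]
    have h3 : (k % (4 * ρ) + 4 * ρ * (k / (4 * ρ))) = k := Nat.mod_add_div k (4 * ρ)
    field_simp
    ring
  simp only [latticePoint]
  rw [h1, Real.cos_add_nat_mul_two_pi, Real.sin_add_nat_mul_two_pi]

/-- Polar coordinates of a lattice point. -/
def polarIndex (ξ : lattice) : ℕ × ℕ := (exists_latticePoint ξ).choose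

theorem polarIndex_spec (ξ : lattice) : 0 < (polarIndex ξ).1 ∧
    (polarIndex ξ).2 < 4 * (polarIndex ξ).1 ∧
    (ξ : Plane) = latticePoint (polarIndex ξ).1 (polarIndex ξ).2 :=
  (exists_latticePoint ξ).choose_spec

theorem polarIndex_injective : Function.Injective polarIndex := by
  intro ξ η h
  apply Subtype.ext
  rw [(polarIndex_spec ξ).2.2, (polarIndex_spec η).2.2, h]

instance : Countable lattice := polarIndex_injective.countable

theorem norm_latticePoint (ρ k : ℕ) : ‖latticePoint ρ k‖ = ρ := by
  have h : ‖latticePoint ρ k‖ ^ 2 = (ρ : ℝ) ^ 2 := by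
    rw [norm_sq_plane]
    simp only [latticePoint, PiLp.toLp_apply, Matrix.cons_val_zero, Matrix.cons_val_one]
    nlinarith [Real.sin_sq_add_cos_sq (Real.pi / 2 * (k / ρ))]
  exact (pow_left_inj₀ (norm_nonneg _) (by positivity) two_ne_zero).1 h

theorem norm_lattice (ξ : lattice) : ‖(ξ : Plane)‖ = (polarIndex ξ).1 := by
  conv_lhs => rw [(polarIndex_spec ξ).2.2]
  exact norm_latticePoint _ _

/-- Points on a circle of the polar lattice are separated by the difference of their indices. -/
theorem dist_latticePoint_ge {ρ k k' : ℕ} (hρ : 0 < ρ) (hk : k < 4 * ρ) (hk' : k' ≤ k) :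
    min ((k : ℝ) - k') (4 * ρ - (k - k')) ≤ dist (latticePoint ρ k) (latticePoint ρ k') := by
  set m : ℝ := (k : ℝ) - k' with hm
  have hρ' : (0 : ℝ) < ρ := by exact_mod_cast hρ
  have hm0 : 0 ≤ m := by rw [hm, sub_nonneg]; exact_mod_cast hk'
  have hm4 : m ≤ 4 * ρ := by
    have : (k : ℝ) < 4 * ρ := by exact_mod_cast hk
    have : (0 : ℝ) ≤ k' := by positivity
    linarith
  -- Chord length: twice the radius times the sine of half the angle.
  have hsq : dist (latticePoint ρ k) (latticePoint ρ k') ^ 2 =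
      (2 * ρ * Real.sin (Real.pi * m / (4 * ρ))) ^ 2 := by
    rw [dist_eq_norm, norm_sq_plane]
    simp only [latticePoint, PiLp.sub_apply, Matrix.cons_val_zero, Matrix.cons_val_one]
    set a := Real.pi / 2 * ((k : ℝ) / ρ)
    set b := Real.pi / 2 * ((k' : ℝ) / ρ)
    have h1 : 2 * (Real.pi * m / (4 * ρ)) = a - b := by
      simp only [a, b, hm]; field_simp; ring
    have h2 : Real.cos (a - b) = 1 - 2 * Real.sin (Real.pi * m / (4 * ρ)) ^ 2 := by
      rw [← h1, Real.cos_two_mul']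
      nlinarith [Real.sin_sq_add_cos_sq (Real.pi * m / (4 * ρ))]
    rw [Real.cos_sub] at h2
    have ha := Real.sin_sq_add_cos_sq a
    have hb := Real.sin_sq_add_cos_sq b
    linear_combination (ρ : ℝ) ^ 2 * ha + (ρ : ℝ) ^ 2 * hb - 2 * (ρ : ℝ) ^ 2 * h2
  -- Jordan's inequality `sin x ≥ 2x/π`, for the half angle or for its supplement, whichever is
  -- acute.
  have hsin : min m (4 * ρ - m) / (2 * ρ) ≤ Real.sin (Real.pi * m / (4 * ρ)) := by
    rcases le_total m (2 * ρ) with h | h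
    · have h1 := Real.mul_le_sin (x := Real.pi * m / (4 * ρ)) (by positivity) (by
        rw [div_le_iff₀ (by positivity)]; nlinarith [Real.pi_pos])
      refine le_trans ?_ h1
      calc min m (4 * ρ - m) / (2 * ρ) ≤ m / (2 * ρ) := by gcongr; exact min_le_left _ _
        _ = _ := by field_simp; ring
    · have h0 : 0 ≤ 4 * (ρ : ℝ) - m := by linarith
      have h1 := Real.mul_le_sin (x := Real.pi * (4 * ρ - m) / (4 * ρ)) (by positivity) (by
        rw [div_le_iff₀ (by positivity)]; nlinarith [Real.pi_pos])
      have h2 : Real.sin (Real.pi * m / (4 * ρ)) = Real.sin (Real.pi * (4 * ρ - m) / (4 * ρ)) := by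
        rw [← Real.sin_pi_sub]; congr 1; field_simp
      rw [h2]
      refine le_trans ?_ h1
      calc min m (4 * ρ - m) / (2 * ρ) ≤ (4 * ρ - m) / (2 * ρ) := by gcongr; exact min_le_right _ _
        _ = _ := by field_simp; ring
  have hmin : 0 ≤ min m (4 * ρ - m) := le_min hm0 (by linarith)
  refine (pow_le_pow_iff_left₀ hmin dist_nonneg two_ne_zero).1 ?_
  rw [hsq]
  refine pow_le_pow_left₀ hmin ?_ 2
  rw [div_le_iff₀ (by positivity)] at hsin
  linarith

/-- A finite set of lattice points on one circle, with diameter at most `D`, has `O(D)` points. -/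
theorem card_circle_le (S : Finset lattice) (ρ D : ℕ) (hρ : ∀ ξ ∈ S, (polarIndex ξ).1 = ρ)
    (hD : ∀ ξ ∈ S, ∀ η ∈ S, dist (ξ : Plane) η ≤ D) : S.card ≤ 3 * (2 * D + 1) := by
  rcases S.eq_empty_or_nonempty with rfl | ⟨ξ₀, hξ₀⟩
  · simp
  set k₀ : ℤ := (((polarIndex ξ₀).2 : ℕ) : ℤ) with hk₀
  have hcard : ∀ a : ℤ, (Finset.Icc (a - D) (a + D)).card = 2 * D + 1 := by
    intro a; rw [Int.card_Icc]; omega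
  -- Closeness on the circle means closeness of indices modulo `4ρ`; as indices lie in `[0, 4ρ)`,
  -- three windows suffice.
  set I := Finset.Icc (k₀ - D) (k₀ + D) ∪ Finset.Icc (k₀ + 4 * ρ - D) (k₀ + 4 * ρ + D) ∪
    Finset.Icc (k₀ - 4 * ρ - D) (k₀ - 4 * ρ + D) with hI
  have hIc : I.card ≤ 3 * (2 * D + 1) := by
    refine (Finset.card_union_le _ _).trans ?_
    have h1 := Finset.card_union_le (Finset.Icc (k₀ - D) (k₀ + D))
      (Finset.Icc (k₀ + 4 * ρ - D) (k₀ + 4 * ρ + D))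
    rw [hcard, hcard] at h1
    rw [hcard]; omega
  refine le_trans (Finset.card_le_card_of_injOn (fun ξ => ((polarIndex ξ).2 : ℤ)) ?_ ?_) hIc
  · intro ξ hξ
    have h1 := polarIndex_spec ξ
    have h0 := polarIndex_spec ξ₀
    rw [hρ ξ hξ] at h1
    rw [hρ ξ₀ hξ₀] at h0
    have hd := hD ξ hξ ξ₀ hξ₀
    rw [h1.2.2, h0.2.2] at hd
    have key : ∀ a b : ℕ, a < 4 * ρ → b ≤ a → dist (latticePoint ρ a) (latticePoint ρ b) ≤ D →
        (a : ℤ) - b ≤ D ∨ 4 * (ρ : ℤ) - (a - b) ≤ D := by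
      intro a b ha hb hab
      have h2 := (dist_latticePoint_ge h1.1 ha hb).trans hab
      rcases min_le_iff.1 h2 with h3 | h3
      · left; exact_mod_cast h3
      · right; exact_mod_cast h3
    simp only [hI, Finset.coe_union, Finset.coe_Icc, mem_union, mem_Icc]
    rcases le_total (polarIndex ξ₀).2 (polarIndex ξ).2 with h | h
    · rcases key _ _ h1.2.1 h hd with h2 | h2 <;> omega
    · rw [dist_comm] at hd
      rcases key _ _ h0.2.1 h hd with h2 | h2 <;> omega
  · intro ξ hξ η hη h
    apply polarIndex_injective
    refine Prod.ext ?_ ?_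
    · rw [hρ ξ hξ, hρ η hη]
    · have h' : (((polarIndex ξ).2 : ℕ) : ℤ) = ((polarIndex η).2 : ℕ) := h
      exact_mod_cast h'

/-- The frequency cell `n` and the lattice point `ξ` interact at `ζ`: some `ζᵤ` of size `≲ 2^i` in
the cell `n` is such that `ζ + ε ζᵤ` is close to the paraboloid, and to `ξ`. -/
def Interacts (R : ℝ) (i j : ℕ) (ε : ℝ) (ζ : SpaceTime) (ξ : lattice) (n : Fin 2 → ℤ) : Prop :=
  ∃ ζu : SpaceTime, parabolicSize ζu ≤ 2 ^ (i + 1) ∧ (∀ k, |spatial ζu k - n k| ≤ 1 / 2) ∧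
    2 ^ (j - 1) ≤ parabolicSize (ζ + ε • ζu) ∧ |modulation (ζ + ε • ζu)| ≤ 2 * 2 ^ (j - i) ∧
    dist (spatial (ζ + ε • ζu)) ξ ≤ R

theorem norm_spatial_le {i : ℕ} {ζ : SpaceTime} (h : parabolicSize ζ ≤ 2 ^ (i + 1)) :
    ‖spatial ζ‖ ≤ 2 * 2 ^ i := by
  have h1 := pow_le_pow_left₀ (parabolicSize_nonneg ζ) h 2
  rw [parabolicSize_sq] at h1
  refine abs_le_of_sq_le_sq' ?_ (by positivity) |>.2
  calc ‖spatial ζ‖ ^ 2 ≤ (2 ^ (i + 1)) ^ 2 := by linarith [abs_nonneg (ζ 2)]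
    _ = _ := by ring

theorem abs_time_le {i : ℕ} {ζ : SpaceTime} (h : parabolicSize ζ ≤ 2 ^ (i + 1)) :
    |ζ 2| ≤ 4 * 4 ^ i := by
  have h1 := pow_le_pow_left₀ (parabolicSize_nonneg ζ) h 2
  rw [parabolicSize_sq] at h1
  calc |ζ 2| ≤ (2 ^ (i + 1)) ^ 2 := by linarith [sq_nonneg ‖spatial ζ‖]
    _ = 4 * 4 ^ i := by
      rw [show (4 : ℝ) = 2 ^ 2 by norm_num, ← pow_mul, ← pow_mul, ← pow_add]; congr 1; ring

/-- Near the paraboloid, the spatial frequency is comparable to the parabolic size. -/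
theorem norm_spatial_ge {i j : ℕ} (hi : 1 ≤ i) (hij : 5 * i ≤ j) {ζ : SpaceTime}
    (h : 2 ^ (j - 1) ≤ parabolicSize ζ) (hm : |modulation ζ| ≤ 2 * 2 ^ (j - i)) :
    2 ^ j / 4 ≤ ‖spatial ζ‖ := by
  have h1 := pow_le_pow_left₀ (by positivity) h 2
  rw [parabolicSize_sq] at h1
  obtain ⟨l, rfl⟩ : ∃ l, j = l + 1 := ⟨j - 1, by omega⟩
  simp only [Nat.add_sub_cancel] at h1
  have h2 : (2 : ℝ) ^ (l + 1 - i) ≤ 2 ^ l := pow_le_pow_right₀ (by norm_num) (by omega)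
  -- Since `j ≥ 5`, the error `2 * 2 ^ l` due to the modulation is absorbed by `(2 ^ l) ^ 2`.
  have h3 : (2 : ℝ) ^ 4 ≤ 2 ^ l := pow_le_pow_right₀ (by norm_num) (by omega)
  have h4 : |ζ 2| ≤ ‖spatial ζ‖ ^ 2 + 2 * 2 ^ l := by
    have h5 : ζ 2 = modulation ζ + ‖spatial ζ‖ ^ 2 := by simp [modulation]
    rw [h5]
    refine (abs_add_le _ _).trans ?_
    rw [abs_of_nonneg (sq_nonneg ‖spatial ζ‖)]
    linarith
  have h6 : (2 : ℝ) ^ (l + 1) / 4 = 2 ^ l / 2 := by rw [pow_succ]; ring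
  rw [h6]
  refine abs_le_of_sq_le_sq' ?_ (norm_nonneg _) |>.2
  nlinarith

theorem four_pow_le {i j : ℕ} (hij : 5 * i ≤ j) : (4 : ℝ) ^ i ≤ 2 ^ (j - i) := by
  rw [show (4 : ℝ) = 2 ^ 2 by norm_num, ← pow_mul]
  exact pow_le_pow_right₀ (by norm_num) (by omega)

theorem spatial_add_smul (ζ ζu : SpaceTime) (ε : ℝ) :
    spatial (ζ + ε • ζu) = spatial ζ + ε • spatial ζu := by
  ext k; fin_cases k <;> simp

/-- Two interacting pairs at the same `ζ` are related. -/
theorem Interacts.compare {R : ℝ} {i j : ℕ} (hi : 1 ≤ i) (hij : 5 * i ≤ j) {ε : ℝ}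
    (hε : |ε| = 1) {ζ : SpaceTime} {ξ ξ' : lattice} {n n' : Fin 2 → ℤ}
    (h : Interacts R i j ε ζ ξ n) (h' : Interacts R i j ε ζ ξ' n') :
    |‖(ξ : Plane)‖ - ‖(ξ' : Plane)‖| ≤ 12 + 2 * R ∧ dist (ξ : Plane) ξ' ≤ 2 * R + 4 * 2 ^ i ∧
      (ξ = ξ' → ∀ k, |(n k : ℝ) - n' k| ≤ 2 * R + 1) := by
  obtain ⟨y, hy, hyn, hs, hm, hd⟩ := h
  obtain ⟨y', hy', hyn', hs', hm', hd'⟩ := h'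
  set x := spatial (ζ + ε • y) with hx
  set x' := spatial (ζ + ε • y') with hx'
  have hxx : x - x' = ε • (spatial y - spatial y') := by
    rw [hx, hx', spatial_add_smul, spatial_add_smul, smul_sub]; abel
  have hnorm : ‖x - x'‖ = ‖spatial y - spatial y'‖ := by
    rw [hxx, norm_smul, Real.norm_eq_abs, hε, one_mul]
  rw [dist_eq_norm] at hd hd'
  refine ⟨?_, ?_, ?_⟩
  · have a1 := norm_spatial_ge hi hij hs hm
    have a2 := norm_spatial_ge hi hij hs' hm'
    rw [← hx] at a1
    rw [← hx'] at a2
    -- Up to `O(2^{j-i})`, `ζ` determines the squared radius: the modulation is of this order by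
    -- assumption, and the time frequency of `w` is at most `4 * 4 ^ i ≤ 4 * 2 ^ (j - i)`.
    have b : ∀ w : SpaceTime, parabolicSize w ≤ 2 ^ (i + 1) →
        |modulation (ζ + ε • w)| ≤ 2 * 2 ^ (j - i) →
        |‖spatial (ζ + ε • w)‖ ^ 2 - ζ 2| ≤ 6 * 2 ^ (j - i) := by
      intro w hw hmw
      have h1 := abs_time_le hw
      have h2 := four_pow_le hij
      have h3 : ‖spatial (ζ + ε • w)‖ ^ 2 - ζ 2 = ε * w 2 - modulation (ζ + ε • w) := by
        simp only [modulation, PiLp.add_apply, PiLp.smul_apply, smul_eq_mul]; ring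
      rw [h3]
      refine (abs_sub _ _).trans ?_
      rw [abs_mul, hε, one_mul]
      linarith
    have b1 := abs_le.1 (b y hy hm)
    have b2 := abs_le.1 (b y' hy' hm')
    rw [← hx] at b1
    rw [← hx'] at b2
    have hl : (2 : ℝ) ^ j = 2 ^ i * 2 ^ (j - i) := by rw [← pow_add]; congr 1; omega
    have hi2 : (2 : ℝ) ≤ 2 ^ i := by
      calc (2 : ℝ) = 2 ^ 1 := by norm_num
        _ ≤ 2 ^ i := pow_le_pow_right₀ (by norm_num) hi
    have hL : (0 : ℝ) < 2 ^ (j - i) := by positivity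
    have hjL : 2 * 2 ^ (j - i) ≤ (2 : ℝ) ^ j := by rw [hl]; gcongr
    -- The squares differ by at most `12 * 2 ^ (j - i)`, while the sum of the norms is at least `2 ^
    -- j / 2 ≥ 2 ^ (j - i)`.
    have c : |‖x‖ - ‖x'‖| ≤ 12 := by
      have hpos : 0 < ‖x‖ + ‖x'‖ := by nlinarith
      have h4 : |‖x‖ - ‖x'‖| * (‖x‖ + ‖x'‖) ≤ 12 * 2 ^ (j - i) := by
        rw [← abs_of_pos hpos, ← abs_mul, abs_le]
        constructor <;> nlinarith [b1.1, b1.2, b2.1, b2.2]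
      by_contra hcon
      push Not at hcon
      nlinarith
    have d1 := abs_le.1 ((abs_norm_sub_norm_le x (ξ : Plane)).trans hd)
    have d2 := abs_le.1 ((abs_norm_sub_norm_le x' (ξ' : Plane)).trans hd')
    have c' := abs_le.1 c
    rw [abs_le]; constructor <;> linarith [d1.1, d1.2, d2.1, d2.2, c'.1, c'.2]
  · have e1 := norm_spatial_le hy
    have e2 := norm_spatial_le hy'
    have e3 : ‖x - x'‖ ≤ 4 * 2 ^ i := by
      rw [hnorm]; exact (norm_sub_le _ _).trans (by linarith)
    rw [dist_eq_norm]
    have e4 : (ξ : Plane) - ξ' = -(x - ξ) + (x - x') + (x' - ξ') := by abel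
    rw [e4]
    refine (norm_add₃_le).trans ?_
    rw [norm_neg]; linarith
  · rintro rfl k
    have e3 : ‖spatial y - spatial y'‖ ≤ 2 * R := by
      rw [← hnorm]
      have e4 : x - x' = (x - ξ) - (x' - ξ) := by abel
      rw [e4]
      exact (norm_sub_le _ _).trans (by linarith)
    have e5 : |spatial y k - spatial y' k| ≤ 2 * R := by
      have := (PiLp.norm_apply_le (spatial y - spatial y') k).trans e3
      simpa using this
    have f1 := abs_le.1 (hyn k)
    have f2 := abs_le.1 (hyn' k)
    have f3 := abs_le.1 e5
    rw [abs_le]; constructor <;> linarith [f1.1, f1.2, f2.1, f2.2, f3.1, f3.2]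

theorem card_le_of_abs_sub_le (S : Finset ℕ) (D : ℕ)
    (h : ∀ a ∈ S, ∀ b ∈ S, |(a : ℝ) - b| ≤ D) : S.card ≤ 2 * D + 1 := by
  rcases S.eq_empty_or_nonempty with rfl | ⟨a₀, h₀⟩
  · simp
  have : S ⊆ Finset.Icc (a₀ - D) (a₀ + D) := by
    intro a ha
    have h1 := abs_le.1 (h a ha a₀ h₀)
    have h2 : (a : ℤ) - a₀ ≤ D := by exact_mod_cast h1.2
    have h3 : -(D : ℤ) ≤ a - a₀ := by exact_mod_cast h1.1
    rw [Finset.mem_Icc]; omega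
  refine (Finset.card_le_card this).trans ?_
  rw [Nat.card_Icc]; omega

theorem card_le_of_abs_sub_le_pi (S : Finset (Fin 2 → ℤ)) (D : ℕ)
    (h : ∀ a ∈ S, ∀ b ∈ S, ∀ k, |(a k : ℝ) - b k| ≤ D) : S.card ≤ (2 * D + 1) ^ 2 := by
  rcases S.eq_empty_or_nonempty with rfl | ⟨a₀, h₀⟩
  · simp
  have : S ⊆ Fintype.piFinset fun k => Finset.Icc (a₀ k - D) (a₀ k + D) := by
    intro a ha
    rw [Fintype.mem_piFinset]
    intro k
    have h1 := abs_le.1 (h a ha a₀ h₀ k)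
    have h2 : (a k : ℤ) - a₀ k ≤ D := by exact_mod_cast h1.2
    have h3 : -(D : ℤ) ≤ a k - a₀ k := by exact_mod_cast h1.1
    rw [Finset.mem_Icc]; omega
  refine (Finset.card_le_card this).trans ?_
  rw [Fintype.card_piFinset]
  have : ∀ k, (Finset.Icc (a₀ k - D) (a₀ k + D)).card = 2 * D + 1 := fun k => by
    rw [Int.card_Icc]; omega
  simp [this]

open Classical in
/-- At each `ζ` there are only `O(2^i)` interacting pairs. -/
theorem card_interacts_le (R : ℝ) : ∃ K : ℕ, ∀ i j : ℕ, 1 ≤ i → 5 * i ≤ j → ∀ ε : ℝ, |ε| = 1 →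
    ∀ ζ : SpaceTime, ∀ S : Finset (lattice × (Fin 2 → ℤ)),
      (∀ p ∈ S, Interacts R i j ε ζ p.1 p.2) → S.card ≤ K * 2 ^ i := by
  set D := ⌈2 * R + 1⌉₊ with hD
  have hDR : 2 * R + 1 ≤ D := Nat.le_ceil _
  -- `(2D+1)²` cells for each lattice point, at most `3(2D+9)2^i` points on each circle, and
  -- `2(D+12)+1` circles.
  refine ⟨(2 * D + 1) ^ 2 * (3 * (2 * D + 9) * (2 * (D + 12) + 1)), ?_⟩
  intro i j hi hij ε hε ζ S hS
  have h1 : S.card ≤ (2 * D + 1) ^ 2 * (S.image Prod.fst).card := by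
    refine Finset.card_le_mul_card_image S _ fun ξ _ => ?_
    have hinj : Set.InjOn Prod.snd (↑(S.filter fun p => p.1 = ξ) : Set (lattice × (Fin 2 → ℤ))) := by
      intro p hp q hq hpq
      simp only [Finset.coe_filter, mem_ofPred_eq] at hp hq
      exact Prod.ext (hp.2.trans hq.2.symm) hpq
    rw [← Finset.card_image_of_injOn hinj]
    refine card_le_of_abs_sub_le_pi _ _ ?_
    intro a ha b hb k
    simp only [Finset.mem_image, Finset.mem_filter] at ha hb
    obtain ⟨p, ⟨hp, hp1⟩, rfl⟩ := ha
    obtain ⟨q, ⟨hq, hq1⟩, rfl⟩ := hb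
    exact (((hS p hp).compare hi hij hε (hS q hq)).2.2 (hp1.trans hq1.symm) k).trans hDR
  have hS' : ∀ ξ ∈ S.image Prod.fst, ∃ n, Interacts R i j ε ζ ξ n := by
    intro ξ hξ
    obtain ⟨p, hp, rfl⟩ := Finset.mem_image.1 hξ
    exact ⟨p.2, hS p hp⟩
  set S' := S.image Prod.fst with hS'def
  have h2 : S'.card ≤ 3 * (2 * (D + 4 * 2 ^ i) + 1) * (S'.image fun ξ => (polarIndex ξ).1).card := by
    refine Finset.card_le_mul_card_image S' _ fun ρ _ => ?_
    refine card_circle_le _ ρ _ (fun ξ hξ => (Finset.mem_filter.1 hξ).2) ?_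
    intro ξ hξ η hη
    obtain ⟨n, hn⟩ := hS' ξ (Finset.mem_filter.1 hξ).1
    obtain ⟨n', hn'⟩ := hS' η (Finset.mem_filter.1 hη).1
    refine (hn.compare hi hij hε hn').2.1.trans ?_
    push_cast; linarith
  have h3 : (S'.image fun ξ => (polarIndex ξ).1).card ≤ 2 * (D + 12) + 1 := by
    refine card_le_of_abs_sub_le _ _ ?_
    intro a ha b hb
    obtain ⟨ξ, hξ, rfl⟩ := Finset.mem_image.1 ha
    obtain ⟨η, hη, rfl⟩ := Finset.mem_image.1 hb
    obtain ⟨n, hn⟩ := hS' ξ hξ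
    obtain ⟨n', hn'⟩ := hS' η hη
    have := (hn.compare hi hij hε hn').1
    rw [norm_lattice, norm_lattice] at this
    refine this.trans ?_
    push_cast; linarith
  have h4 : 2 * (D + 4 * 2 ^ i) + 1 ≤ (2 * D + 9) * 2 ^ i := by
    have : 1 ≤ 2 ^ i := Nat.one_le_two_pow
    nlinarith
  calc S.card ≤ (2 * D + 1) ^ 2 * S'.card := h1
    _ ≤ (2 * D + 1) ^ 2 * (3 * (2 * (D + 4 * 2 ^ i) + 1) * (2 * (D + 12) + 1)) := by gcongr; exact h2.trans (by gcongr)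
    _ ≤ (2 * D + 1) ^ 2 * (3 * ((2 * D + 9) * 2 ^ i) * (2 * (D + 12) + 1)) := by gcongr
    _ = _ := by ring

end Counting

/-! ### Dyadic symbols and their supports. -/

section Symbols

variable {φ₀ : ℝ → ℝ}

theorem continuous_parabolicSize : Continuous parabolicSize := by
  unfold parabolicSize; fun_prop

theorem continuous_modulation : Continuous modulation := by
  unfold modulation; fun_prop

theorem IsBasicCutoff.exists_bound (h : IsBasicCutoff φ₀) : ∃ B, 1 ≤ B ∧ ∀ x, 0 ≤ x → |φ₀ x| ≤ B := by
  obtain ⟨B, hB⟩ := isCompact_Icc.exists_bound_of_continuousOn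
    (h.smooth.continuousOn.mono (Icc_subset_Ici_self : Icc (0 : ℝ) 2 ⊆ Ici 0))
  refine ⟨max B 1, le_max_right _ _, fun x hx => ?_⟩
  rcases le_total x 2 with h2 | h2
  · exact (hB x ⟨hx, h2⟩).trans (le_max_left _ _)
  · rw [h.eq_zero x h2, abs_zero]; exact zero_le_one.trans (le_max_right _ _)

theorem IsBasicCutoff.continuous_comp (h : IsBasicCutoff φ₀) {f : SpaceTime → ℝ}
    (hf : Continuous f) (h0 : ∀ ζ, 0 ≤ f ζ) : Continuous fun ζ => φ₀ (f ζ) :=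
  h.smooth.continuousOn.comp_continuous hf h0

theorem IsBasicCutoff.continuous_dyadic (h : IsBasicCutoff φ₀) (i : ℕ) {f : SpaceTime → ℝ}
    (hf : Continuous f) (h0 : ∀ ζ, 0 ≤ f ζ) : Continuous fun ζ => dyadic φ₀ i (f ζ) := by
  cases i with
  | zero => exact h.continuous_comp hf h0
  | succ i =>
    simp only [dyadic]
    exact (h.continuous_comp (hf.div_const _) fun ζ => div_nonneg (h0 ζ) (by positivity)).sub
      (h.continuous_comp (hf.div_const _) fun ζ => div_nonneg (h0 ζ) (by positivity))

theorem IsBasicCutoff.continuous_symb (h : IsBasicCutoff φ₀) (i : ℕ) : Continuous (symb φ₀ i) :=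
  h.continuous_dyadic i continuous_parabolicSize parabolicSize_nonneg

theorem IsBasicCutoff.continuous_symbDist (h : IsBasicCutoff φ₀) (i : ℕ) (a : ℤ) :
    Continuous (symbDist φ₀ i a) :=
  (h.continuous_symb i).mul (h.continuous_dyadic _ continuous_modulation.abs fun _ => abs_nonneg _)

theorem abs_dyadic_le {B : ℝ} (hB1 : 1 ≤ B)
    (hB : ∀ x, 0 ≤ x → |φ₀ x| ≤ B) (i : ℕ) {x : ℝ} (hx : 0 ≤ x) : |dyadic φ₀ i x| ≤ 2 * B := by
  cases i with
  | zero => exact (hB x hx).trans (by linarith)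
  | succ i =>
    simp only [dyadic]
    refine (abs_sub _ _).trans ?_
    linarith [hB (x / 2 ^ (i + 1)) (by positivity), hB (x / 2 ^ i) (by positivity)]

theorem sum_dyadic (n : ℕ) (x : ℝ) :
    ∑ k ∈ Finset.range (n + 1), dyadic φ₀ k x = φ₀ (x / 2 ^ n) := by
  induction n with
  | zero => simp [dyadic]
  | succ n ih => rw [Finset.sum_range_succ, ih]; simp [dyadic]

theorem IsBasicCutoff.dyadic_eq_zero_of_ge (h : IsBasicCutoff φ₀) {i : ℕ} {x : ℝ}
    (hx : 2 ^ (i + 1) ≤ x) : dyadic φ₀ i x = 0 := by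
  cases i with
  | zero => exact h.eq_zero x (by simpa using hx)
  | succ i =>
    simp only [dyadic]
    rw [h.eq_zero, h.eq_zero, sub_zero]
    · rw [le_div_iff₀ (by positivity)]
      refine le_trans ?_ hx
      rw [← pow_succ']; exact pow_le_pow_right₀ (by norm_num) (by omega)
    · rw [le_div_iff₀ (by positivity), ← pow_succ']; exact hx

theorem IsBasicCutoff.dyadic_eq_zero_of_le (h : IsBasicCutoff φ₀) {i : ℕ} (hi : 1 ≤ i) {x : ℝ}
    (h0 : 0 ≤ x) (hx : x ≤ 2 ^ (i - 1)) : dyadic φ₀ i x = 0 := by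
  obtain ⟨i, rfl⟩ : ∃ l, i = l + 1 := ⟨i - 1, by omega⟩
  simp only [Nat.add_sub_cancel] at hx
  simp only [dyadic]
  rw [h.eq_one, h.eq_one, sub_self]
  · positivity
  · rwa [div_le_one (by positivity)]
  · positivity
  · rw [div_le_one (by positivity)]
    exact hx.trans (pow_le_pow_right₀ (by norm_num) (by omega))

/-- The cut-off need not be monotone, so the pieces may have either sign. For `x` between `2^n` and
`2^{n+1}` the piece `n + 1` equals `1 - φ₀(x / 2^n)`. If that is below one half, the piece `n` is
`φ₀(x / 2^n) > 1/2`, its subtracted term, present for `n ≥ 1`, being zero. -/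
theorem exists_abs_dyadic_ge (h : IsBasicCutoff φ₀) {n : ℕ} {x : ℝ} (h0 : 0 ≤ x)
    (hx : x ≤ 2 ^ n) : ∃ k, k ≤ n ∧ 1 / 2 ≤ |dyadic φ₀ k x| := by
  induction n with
  | zero => exact ⟨0, le_rfl, by simp [dyadic, h.eq_one x h0 (by simpa using hx)]; norm_num⟩
  | succ n ih =>
    rcases le_total x (2 ^ n) with h1 | h1
    · obtain ⟨k, hk, hk'⟩ := ih h1
      exact ⟨k, by omega, hk'⟩
    · have e1 : dyadic φ₀ (n + 1) x = 1 - φ₀ (x / 2 ^ n) := by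
        simp only [dyadic]
        rw [h.eq_one (x / 2 ^ (n + 1)) (by positivity) (by rwa [div_le_one (by positivity)])]
      by_cases h2 : φ₀ (x / 2 ^ n) ≤ 1 / 2
      · exact ⟨n + 1, le_rfl, by rw [e1, le_abs]; left; linarith⟩
      · refine ⟨n, by omega, ?_⟩
        push Not at h2
        cases n with
        | zero =>
          simp only [dyadic]
          rw [le_abs]; left; simpa using h2.le
        | succ n =>
          simp only [dyadic]
          by_cases h3 : φ₀ (x / 2 ^ n) ≤ 0
          · rw [le_abs]; left; linarith
          · have h4 : φ₀ (x / 2 ^ n) = 0 := h.eq_zero _ (by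
              rw [le_div_iff₀ (by positivity), ← pow_succ']; exact h1)
            rw [h4, sub_zero, le_abs]; left; exact h2.le

theorem regionA_subset (h : IsBasicCutoff φ₀) {i : ℕ} (hi : 1 ≤ i) {ζ : SpaceTime}
    (hζ : ζ ∈ regionA φ₀ i) : 2 ^ (i - 1) ≤ parabolicSize ζ ∧ parabolicSize ζ ≤ 2 ^ (i + 1) := by
  have hc : IsClosed {ζ : SpaceTime | 2 ^ (i - 1) ≤ parabolicSize ζ ∧ parabolicSize ζ ≤ 2 ^ (i + 1)} :=
    (isClosed_le continuous_const continuous_parabolicSize).inter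
      (isClosed_le continuous_parabolicSize continuous_const)
  refine closure_minimal (fun z hz => ?_) hc hζ
  constructor
  · by_contra hcon
    push Not at hcon
    exact hz (h.dyadic_eq_zero_of_le hi (parabolicSize_nonneg z) hcon.le)
  · by_contra hcon
    push Not at hcon
    exact hz (h.dyadic_eq_zero_of_ge hcon.le)

/-- The exponents from `-j` to `-i` are the dyadic indices from `0` to `j - i`, and the sum
telescopes. -/
theorem symbBelow_eq {i j : ℕ} (hij : i ≤ j) (ζ : SpaceTime) :
    symbBelow φ₀ j (-(i : ℤ)) ζ = symb φ₀ j ζ * φ₀ (|modulation ζ| / 2 ^ (j - i)) := by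
  rw [← sum_dyadic (φ₀ := φ₀) (j - i), Finset.mul_sum, symbBelow]
  simp only [symbDist]
  refine Finset.sum_bij' (fun b _ => (j + b).toNat) (fun k _ => (k : ℤ) - j) ?_ ?_ ?_ ?_ ?_
  · intro b hb
    simp only [distExps, Finset.mem_filter, Finset.mem_Icc] at hb
    rw [Finset.mem_range]; omega
  · intro k hk
    rw [Finset.mem_range] at hk
    simp only [distExps, Finset.mem_filter, Finset.mem_Icc]; omega
  · intro b hb
    simp only [distExps, Finset.mem_filter, Finset.mem_Icc] at hb
    simp only [Int.toNat_of_nonneg (show 0 ≤ (j : ℤ) + b by omega)]; ring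
  · intro k hk
    simp
  · intro b hb
    rfl

theorem continuous_symbBelow (h : IsBasicCutoff φ₀) (j : ℕ) (a : ℤ) :
    Continuous (symbBelow φ₀ j a) := by
  unfold symbBelow
  exact continuous_finsetSum _ fun b _ => h.continuous_symbDist j b

theorem symbBelow_ne_zero (h : IsBasicCutoff φ₀) {i j : ℕ} (hj : 1 ≤ j) (hij : i ≤ j)
    {ζ : SpaceTime} (hζ : symbBelow φ₀ j (-(i : ℤ)) ζ ≠ 0) :
    2 ^ (j - 1) ≤ parabolicSize ζ ∧ parabolicSize ζ ≤ 2 ^ (j + 1) ∧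
      |modulation ζ| ≤ 2 * 2 ^ (j - i) := by
  rw [symbBelow_eq hij] at hζ
  have h1 := regionA_subset h hj (subset_tsupport _ (left_ne_zero_of_mul hζ))
  refine ⟨h1.1, h1.2, ?_⟩
  by_contra hcon
  push Not at hcon
  exact right_ne_zero_of_mul hζ (h.eq_zero _ (by
    rw [le_div_iff₀ (by positivity)]; exact hcon.le))

theorem regionBelow_subset (h : IsBasicCutoff φ₀) {i j : ℕ} (hj : 1 ≤ j) (hij : i ≤ j)
    {ζ : SpaceTime} (hζ : ζ ∈ regionBelow φ₀ j (-(i : ℤ))) :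
    2 ^ (j - 1) ≤ parabolicSize ζ ∧ parabolicSize ζ ≤ 2 ^ (j + 1) ∧
      |modulation ζ| ≤ 2 * 2 ^ (j - i) := by
  have hc : IsClosed {ζ : SpaceTime | 2 ^ (j - 1) ≤ parabolicSize ζ ∧
      parabolicSize ζ ≤ 2 ^ (j + 1) ∧ |modulation ζ| ≤ 2 * 2 ^ (j - i)} :=
    (isClosed_le continuous_const continuous_parabolicSize).inter
      ((isClosed_le continuous_parabolicSize continuous_const).inter
        (isClosed_le continuous_modulation.abs continuous_const))
  exact closure_minimal (fun z hz => symbBelow_ne_zero h hj hij hz) hc hζ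

/-- By telescoping the symbol has the factor `1 - φ₀(|τ - |ξ|²| / 2^{j-i})`, which vanishes at
smaller modulations; the bounds are closed conditions and pass to the support. -/
theorem regionAbove_subset (h : IsBasicCutoff φ₀) {i j : ℕ} (hj : 1 ≤ j) (hij : i ≤ j)
    {ζ : SpaceTime} (hζ : ζ ∈ regionAbove φ₀ j (-(i : ℤ))) :
    2 ^ (j - 1) ≤ parabolicSize ζ ∧ parabolicSize ζ ≤ 2 ^ (j + 1) ∧
      2 ^ (j - i) ≤ |modulation ζ| := by
  have hc : IsClosed {ζ : SpaceTime | 2 ^ (j - 1) ≤ parabolicSize ζ ∧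
      parabolicSize ζ ≤ 2 ^ (j + 1) ∧ 2 ^ (j - i) ≤ |modulation ζ|} :=
    (isClosed_le continuous_const continuous_parabolicSize).inter
      ((isClosed_le continuous_parabolicSize continuous_const).inter
        (isClosed_le continuous_const continuous_modulation.abs))
  refine closure_minimal (fun z hz => ?_) hc hζ
  have hz' : symb φ₀ j z * (1 - φ₀ (|modulation z| / 2 ^ (j - i))) ≠ 0 := by
    rw [mul_sub, mul_one, ← symbBelow_eq hij]; exact hz
  have h1 := regionA_subset h hj (subset_tsupport _ (left_ne_zero_of_mul hz'))
  refine ⟨h1.1, h1.2, ?_⟩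
  by_contra hcon
  push Not at hcon
  refine right_ne_zero_of_mul hz' ?_
  rw [h.eq_one _ (by positivity) (by rw [div_le_one (by positivity)]; exact hcon.le), sub_self]

theorem IsBasicCutoff.exists_symb_bound (h : IsBasicCutoff φ₀) : ∃ B, 0 < B ∧ ∀ i ζ, |symb φ₀ i ζ| ≤ B := by
  obtain ⟨B, hB1, hB⟩ := h.exists_bound
  exact ⟨2 * B, by linarith, fun i ζ => abs_dyadic_le hB1 hB i (parabolicSize_nonneg ζ)⟩

theorem IsBasicCutoff.exists_symbDist_bound (h : IsBasicCutoff φ₀) :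
    ∃ B, 0 < B ∧ ∀ i a ζ, |symbDist φ₀ i a ζ| ≤ B := by
  obtain ⟨B, hB1, hB⟩ := h.exists_bound
  refine ⟨2 * B * (2 * B), by positivity, fun i a ζ => ?_⟩
  rw [symbDist, abs_mul]
  exact mul_le_mul (abs_dyadic_le hB1 hB i (parabolicSize_nonneg ζ))
    (abs_dyadic_le hB1 hB _ (abs_nonneg _)) (abs_nonneg _) (by linarith)

theorem IsBasicCutoff.exists_symbBelow_bound (h : IsBasicCutoff φ₀) :
    ∃ B, 0 < B ∧ ∀ i j : ℕ, i ≤ j → ∀ ζ, |symbBelow φ₀ j (-(i : ℤ)) ζ| ≤ B := by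
  obtain ⟨B, hB1, hB⟩ := h.exists_bound
  refine ⟨2 * B * B, by positivity, fun i j hij ζ => ?_⟩
  rw [symbBelow_eq hij, abs_mul]
  exact mul_le_mul (abs_dyadic_le hB1 hB j (parabolicSize_nonneg ζ)) (hB _ (by positivity))
    (abs_nonneg _) (by linarith)

end Symbols

/-! ### The modulation norm and the space `X^{0,1/2,1}`. -/

section XNorm

variable {φ₀ : ℝ → ℝ}

theorem modulation_shear (y : Plane) (l : ℝ) : modulation (pt y (l + ‖y‖ ^ 2)) = l := by
  simp [modulation]

theorem abs_modulation_le (ζ : SpaceTime) : |modulation ζ| ≤ parabolicSize ζ ^ 2 := by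
  rw [parabolicSize_sq, modulation]
  refine (abs_sub _ _).trans ?_
  rw [abs_of_nonneg (sq_nonneg ‖spatial ζ‖)]

/-- One dyadic factor of size at least `1 / 2` exists in the parabolic size and one in the
modulation. The former occurs twice in `S_{k,d} S_k`, whence `1 / 8`. Only three adjacent shells can
occur. -/
theorem exists_symb_ge (h : IsBasicCutoff φ₀) {i : ℕ} {ζ : SpaceTime}
    (h1 : 2 ^ (i - 1) ≤ parabolicSize ζ) (h2 : parabolicSize ζ ≤ 2 ^ (i + 1)) :
    ∃ k ∈ Finset.Icc (i - 1) (i + 1), ∃ a ∈ distExps k,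
      1 / 8 ≤ |symbDist φ₀ k a ζ * symb φ₀ k ζ| := by
  obtain ⟨k, hk, hk2⟩ := exists_abs_dyadic_ge h (parabolicSize_nonneg ζ) h2
  have hk0 : dyadic φ₀ k (parabolicSize ζ) ≠ 0 := by
    intro h0; rw [h0, abs_zero] at hk2; norm_num at hk2
  have hk3 : parabolicSize ζ ≤ 2 ^ (k + 1) := by
    by_contra hcon
    push Not at hcon
    exact hk0 (h.dyadic_eq_zero_of_ge hcon.le)
  have hk4 : i - 1 ≤ k := by
    by_contra hcon
    refine hk0 (h.dyadic_eq_zero_of_ge (le_trans ?_ h1))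
    exact pow_le_pow_right₀ (by norm_num) (by omega)
  have hm : |modulation ζ| ≤ 2 ^ (2 * k + 2) := by
    refine (abs_modulation_le ζ).trans ?_
    calc parabolicSize ζ ^ 2 ≤ (2 ^ (k + 1)) ^ 2 :=
          pow_le_pow_left₀ (parabolicSize_nonneg ζ) hk3 2
      _ = 2 ^ (2 * k + 2) := by rw [← pow_mul]; congr 1; ring
  obtain ⟨l, hl, hl2⟩ := exists_abs_dyadic_ge h (abs_nonneg _) hm
  refine ⟨k, Finset.mem_Icc.2 ⟨hk4, hk⟩, (l : ℤ) - k, ?_, ?_⟩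
  · simp only [distExps, Finset.mem_Icc]; omega
  · have e : ((k : ℤ) + ((l : ℤ) - k)).toNat = l := by simp
    rw [symbDist, e, symb, abs_mul, abs_mul]
    calc (1 : ℝ) / 8 = 1 / 2 * (1 / 2) * (1 / 2) := by norm_num
      _ ≤ _ := by gcongr

/-- The part of `f` measured by the summand `(k, a)` of the norm of `X^{0,1/2,1}`. -/
def xPiece (φ₀ : ℝ → ℝ) (k : ℕ) (a : ℤ) (f : L2) : L2 :=
  fourierMul (symbDist φ₀ k a) (fourierMul (symb φ₀ k) f)

theorem hat_xPiece (h : IsBasicCutoff φ₀) (k : ℕ) (a : ℤ) (f : L2) :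
    hat (xPiece φ₀ k a f) =ᵐ[volume] fun ζ => ((symbDist φ₀ k a ζ * symb φ₀ k ζ : ℝ) : ℂ) * hat f ζ := by
  obtain ⟨B, _, hB⟩ := h.exists_symb_bound
  obtain ⟨B', _, hB'⟩ := h.exists_symbDist_bound
  have h1 := hat_fourierMul (h.continuous_symb k).measurable (hB k) f
  have h2 := hat_fourierMul (h.continuous_symbDist k a).measurable (hB' k a) (fourierMul (symb φ₀ k) f)
  filter_upwards [h1, h2] with ζ h3 h4
  rw [xPiece, h4, h3]; push_cast; ring

theorem sum_xPiece_le (k : ℕ) (f : L2) :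
    ∑ a ∈ distExps k, normX0 (1 / 2) (xPiece φ₀ k a f) ≤ normX φ₀ f := by
  have h1 : normXi φ₀ k (fourierMul (symb φ₀ k) f) ^ 2 ≤
      ∑' i : ℕ, normXi φ₀ i (fourierMul (symb φ₀ i) f) ^ 2 := ENNReal.le_tsum k
  calc _ = (normXi φ₀ k (fourierMul (symb φ₀ k) f) ^ 2) ^ (1 / 2 : ℝ) := by
        rw [ENNReal_sq_rpow_half]; rfl
    _ ≤ _ := by unfold normX; gcongr

theorem weight_lower (h : IsBasicCutoff φ₀) {l : ℕ} {m : ℝ}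
    (hm : dyadic φ₀ l |m| ≠ 0) : |m| ≤ 2 * 2 ^ l ∧ 2 ^ l / 2 ≤ (1 + m ^ 2) ^ (1 / 2 : ℝ) := by
  constructor
  · by_contra hcon
    push Not at hcon
    exact hm (h.dyadic_eq_zero_of_ge (by rw [pow_succ']; exact hcon.le))
  · rw [← Real.sqrt_eq_rpow]
    refine Real.le_sqrt_of_sq_le ?_
    rcases Nat.eq_zero_or_pos l with rfl | hl
    · norm_num; nlinarith [sq_nonneg m]
    · have h1 : (2 : ℝ) ^ (l - 1) ≤ |m| := by
        by_contra hcon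
        push Not at hcon
        exact hm (h.dyadic_eq_zero_of_le hl (abs_nonneg _) hcon.le)
      have h2 : (2 : ℝ) ^ l / 2 = 2 ^ (l - 1) := by
        obtain ⟨l, rfl⟩ : ∃ k, l = k + 1 := ⟨l - 1, by omega⟩
        rw [pow_succ]; simp
      rw [h2]
      have := pow_le_pow_left₀ (by positivity) h1 2
      rw [sq_abs] at this
      linarith

/-- Cauchy-Schwarz in the modulation variable, on a dyadic range of modulations. -/
theorem modNorm_le_of_dyadic {G : SpaceTime → ℂ} (hG : Measurable G) (l : ℕ)
    (hs : ∀ ζ, G ζ ≠ 0 → |modulation ζ| ≤ 2 * 2 ^ l ∧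
      2 ^ l / 2 ≤ (1 + modulation ζ ^ 2) ^ (1 / 2 : ℝ)) :
    modNorm G ≤ 3 * (∫⁻ ζ, ENNReal.ofReal ((1 + modulation ζ ^ 2) ^ (1 / 2 : ℝ)) *
      ‖G ζ‖ₑ ^ 2) ^ (1 / 2 : ℝ) := by
  set L : ℝ := 2 ^ l with hL
  have hL0 : 0 < L := by positivity
  set I : ℝ → ℝ≥0∞ := (Icc (-(2 * L)) (2 * L)).indicator 1 with hI
  have hIm : Measurable I := measurable_one.indicator measurableSet_Icc
  have hGs : Measurable fun q : ℝ × Plane => ‖G (pt q.2 (q.1 + ‖q.2‖ ^ 2))‖ₑ ^ 2 :=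
    ((hG.comp measurable_shear).enorm).pow_const 2
  have h1 : modNorm G = ∫⁻ t, I t * (∫⁻ y : Plane, ‖G (pt y (t + ‖y‖ ^ 2))‖ₑ ^ 2) ^ (1 / 2 : ℝ) := by
    refine lintegral_congr fun t => ?_
    by_cases ht : t ∈ Icc (-(2 * L)) (2 * L)
    · rw [hI, indicator_of_mem ht]; simp
    · have h0 : ∀ y : Plane, G (pt y (t + ‖y‖ ^ 2)) = 0 := by
        intro y
        by_contra hne
        have := (hs _ hne).1
        rw [modulation_shear] at this
        exact ht (abs_le.1 this)
      simp [h0]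
  have h2 : ∫⁻ t, I t ^ 2 = ENNReal.ofReal (4 * L) := by
    have : ∀ t, I t ^ 2 = (Icc (-(2 * L)) (2 * L)).indicator 1 t := by
      intro t
      by_cases ht : t ∈ Icc (-(2 * L)) (2 * L) <;> simp only [hI, ht, indicator_of_mem,
        indicator_of_notMem, not_false_eq_true] <;> simp
    simp_rw [this]
    rw [lintegral_indicator_one measurableSet_Icc, Real.volume_Icc]
    congr 1; ring
  have h3 : ENNReal.ofReal (L / 2) * ∫⁻ ζ, ‖G ζ‖ₑ ^ 2 ≤
      ∫⁻ ζ, ENNReal.ofReal ((1 + modulation ζ ^ 2) ^ (1 / 2 : ℝ)) * ‖G ζ‖ₑ ^ 2 := by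
    rw [← lintegral_const_mul _ (by fun_prop)]
    refine lintegral_mono fun ζ => ?_
    by_cases hz : G ζ = 0
    · simp [hz]
    · dsimp only
      gcongr
      exact (hs ζ hz).2
  rw [h1]
  refine (lintegral_mul_le_sqrt hIm.aemeasurable
    ((hGs.lintegral_prod_right').pow_const _).aemeasurable).trans ?_
  simp_rw [ENNReal_rpow_half_sq]
  rw [h2, ← lintegral_spaceTime_shear (g := fun ζ => ‖G ζ‖ₑ ^ 2) (by fun_prop),
    ← ENNReal.mul_rpow_of_nonneg _ _ (by norm_num), ENNReal_rpow_half_le_iff, mul_pow,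
    ENNReal_rpow_half_sq]
  -- The range of modulations has length `4L` and the weight is at least `L / 2`; their quotient `8`
  -- is below `3²`.
  calc ENNReal.ofReal (4 * L) * ∫⁻ ζ, ‖G ζ‖ₑ ^ 2
      = 8 * (ENNReal.ofReal (L / 2) * ∫⁻ ζ, ‖G ζ‖ₑ ^ 2) := by
        rw [← mul_assoc, show (8 : ℝ≥0∞) = ENNReal.ofReal 8 by simp,
          ← ENNReal.ofReal_mul (by norm_num)]
        congr 2; ring
    _ ≤ 9 * ∫⁻ ζ, ENNReal.ofReal ((1 + modulation ζ ^ 2) ^ (1 / 2 : ℝ)) * ‖G ζ‖ₑ ^ 2 := by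
        gcongr; norm_num
    _ = _ := by norm_num

theorem modNorm_le_sum {ι : Type*} {S : Finset ι} {F : SpaceTime → ℂ} {G : ι → SpaceTime → ℂ}
    (hG : ∀ s, Measurable (G s))
    (h : ∀ᵐ ζ, ‖F ζ‖ ≤ ∑ s ∈ S, ‖G s ζ‖) : modNorm F ≤ ∑ s ∈ S, modNorm (G s) := by
  have h0 : modNorm F ≤ modNorm fun ζ => ((∑ s ∈ S, ‖G s ζ‖ : ℝ) : ℂ) := by
    -- Monotonicity of `modNorm` is available for everywhere inequalities, so `F` is first changed
    -- on a null set.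
    set F' : SpaceTime → ℂ := {ζ | ‖F ζ‖ ≤ ∑ s ∈ S, ‖G s ζ‖}.indicator F with hF'
    have h1 : F =ᵐ[volume] F' := by
      filter_upwards [h] with ζ hζ
      rw [hF', indicator_of_mem (show ζ ∈ {ζ | ‖F ζ‖ ≤ ∑ s ∈ S, ‖G s ζ‖} from hζ)]
    rw [modNorm_congr h1]
    refine modNorm_mono fun ζ => ?_
    rw [Complex.norm_real, Real.norm_of_nonneg (Finset.sum_nonneg fun _ _ => norm_nonneg _)]
    by_cases hz : ζ ∈ {ζ | ‖F ζ‖ ≤ ∑ s ∈ S, ‖G s ζ‖}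
    · rw [hF', indicator_of_mem hz]; exact hz
    · rw [hF', indicator_of_notMem hz, norm_zero]
      exact Finset.sum_nonneg fun _ _ => norm_nonneg _
  refine h0.trans ?_
  have hm : ∀ s, Measurable fun t : ℝ =>
      (∫⁻ y : Plane, ‖G s (pt y (t + ‖y‖ ^ 2))‖ₑ ^ 2) ^ (1 / 2 : ℝ) := fun s => by
    have : Measurable fun q : ℝ × Plane => ‖G s (pt q.2 (q.1 + ‖q.2‖ ^ 2))‖ₑ ^ 2 :=
      (((hG s).comp measurable_shear).enorm).pow_const 2
    exact this.lintegral_prod_right'.pow_const _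
  unfold modNorm
  rw [← lintegral_finsetSum _ fun s _ => hm s]
  refine lintegral_mono fun t => ?_
  have h2 := summable_lintegral_mul_le (μ := (volume : Measure Plane))
    (f := fun (s : S) (y : Plane) => ‖G s (pt y (t + ‖y‖ ^ 2))‖ₑ)
    fun s => ((hG s).comp (by fun_prop : Measurable fun y : Plane => pt y (t + ‖y‖ ^ 2))).enorm
  rw [tsum_fintype] at h2
  rw [← Finset.sum_coe_sort S fun s =>
    (∫⁻ y : Plane, ‖G s (pt y (t + ‖y‖ ^ 2))‖ₑ ^ 2) ^ (1 / 2 : ℝ)]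
  refine le_trans (le_of_eq ?_) h2
  congr 1
  refine lintegral_congr fun y => ?_
  congr 1
  rw [tsum_fintype, Finset.sum_coe_sort S fun s => ‖G s (pt y (t + ‖y‖ ^ 2))‖ₑ, ← ofReal_norm,
    Complex.norm_real, Real.norm_of_nonneg (Finset.sum_nonneg fun _ _ => norm_nonneg _),
    ENNReal.ofReal_sum_of_nonneg fun _ _ => norm_nonneg _]
  simp [ofReal_norm]

theorem modNorm_const_mul (c : ℂ) (F : SpaceTime → ℂ) :
    modNorm (fun ζ => c * F ζ) = ‖c‖ₑ * modNorm F := by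
  unfold modNorm
  rw [← lintegral_const_mul' _ _ enorm_ne_top]
  refine lintegral_congr fun t => ?_
  simp_rw [enorm_mul, mul_pow]
  rw [lintegral_const_mul' _ _ (by simp), ENNReal.mul_rpow_of_nonneg _ _ (by norm_num),
    ENNReal_sq_rpow_half]

theorem modNorm_xPiece_le (h : IsBasicCutoff φ₀) (k : ℕ) (a : ℤ) (f : L2) :
    modNorm (hat (xPiece φ₀ k a f)) ≤ 3 * normX0 (1 / 2) (xPiece φ₀ k a f) := by
  have h1 := hat_xPiece h k a f
  set m : SpaceTime → ℝ := fun ζ => symbDist φ₀ k a ζ * symb φ₀ k ζ with hm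
  have hmc : Continuous m := (h.continuous_symbDist k a).mul (h.continuous_symb k)
  have hmeas : Measurable fun ζ => (m ζ : ℂ) * hat f ζ := by
    have := hmc.measurable
    have := measurable_hat f
    fun_prop
  rw [modNorm_congr h1]
  refine (modNorm_le_of_dyadic hmeas ((k + a).toNat) fun ζ hζ => ?_).trans (le_of_eq ?_)
  · refine weight_lower h ?_
    intro h0
    refine hζ ?_
    simp [hm, symbDist, h0]
  · rw [normX0, normX0On, setLIntegral_univ]
    congr 2
    refine lintegral_congr_ae ?_
    filter_upwards [h1] with ζ hζ
    rw [hζ]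

/-- The modulation norm is controlled by the norm of `X^{0,1/2,1}`. -/
theorem modNorm_hat_le (h : IsBasicCutoff φ₀) {i : ℕ} (hi : 1 ≤ i) {u : L2}
    (hu : FourierSupportedIn u (regionA φ₀ i)) : modNorm (hat u) ≤ 72 * normX φ₀ u := by
  -- Three shells and all their modulations. The constant is `72 = 3 * 8 * 3`: the number of shells,
  -- the inverse of the lower bound `1 / 8`, and the constant of the dyadic Cauchy–Schwarz.
  set S : Finset ((_ : ℕ) × ℤ) := (Finset.Icc (i - 1) (i + 1)).sigma fun k => distExps k with hS
  have hall : ∀ᵐ ζ, ∀ s : (_ : ℕ) × ℤ, hat (xPiece φ₀ s.1 s.2 u) ζ =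
      ((symbDist φ₀ s.1 s.2 ζ * symb φ₀ s.1 ζ : ℝ) : ℂ) * hat u ζ :=
    ae_all_iff.2 fun s => hat_xPiece h s.1 s.2 u
  have h1 : modNorm (hat u) ≤ ∑ s ∈ S, modNorm fun ζ => (8 : ℂ) * hat (xPiece φ₀ s.1 s.2 u) ζ := by
    refine modNorm_le_sum (fun s => measurable_const.mul (measurable_hat _)) ?_
    filter_upwards [hall, hu] with ζ h2 h3
    by_cases hz : hat u ζ = 0
    · rw [hz, norm_zero]; exact Finset.sum_nonneg fun _ _ => norm_nonneg _
    have h4 : ζ ∈ regionA φ₀ i := by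
      by_contra hcon; exact hz (h3 hcon)
    have h5 := regionA_subset h hi h4
    obtain ⟨k, hk, a, ha, hka⟩ := exists_symb_ge h h5.1 h5.2
    have h6 : ‖hat u ζ‖ ≤ ‖(8 : ℂ) * hat (xPiece φ₀ k a u) ζ‖ := by
      have := h2 ⟨k, a⟩
      simp only at this
      rw [this, norm_mul, norm_mul, Complex.norm_real, Real.norm_eq_abs, ← mul_assoc]
      refine le_mul_of_one_le_left (norm_nonneg _) ?_
      rw [show ‖(8 : ℂ)‖ = 8 by simp]
      linarith
    refine h6.trans (Finset.single_le_sum (f := fun s : (_ : ℕ) × ℤ =>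
      ‖(8 : ℂ) * hat (xPiece φ₀ s.1 s.2 u) ζ‖) (fun _ _ => norm_nonneg _)
      (a := ⟨k, a⟩) (Finset.mem_sigma.2 ⟨hk, ha⟩))
  refine h1.trans ?_
  simp_rw [modNorm_const_mul]
  have h8 : ‖(8 : ℂ)‖ₑ = 8 := by
    rw [← ofReal_norm]; simp
  rw [h8, hS, Finset.sum_sigma]
  calc ∑ k ∈ Finset.Icc (i - 1) (i + 1), ∑ a ∈ distExps k, 8 * modNorm (hat (xPiece φ₀ k a u))
      ≤ ∑ k ∈ Finset.Icc (i - 1) (i + 1), 24 * normX φ₀ u := by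
        refine Finset.sum_le_sum fun k _ => ?_
        calc _ ≤ ∑ a ∈ distExps k, 24 * normX0 (1 / 2) (xPiece φ₀ k a u) := by
              refine Finset.sum_le_sum fun a _ => ?_
              rw [show (24 : ℝ≥0∞) = 8 * 3 by norm_num, mul_assoc]
              gcongr
              exact modNorm_xPiece_le h k a u
          _ ≤ _ := by
              rw [← Finset.mul_sum]; gcongr; exact sum_xPiece_le k u
    _ = 72 * normX φ₀ u := by
        rw [Finset.sum_const, Nat.card_Icc, show i + 1 + 1 - (i - 1) = 3 by omega, nsmul_eq_mul,
          ← mul_assoc]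
        norm_num

theorem normX0_sq (f : L2) (b : ℝ) : normX0 b f ^ 2 =
    ∫⁻ ζ, ENNReal.ofReal ((1 + modulation ζ ^ 2) ^ b) * ‖hat f ζ‖ₑ ^ 2 := by
  rw [normX0, normX0On, setLIntegral_univ, ENNReal_rpow_half_sq]

/-- The `L²` norm of a function at modulations `≥ λ` is controlled by `λ^{-1/2}` times the norm of
`X^{0,1/2,1}`. -/
theorem lintegral_hat_sq_le_of_modulation_ge (h : IsBasicCutoff φ₀) {j : ℕ} {lam : ℝ} {v : L2}
    (hv : ∀ᵐ ζ, hat v ζ ≠ 0 → 2 ^ (j - 1) ≤ parabolicSize ζ ∧ parabolicSize ζ ≤ 2 ^ (j + 1) ∧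
      lam ≤ |modulation ζ|) :
    ENNReal.ofReal lam * ∫⁻ ζ, ‖hat v ζ‖ₑ ^ 2 ≤ 192 * normX φ₀ v ^ 2 := by
  set S : Finset ((_ : ℕ) × ℤ) := (Finset.Icc (j - 1) (j + 1)).sigma fun k => distExps k with hS
  set w : SpaceTime → ℝ≥0∞ := fun ζ => ENNReal.ofReal ((1 + modulation ζ ^ 2) ^ (1 / 2 : ℝ)) with hw
  have hall : ∀ᵐ ζ, ∀ s : (_ : ℕ) × ℤ, hat (xPiece φ₀ s.1 s.2 v) ζ =
      ((symbDist φ₀ s.1 s.2 ζ * symb φ₀ s.1 ζ : ℝ) : ℂ) * hat v ζ :=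
    ae_all_iff.2 fun s => hat_xPiece h s.1 s.2 v
  have hwm : Measurable w := by
    have := continuous_modulation.measurable
    simp only [hw]
    fun_prop
  -- At each frequency one piece has multiplier at least `1 / 8`, hence `64`, and the weight there
  -- is at least `lam`. Three shells give `192`.
  have h1 : ENNReal.ofReal lam * ∫⁻ ζ, ‖hat v ζ‖ₑ ^ 2 ≤
      ∑ s ∈ S, 64 * ∫⁻ ζ, w ζ * ‖hat (xPiece φ₀ s.1 s.2 v) ζ‖ₑ ^ 2 := by
    have hm : ∀ s : (_ : ℕ) × ℤ, Measurable fun ζ => w ζ * ‖hat (xPiece φ₀ s.1 s.2 v) ζ‖ₑ ^ 2 :=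
      fun s => hwm.mul ((measurable_hat _).enorm.pow_const 2)
    rw [Finset.sum_congr rfl fun s _ => (lintegral_const_mul (64 : ℝ≥0∞) (hm s)).symm, ← lintegral_finsetSum _ fun s _ => (hm s).const_mul _,
      ← lintegral_const_mul _ ((measurable_hat v).enorm.pow_const 2)]
    refine lintegral_mono_ae ?_
    filter_upwards [hall, hv] with ζ h2 h3
    by_cases hz : hat v ζ = 0
    · simp [hz]
    obtain ⟨h4, h5, h6⟩ := h3 hz
    obtain ⟨k, hk, a, ha, hka⟩ := exists_symb_ge h h4 h5
    refine le_trans ?_ (Finset.single_le_sum (f := fun s : (_ : ℕ) × ℤ =>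
      64 * (w ζ * ‖hat (xPiece φ₀ s.1 s.2 v) ζ‖ₑ ^ 2)) (fun _ _ => zero_le)
      (a := ⟨k, a⟩) (Finset.mem_sigma.2 ⟨hk, ha⟩))
    have h7 : lam ≤ (1 + modulation ζ ^ 2) ^ (1 / 2 : ℝ) := by
      rw [← Real.sqrt_eq_rpow]
      refine h6.trans (Real.le_sqrt_of_sq_le ?_)
      rw [sq_abs]; linarith
    have h8 : ‖hat v ζ‖ ^ 2 ≤ 64 * ‖hat (xPiece φ₀ k a v) ζ‖ ^ 2 := by
      have := h2 ⟨k, a⟩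
      simp only at this
      rw [this, norm_mul, Complex.norm_real, Real.norm_eq_abs, mul_pow, ← mul_assoc]
      refine le_mul_of_one_le_left (by positivity) ?_
      nlinarith
    have h9 : ‖hat v ζ‖ₑ ^ 2 ≤ 64 * ‖hat (xPiece φ₀ k a v) ζ‖ₑ ^ 2 := by
      rw [← ofReal_norm, ← ofReal_norm, ← ENNReal.ofReal_pow (norm_nonneg _),
        ← ENNReal.ofReal_pow (norm_nonneg _), show (64 : ℝ≥0∞) = ENNReal.ofReal 64 by simp,
        ← ENNReal.ofReal_mul (by norm_num)]
      exact ENNReal.ofReal_le_ofReal h8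
    calc ENNReal.ofReal lam * ‖hat v ζ‖ₑ ^ 2 ≤ w ζ * (64 * ‖hat (xPiece φ₀ k a v) ζ‖ₑ ^ 2) := by
          gcongr
          exact ENNReal.ofReal_le_ofReal h7
      _ = _ := by ring
  refine h1.trans ?_
  have h2 : ∀ s : (_ : ℕ) × ℤ, ∫⁻ ζ, w ζ * ‖hat (xPiece φ₀ s.1 s.2 v) ζ‖ₑ ^ 2 =
      normX0 (1 / 2) (xPiece φ₀ s.1 s.2 v) ^ 2 := fun s => (normX0_sq _ _).symm
  simp_rw [h2]
  rw [hS, Finset.sum_sigma]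
  calc ∑ k ∈ Finset.Icc (j - 1) (j + 1), ∑ a ∈ distExps k, 64 * normX0 (1 / 2) (xPiece φ₀ k a v) ^ 2
      ≤ ∑ k ∈ Finset.Icc (j - 1) (j + 1), 64 * normX φ₀ v ^ 2 := by
        refine Finset.sum_le_sum fun k _ => ?_
        rw [← Finset.mul_sum]
        gcongr
        calc ∑ a ∈ distExps k, normX0 (1 / 2) (xPiece φ₀ k a v) ^ 2
            ≤ (∑ a ∈ distExps k, normX0 (1 / 2) (xPiece φ₀ k a v)) ^ 2 := by
              rw [sq, Finset.sum_mul]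
              refine Finset.sum_le_sum fun a ha => ?_
              rw [sq]
              gcongr
              exact Finset.single_le_sum (f := fun a => normX0 (1 / 2) (xPiece φ₀ k a v))
                (fun _ _ => zero_le) ha
          _ ≤ _ := by gcongr; exact sum_xPiece_le k v
    _ ≤ 192 * normX φ₀ v ^ 2 := by
        rw [Finset.sum_const, Nat.card_Icc, nsmul_eq_mul, ← mul_assoc]
        gcongr
        have : ((j + 1 + 1 - (j - 1) : ℕ) : ℝ≥0∞) ≤ 3 := by
          have : j + 1 + 1 - (j - 1) ≤ 3 := by omega
          exact_mod_cast this
        calc _ ≤ (3 : ℝ≥0∞) * 64 := by gcongr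
          _ = 192 := by norm_num

end XNorm

/-! ### Unit frequency cells and almost orthogonality. -/

section Cells

/-- The unit frequency cell with index `n`. -/
def cell (n : Fin 2 → ℤ) : Set SpaceTime := spatial ⁻¹' unitCube n

theorem measurableSet_unitCube (n : Fin 2 → ℤ) : MeasurableSet (unitCube n) := by
  have : unitCube n = ⋂ k, (fun x : Plane => x k) ⁻¹' Ico ((n k : ℝ) - 1 / 2) ((n k : ℝ) + 1 / 2) := by
    ext x; simp [unitCube]
  rw [this]
  exact MeasurableSet.iInter fun k => (by fun_prop : Measurable fun x : Plane => x k) measurableSet_Ico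

theorem measurableSet_cell (n : Fin 2 → ℤ) : MeasurableSet (cell n) :=
  measurable_spatial (measurableSet_unitCube n)

/-- The index of the unit cube containing `x`. -/
def cubeIndex (x : Plane) : Fin 2 → ℤ := fun k => ⌊x k + 1 / 2⌋

theorem mem_unitCube_iff {x : Plane} {n : Fin 2 → ℤ} : x ∈ unitCube n ↔ n = cubeIndex x := by
  constructor
  · intro h
    ext k
    have := h k
    symm
    simp only [cubeIndex]
    rw [Int.floor_eq_iff]
    exact ⟨by linarith [this.1], by linarith [this.2]⟩
  · rintro rfl k
    have h1 := Int.floor_le (x k + 1 / 2)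
    have h2 := Int.lt_floor_add_one (x k + 1 / 2)
    simp only [cubeIndex]
    exact ⟨by linarith, by linarith⟩

theorem abs_le_of_mem_unitCube {x : Plane} {n : Fin 2 → ℤ} (h : x ∈ unitCube n) (k : Fin 2) :
    |x k - n k| ≤ 1 / 2 := by
  have := h k
  rw [abs_le]; exact ⟨by linarith [this.1], by linarith [this.2]⟩

theorem tsum_indicator_unitCube (f : Plane → ℝ≥0∞) (x : Plane) :
    ∑' n, (unitCube n).indicator f x = f x := by
  rw [tsum_eq_single (cubeIndex x)]
  · rw [indicator_of_mem (mem_unitCube_iff.2 rfl)]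
  · intro n hn
    rw [indicator_of_notMem fun h => hn (mem_unitCube_iff.1 h)]

/-- Minkowski moves the `ℓ²` sum inside the integral over `λ`; on each paraboloid the cells are
disjoint and cover, so the squares add up exactly. -/
theorem tsum_modNorm_cell_sq_le {F : SpaceTime → ℂ} (hF : Measurable F) :
    ∑' n, modNorm ((cell n).indicator F) ^ 2 ≤ modNorm F ^ 2 := by
  rw [← ENNReal_rpow_half_le_iff]
  unfold modNorm
  have hm : ∀ n, Measurable fun q : ℝ × Plane =>
      ‖(cell n).indicator F (pt q.2 (q.1 + ‖q.2‖ ^ 2))‖ₑ ^ 2 := fun n =>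
    ((((hF.indicator (measurableSet_cell n)).comp measurable_shear).enorm).pow_const 2)
  refine (tsum_lintegral_minkowski fun n => (hm n).lintegral_prod_right'.pow_const _).trans
    (le_of_eq ?_)
  refine lintegral_congr fun t => ?_
  congr 1
  simp_rw [ENNReal_rpow_half_sq]
  have hm' : ∀ n, AEMeasurable fun y : Plane =>
      ‖(cell n).indicator F (pt y (t + ‖y‖ ^ 2))‖ₑ ^ 2 := fun n =>
    ((hm n).comp (measurable_prodMk_left (x := t))).aemeasurable
  rw [← lintegral_tsum hm']
  refine lintegral_congr fun y => ?_
  rw [← tsum_indicator_unitCube (fun y => ‖F (pt y (t + ‖y‖ ^ 2))‖ₑ ^ 2) y]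
  refine tsum_congr fun n => ?_
  by_cases hy : y ∈ unitCube n
  · have : pt y (t + ‖y‖ ^ 2) ∈ cell n := by simpa [cell] using hy
    simp only [indicator_of_mem this, indicator_of_mem hy]
  · have : pt y (t + ‖y‖ ^ 2) ∉ cell n := by simpa [cell] using hy
    simp only [indicator_of_notMem this, indicator_of_notMem hy]
    simp

end Cells

/-! ### The majorant of a cell piece on fast tubes, with gain `2^{-j}`. -/

section Majorant

theorem volume_unitCube (n : Fin 2 → ℤ) : volume (unitCube n) = 1 := by
  have h := (EuclideanSpace.volume_preserving_symm_measurableEquiv_toLp (Fin 2)).measure_preimage_equiv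
    (Set.pi univ fun k => Ico ((n k : ℝ) - 1 / 2) ((n k : ℝ) + 1 / 2))
  have h2 : unitCube n = ⇑(MeasurableEquiv.toLp 2 (Fin 2 → ℝ)).symm ⁻¹'
      (Set.pi univ fun k => Ico ((n k : ℝ) - 1 / 2) ((n k : ℝ) + 1 / 2)) := by
    ext x
    simp only [unitCube, mem_preimage, mem_pi, mem_univ, true_imp_iff]
    rfl
  rw [h2, h, Real.volume_pi_Ico]
  simp
  norm_num

/-- Cauchy–Schwarz on a cube of volume one for each `λ`. This is the trivial bound used when `2^j`
is not large compared with the packet radius. -/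
theorem lintegral_le_modNorm {F : SpaceTime → ℂ} (hF : Measurable F) {n : Fin 2 → ℤ}
    (hs : ∀ ζ, F ζ ≠ 0 → ζ ∈ cell n) : ∫⁻ ζ, ‖F ζ‖ₑ ≤ modNorm F := by
  rw [lintegral_spaceTime_shear hF.enorm]
  refine lintegral_mono fun t => ?_
  have hm : Measurable fun y : Plane => ‖F (pt y (t + ‖y‖ ^ 2))‖ₑ :=
    (hF.comp (by fun_prop : Measurable fun y : Plane => pt y (t + ‖y‖ ^ 2))).enorm
  have h1 : ∀ y : Plane, ‖F (pt y (t + ‖y‖ ^ 2))‖ₑ =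
      (unitCube n).indicator 1 y * ‖F (pt y (t + ‖y‖ ^ 2))‖ₑ := by
    intro y
    by_cases hy : y ∈ unitCube n
    · simp [hy]
    · have : F (pt y (t + ‖y‖ ^ 2)) = 0 := by
        by_contra hne
        exact hy (by simpa [cell] using hs _ hne)
      simp [this]
  dsimp only
  rw [lintegral_congr h1]
  refine (lintegral_mul_le_sqrt ((measurable_one.indicator (measurableSet_unitCube n)).aemeasurable)
    hm.aemeasurable).trans ?_
  have h2 : ∀ y, (unitCube n).indicator (1 : Plane → ℝ≥0∞) y ^ 2 = (unitCube n).indicator 1 y := by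
    intro y; by_cases hy : y ∈ unitCube n <;> simp [hy]
  simp_rw [h2]
  rw [lintegral_indicator_one (measurableSet_unitCube n), volume_unitCube]
  simp

theorem exists_coord_ge {ξ : Plane} {a : ℝ} (h : a / 8 ≤ ‖ξ‖) (ha : 0 ≤ a) :
    ∃ k, a / 16 ≤ |ξ k| := by
  by_contra hcon
  push Not at hcon
  have h0 := pow_lt_pow_left₀ (hcon 0) (abs_nonneg _) two_ne_zero
  have h1 := pow_lt_pow_left₀ (hcon 1) (abs_nonneg _) two_ne_zero
  have h2 := pow_le_pow_left₀ (by positivity) h 2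
  rw [norm_sq_plane] at h2
  rw [sq_abs] at h0 h1
  nlinarith

/-- A function with Fourier transform in a unit cell of frequencies `≲ 2^i` is bounded, on the tubes
of velocity `≳ 2^j`, by a function of time with an `L²` gain of `2^{-j/2}`. -/
theorem exists_majorant (R : ℝ) : ∃ C : ℝ, 0 < C ∧ ∀ i j : ℕ, 1 ≤ i → 5 * i ≤ j → ∀ ξ : Plane,
    2 ^ j / 4 - R ≤ ‖ξ‖ → ∀ (n : Fin 2 → ℤ) (F : SpaceTime → ℂ), Measurable F →
    Integrable F volume → (∀ ζ, F ζ ≠ 0 → ζ ∈ cell n ∧ parabolicSize ζ ≤ 2 ^ (i + 1)) →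
    ∀ (m : Fin 2 → ℤ) (l : ℤ), ∃ U : ℝ → ℝ≥0∞, Measurable U ∧
      (∀ t, ∀ x ∈ tubeSlice ξ m t, ‖∫ ζ, F ζ * expi (inner ℝ ζ (pt x t))‖ₑ ≤ U t) ∧
      ∫⁻ t in Icc (l : ℝ) (l + 1), U t ^ 2 ≤ ENNReal.ofReal (C / 2 ^ j) * modNorm F ^ 2 := by
  set C₁ : ℝ := tubeConst.toReal ^ 2 * (32 * Real.pi) with hC₁
  refine ⟨max (128 + 32 * |R|) C₁, by positivity, ?_⟩
  intro i j hi hij ξ hξ n F hF hFi hs m l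
  -- If `2^j` dominates `R`, then `|ξ| ≥ 2^j / 8`, so some coordinate is at least `N = 2^j / 16` and
  -- smoothing applies. Otherwise `C / 2^j ≥ 1` and the constant majorant `modNorm F` is good
  -- enough.
  by_cases hj : 128 + 32 * |R| ≤ 2 ^ j
  · have hR : R ≤ 2 ^ j / 32 := by
      have := le_abs_self R
      have h0 := abs_nonneg R
      linarith
    obtain ⟨k, hk⟩ := exists_coord_ge (ξ := ξ) (a := 2 ^ j) (by
      have : (0 : ℝ) < 2 ^ j := by positivity
      linarith) (by positivity)
    -- For `i = 1` the condition `5 i ≤ j` alone does not give `i + 6 ≤ j`, which places the cell in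
    -- `|spatial ζ k| ≤ N / 2`.
    have hj7 : 7 ≤ j := by
      by_contra hcon
      have h1 : (2 : ℝ) ^ j ≤ 2 ^ 6 := pow_le_pow_right₀ (by norm_num) (by omega)
      have h2 := abs_nonneg R
      norm_num at h1
      linarith
    obtain ⟨U, hU, hU1, hU2⟩ := exists_tube_majorant hF hFi (n := n) (N := 2 ^ j / 16)
      (by positivity) hk (fun ζ hζ => ⟨fun k' => abs_le_of_mem_unitCube (hs ζ hζ).1 k', by
        have h1 := norm_spatial_le (hs ζ hζ).2
        have h2 := PiLp.norm_apply_le (spatial ζ) k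
        rw [Real.norm_eq_abs] at h2
        have h3 : (2 : ℝ) ^ (i + 6) ≤ 2 ^ j := pow_le_pow_right₀ (by norm_num) (by omega)
        rw [pow_add] at h3
        norm_num at h3
        linarith⟩) m
    refine ⟨U, hU, hU1, ?_⟩
    calc ∫⁻ t in Icc (l : ℝ) (l + 1), U t ^ 2 ≤ ∫⁻ t, U t ^ 2 := setLIntegral_le_lintegral _ _
      _ ≤ (tubeConst * (ENNReal.ofReal (2 * Real.pi / (2 ^ j / 16)) ^ (1 / 2 : ℝ) * modNorm F)) ^ 2 :=
        ENNReal_rpow_half_le_iff.1 hU2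
      _ = ENNReal.ofReal (C₁ / 2 ^ j) * modNorm F ^ 2 := by
        rw [mul_pow, mul_pow, ENNReal_rpow_half_sq, ← mul_assoc,
          ← ENNReal.ofReal_toReal tubeConst_ne_top, ← ENNReal.ofReal_pow ENNReal.toReal_nonneg,
          ← ENNReal.ofReal_mul (by positivity)]
        congr 2
        simp only [hC₁]
        field_simp
        ring
      _ ≤ _ := by
        gcongr
        exact le_max_right _ _
  · push Not at hj
    refine ⟨fun _ => modNorm F, measurable_const, ?_, ?_⟩
    · intro t x _
      refine (enorm_integral_le_lintegral_enorm _).trans ?_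
      simp only [enorm_mul, enorm_expi, mul_one]
      exact lintegral_le_modNorm hF fun ζ hζ => (hs ζ hζ).1
    · rw [setLIntegral_const, Real.volume_Icc]
      simp only [add_sub_cancel_left, ENNReal.ofReal_one, mul_one]
      refine le_mul_of_one_le_left zero_le ?_
      rw [ENNReal.one_le_ofReal, one_le_div (by positivity)]
      exact hj.le.trans (le_max_left _ _)

end Majorant

/-! ### The low-frequency factor and its cell pieces. -/

section LowFrequency

variable {φ₀ : ℝ → ℝ}

theorem measurableSet_parabolicSize_le (r : ℝ) : MeasurableSet {ζ : SpaceTime | parabolicSize ζ ≤ r} :=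
  (isClosed_le continuous_parabolicSize continuous_const).measurableSet

theorem isBounded_parabolicSize_le (r : ℝ) : Bornology.IsBounded {ζ : SpaceTime | parabolicSize ζ ≤ r} := by
  rw [isBounded_iff_forall_norm_le]
  refine ⟨r ^ 2 + 1 + (r ^ 2 + 1) ^ 2, fun ζ hζ => ?_⟩
  have h1 := pow_le_pow_left₀ (parabolicSize_nonneg ζ) (show parabolicSize ζ ≤ r from hζ) 2
  rw [parabolicSize_sq, norm_sq_plane] at h1
  simp only [spatial_zero, spatial_one] at h1
  have h2 : ‖ζ‖ ^ 2 = ζ 0 ^ 2 + ζ 1 ^ 2 + ζ 2 ^ 2 := by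
    rw [EuclideanSpace.norm_sq_eq]; simp [Fin.sum_univ_succ]; ring
  have h3 : ζ 2 ^ 2 ≤ (r ^ 2) ^ 2 := by
    rw [← sq_abs]; exact pow_le_pow_left₀ (abs_nonneg _) (by nlinarith [sq_nonneg (ζ 0), sq_nonneg (ζ 1)]) 2
  refine abs_le_of_sq_le_sq' ?_ (by positivity) |>.2
  rw [h2]
  nlinarith [abs_nonneg (ζ 2), sq_nonneg r, sq_nonneg (r ^ 2)]

theorem volume_parabolicSize_le_lt_top (r : ℝ) : volume {ζ : SpaceTime | parabolicSize ζ ≤ r} < ⊤ :=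
  (isBounded_parabolicSize_le r).measure_lt_top

/-- The Fourier transform of `u`, cut off to parabolic sizes at most `2^{i+1}`. -/
def lowPart (i : ℕ) (u : L2) : SpaceTime → ℂ :=
  {ζ | parabolicSize ζ ≤ 2 ^ (i + 1)}.indicator (hat u)

/-- The restriction of `lowPart` to a unit cell. -/
def cellPart (i : ℕ) (u : L2) (n : Fin 2 → ℤ) : SpaceTime → ℂ := (cell n).indicator (lowPart i u)

theorem measurable_lowPart (i : ℕ) (u : L2) : Measurable (lowPart i u) :=
  (measurable_hat u).indicator (measurableSet_parabolicSize_le _)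

theorem measurable_cellPart (i : ℕ) (u : L2) (n : Fin 2 → ℤ) : Measurable (cellPart i u n) :=
  (measurable_lowPart i u).indicator (measurableSet_cell n)

theorem memLp_lowPart (i : ℕ) (u : L2) : MemLp (lowPart i u) 2 volume :=
  (memLp_hat u).indicator (measurableSet_parabolicSize_le _)

theorem memLp_cellPart (i : ℕ) (u : L2) (n : Fin 2 → ℤ) : MemLp (cellPart i u n) 2 volume :=
  (memLp_lowPart i u).indicator (measurableSet_cell n)

theorem integrable_lowPart (i : ℕ) (u : L2) : Integrable (lowPart i u) volume := by
  have h := memLp_two_mul_integrable (memLp_indicator_const (μ := (volume : Measure SpaceTime)) 2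
    (measurableSet_parabolicSize_le (2 ^ (i + 1))) (1 : ℂ)
    (Or.inr (volume_parabolicSize_le_lt_top _).ne)) (memLp_hat u)
  refine h.congr (Filter.Eventually.of_forall fun ζ => ?_)
  by_cases hζ : ζ ∈ {ζ : SpaceTime | parabolicSize ζ ≤ 2 ^ (i + 1)}
  · simp only [lowPart, indicator_of_mem hζ, one_mul]
  · simp only [lowPart, indicator_of_notMem hζ, zero_mul]

theorem integrable_cellPart (i : ℕ) (u : L2) (n : Fin 2 → ℤ) : Integrable (cellPart i u n) volume :=
  (integrable_lowPart i u).indicator (measurableSet_cell n)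

theorem cellPart_support {i : ℕ} {u : L2} {n : Fin 2 → ℤ} {ζ : SpaceTime}
    (h : cellPart i u n ζ ≠ 0) : ζ ∈ cell n ∧ parabolicSize ζ ≤ 2 ^ (i + 1) := by
  have h1 : ζ ∈ cell n := mem_of_indicator_ne_zero h
  refine ⟨h1, ?_⟩
  rw [cellPart, indicator_of_mem h1] at h
  exact mem_of_indicator_ne_zero (s := {ζ | parabolicSize ζ ≤ 2 ^ (i + 1)}) h

theorem hat_ae_eq_lowPart (h : IsBasicCutoff φ₀) {i : ℕ} (hi : 1 ≤ i) {u : L2}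
    (hu : FourierSupportedIn u (regionA φ₀ i)) : hat u =ᵐ[volume] lowPart i u := by
  filter_upwards [hu] with ζ hζ
  by_cases h1 : ζ ∈ {ζ : SpaceTime | parabolicSize ζ ≤ 2 ^ (i + 1)}
  · rw [lowPart, indicator_of_mem h1]
  · rw [lowPart, indicator_of_notMem h1]
    exact hζ fun h2 => h1 (regionA_subset h hi h2).2

/-- The part of `u` with frequencies in a unit cell. -/
def cellPiece (i : ℕ) (u : L2) (n : Fin 2 → ℤ) : L2 :=
  (exists_hat_eq (memLp_cellPart i u n)).choose

theorem hat_cellPiece (i : ℕ) (u : L2) (n : Fin 2 → ℤ) :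
    hat (cellPiece i u n) =ᵐ[volume] cellPart i u n :=
  (exists_hat_eq (memLp_cellPart i u n)).choose_spec

theorem inversion_of_ae_eq {f : L2} {F : SpaceTime → ℂ} (hf : hat f =ᵐ[volume] F)
    (hF : Integrable F volume) :
    f =ᵐ[volume] fun x => (((2 * Real.pi) ^ 3)⁻¹ : ℝ) * ∫ ζ, F ζ * expi (inner ℝ ζ x) := by
  filter_upwards [hat_inversion (hF.congr hf.symm)] with x hx
  rw [hx]
  congr 1
  refine integral_congr_ae ?_
  filter_upwards [hf] with ζ hζ
  rw [hζ]

/-- An integrable Fourier transform makes `u` essentially bounded, so multiplication by it preserves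
`L²`. -/
theorem exists_mul_L2 {u : L2} {F : SpaceTime → ℂ} (hu : hat u =ᵐ[volume] F)
    (hF : Integrable F volume) (v : L2) : ∃ w : L2, w =ᵐ[volume] fun z => v z * u z := by
  have h1 := inversion_of_ae_eq hu hF
  have h2 : MemLp (fun z => v z * u z) 2 volume := by
    refine (Lp.memLp v).of_le_mul (c := ((2 * Real.pi) ^ 3)⁻¹ * ∫ ζ, ‖F ζ‖)
      ((Lp.aestronglyMeasurable v).mul (Lp.aestronglyMeasurable u)) ?_
    filter_upwards [h1] with z hz
    rw [norm_mul, hz, mul_comm, norm_mul, Complex.norm_real, Real.norm_of_nonneg (by positivity)]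
    gcongr
    refine (norm_integral_le_integral_norm _).trans_eq ?_
    simp
  exact ⟨h2.toLp _, h2.coeFn_toLp⟩

end LowFrequency

/-! ### Tilings by tubes and products on a tube. -/

section Tubes

theorem measurable_shift (ξ : Plane) : Measurable fun q : ℝ × Plane => q.2 + (2 * q.1) • ξ := by
  fun_prop

theorem measurableSet_tubeSlice (ξ : Plane) (m : Fin 2 → ℤ) (t : ℝ) :
    MeasurableSet (tubeSlice ξ m t) :=
  (by fun_prop : Measurable fun x : Plane => x + (2 * t) • ξ) (measurableSet_unitCube m)

theorem measurableSet_tube (ξ : Plane) (m : Fin 2 → ℤ) :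
    MeasurableSet {q : ℝ × Plane | q.2 ∈ tubeSlice ξ m q.1} :=
  measurable_shift ξ (measurableSet_unitCube m)

theorem measurable_setLIntegral_tubeSlice (ξ : Plane) (m : Fin 2 → ℤ) {g : SpaceTime → ℝ≥0∞}
    (hg : Measurable g) : Measurable fun t => ∫⁻ x in tubeSlice ξ m t, g (pt x t) := by
  have h : Measurable fun q : ℝ × Plane =>
      {q : ℝ × Plane | q.2 ∈ tubeSlice ξ m q.1}.indicator (fun q => g (pt q.2 q.1)) q :=
    (hg.comp measurePreserving_pt.measurable).indicator (measurableSet_tube ξ m)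
  have h2 := h.lintegral_prod_right' (ν := (volume : Measure Plane))
  convert! h2 using 2 with t
  rw [← lintegral_indicator (measurableSet_tubeSlice ξ m t)]
  rfl

theorem tsum_setLIntegral_tubeSlice (ξ : Plane) {g : SpaceTime → ℝ≥0∞} (hg : Measurable g) (t : ℝ) :
    ∑' m, ∫⁻ x in tubeSlice ξ m t, g (pt x t) = ∫⁻ x, g (pt x t) := by
  have hm : Measurable fun x : Plane => g (pt x t) := by fun_prop
  rw [tsum_congr fun m => (lintegral_indicator (measurableSet_tubeSlice ξ m t) fun x => g (pt x t)).symm]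
  rw [← lintegral_tsum fun m => (hm.indicator (measurableSet_tubeSlice ξ m t)).aemeasurable]
  refine lintegral_congr fun x => ?_
  have h := tsum_indicator_unitCube (fun _ => g (pt x t)) (x + (2 * t) • ξ)
  rw [← h]
  rfl

theorem tsum_lintegral_Icc {g : ℝ → ℝ≥0∞} :
    ∑' l : ℤ, ∫⁻ t in Icc (l : ℝ) (l + 1), g t = ∫⁻ t, g t := by
  rw [← setLIntegral_univ g, ← iUnion_Ioc_intCast ℝ,
    lintegral_iUnion (fun _ => measurableSet_Ioc) (pairwise_disjoint_Ioc_intCast ℝ)]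
  refine tsum_congr fun l => ?_
  rw [restrict_Ioc_eq_restrict_Icc]

/-- The tubes with a given velocity tile space-time. -/
theorem tsum_lintegral_tube (ξ : Plane) {g : SpaceTime → ℝ≥0∞} (hg : Measurable g) :
    ∑' (m : Fin 2 → ℤ) (l : ℤ), ∫⁻ t in Icc (l : ℝ) (l + 1), ∫⁻ x in tubeSlice ξ m t, g (pt x t) =
      ∫⁻ z, g z := by
  simp_rw [tsum_lintegral_Icc]
  rw [← lintegral_tsum fun m => (measurable_setLIntegral_tubeSlice ξ m hg).aemeasurable,
    lintegral_spaceTime hg]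
  refine lintegral_congr fun t => ?_
  rw [tsum_setLIntegral_tubeSlice ξ hg]

theorem sliceNorm_sq (ξ : Plane) (m : Fin 2 → ℤ) (f : L2) (t : ℝ) :
    sliceNorm ξ m f t ^ 2 = ∫⁻ x in tubeSlice ξ m t, ‖f (pt x t)‖ₑ ^ 2 :=
  ENNReal_rpow_half_sq _

theorem sliceNorm_mul_le {ξ : Plane} {m : Fin 2 → ℤ} {v g w : L2} {G : SpaceTime → ℂ}
    {U : ℝ → ℝ≥0∞} (hw : w =ᵐ[volume] fun z => v z * g z) (hg : g =ᵐ[volume] G)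
    (hU : ∀ t, ∀ x ∈ tubeSlice ξ m t, ‖G (pt x t)‖ₑ ≤ U t) :
    ∀ᵐ t, sliceNorm ξ m w t ≤ U t * sliceNorm ξ m v t := by
  filter_upwards [ae_ae_of_ae_spaceTime (hw.and hg)] with t ht
  have hm : Measurable fun x : Plane => ‖v (pt x t)‖ₑ ^ 2 := by
    have := measurable_coe_L2 v
    fun_prop
  have h1 : sliceNorm ξ m w t ^ 2 ≤ (U t * sliceNorm ξ m v t) ^ 2 := by
    rw [mul_pow, sliceNorm_sq, sliceNorm_sq, ← lintegral_const_mul _ hm]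
    refine setLIntegral_mono_ae (hm.const_mul _).aemeasurable ?_
    filter_upwards [ht] with x hx hxm
    rw [hx.1, enorm_mul, mul_pow, mul_comm, hx.2]
    gcongr
    exact hU t x hxm
  have h2 := ENNReal_rpow_half_le_iff.2 h1
  rwa [ENNReal_sq_rpow_half] at h2

/-- Hölder on a tube: `L^∞_t L²_x` for `v` against `L²_t L^∞_x` for `g`, the latter through the
majorant `U`. -/
theorem lintegral_tube_mul_le {ξ : Plane} {m : Fin 2 → ℤ} {l : ℤ} {v g w : L2} {G : SpaceTime → ℂ}
    {U : ℝ → ℝ≥0∞} (hw : w =ᵐ[volume] fun z => v z * g z) (hg : g =ᵐ[volume] G)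
    (hUm : Measurable U) (hU : ∀ t, ∀ x ∈ tubeSlice ξ m t, ‖G (pt x t)‖ₑ ≤ U t) :
    ∫⁻ t in Icc (l : ℝ) (l + 1), ∫⁻ x in tubeSlice ξ m t, ‖w (pt x t)‖ₑ ^ 2 ≤
      tubeNormSup ξ m l v ^ 2 * ∫⁻ t in Icc (l : ℝ) (l + 1), U t ^ 2 := by
  simp_rw [← sliceNorm_sq]
  rw [← lintegral_const_mul _ (hUm.pow_const 2)]
  refine lintegral_mono_ae ?_
  filter_upwards [ae_restrict_of_ae (sliceNorm_mul_le hw hg hU),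
    ENNReal.ae_le_essSup (μ := volume.restrict (Icc (l : ℝ) (l + 1))) (sliceNorm ξ m v)] with t h1 h2
  rw [← mul_pow]
  refine pow_le_pow_left' (h1.trans ?_) 2
  rw [mul_comm]
  gcongr
  exact h2

end Tubes

/-! ### Wave packets and the joint decomposition into packets and cells. -/

section Packets

variable {φ : lattice → Plane → ℝ}

theorem IsLatticePartition.exists_bound (h : IsLatticePartition φ) : ∃ B, 0 < B ∧ ∀ ξ x, |φ ξ x| ≤ B := by
  obtain ⟨B, hB⟩ := h.deriv_bound 0
  refine ⟨|B| + 1, by positivity, fun ξ x => ?_⟩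
  have := hB ξ x
  rw [norm_iteratedFDeriv_zero, Real.norm_eq_abs] at this
  linarith [le_abs_self B]

theorem IsLatticePartition.measurable_spatial (h : IsLatticePartition φ) (ξ : lattice) :
    Measurable fun ζ => φ ξ (spatial ζ) :=
  ((h.smooth ξ).continuous.comp continuous_spatial).measurable

theorem hat_packet (h : IsLatticePartition φ) (ξ : lattice) (f : L2) :
    hat (packet φ ξ f) =ᵐ[volume] fun ζ => (φ ξ (spatial ζ) : ℂ) * hat f ζ := by
  obtain ⟨B, _, hB⟩ := h.exists_bound
  exact hat_fourierMul (h.measurable_spatial ξ) (fun ζ => hB ξ _) f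

theorem finite_interacts (R : ℝ) {i j : ℕ} (hi : 1 ≤ i) (hij : 5 * i ≤ j) {ε : ℝ} (hε : |ε| = 1)
    (ζ : SpaceTime) : {p : lattice × (Fin 2 → ℤ) | Interacts R i j ε ζ p.1 p.2}.Finite := by
  obtain ⟨K, hK⟩ := card_interacts_le R
  by_contra hcon
  obtain ⟨S, hS, hc⟩ := Set.Infinite.exists_subset_card_eq hcon (K * 2 ^ i + 1)
  have := hK i j hi hij ε hε ζ S fun p hp => hS hp
  omega

/-- The cells and the packets decompose a point interaction. -/
theorem hasSum_cell_packet (h : IsLatticePartition φ) (η x : Plane) :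
    HasSum (fun p : lattice × (Fin 2 → ℤ) => (unitCube p.2).indicator (fun _ => φ p.1 x) η) 1 := by
  have hinj : Function.Injective fun ξ : lattice => (ξ, cubeIndex η) := fun a b hab => by
    simpa using hab
  rw [← hinj.hasSum_iff]
  · refine (h.sum_eq_one x).congr_fun ?_
    intro ξ
    simp [mem_unitCube_iff]
  · rintro ⟨ξ, n⟩ hn
    refine indicator_of_notMem (fun hmem => hn ?_) _
    exact ⟨ξ, Prod.ext rfl (mem_unitCube_iff.1 hmem).symm⟩

theorem enorm_sum_sq_le {ι : Type*} (S : Finset ι) (a : ι → ℂ) :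
    ‖∑ s ∈ S, a s‖ₑ ^ 2 ≤ S.card * ∑ s ∈ S, ‖a s‖ₑ ^ 2 := by
  have h1 : ‖∑ s ∈ S, a s‖ ^ 2 ≤ S.card * ∑ s ∈ S, ‖a s‖ ^ 2 :=
    (pow_le_pow_left₀ (norm_nonneg _) (norm_sum_le _ _) 2).trans sq_sum_le_card_mul_sum_sq
  have h2 := ENNReal.ofReal_le_ofReal h1
  rw [ENNReal.ofReal_mul (by positivity), ENNReal.ofReal_sum_of_nonneg fun _ _ => by positivity] at h2
  simpa [ENNReal.ofReal_pow, ofReal_norm] using h2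

end Packets

/-! ### First estimate: the high-frequency factor is near the paraboloid. -/

section NearParaboloid

variable {φ₀ : ℝ → ℝ} {φ : lattice → Plane → ℝ}

/-- The function given by the inversion formula for the part of `u` in a unit cell. -/
def cellInv (i : ℕ) (u : L2) (n : Fin 2 → ℤ) (x : SpaceTime) : ℂ :=
  (((2 * Real.pi) ^ 3)⁻¹ : ℝ) * ∫ ζ, cellPart i u n ζ * expi (inner ℝ ζ x)

theorem cellPiece_ae_eq (i : ℕ) (u : L2) (n : Fin 2 → ℤ) :
    cellPiece i u n =ᵐ[volume] cellInv i u n :=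
  inversion_of_ae_eq (hat_cellPiece i u n) (integrable_cellPart i u n)

theorem exists_cellInv_majorant (R : ℝ) : ∃ C : ℝ, 0 < C ∧ ∀ i j : ℕ, 1 ≤ i → 5 * i ≤ j →
    ∀ ξ : Plane, 2 ^ j / 4 - R ≤ ‖ξ‖ → ∀ (u : L2) (n m : Fin 2 → ℤ) (l : ℤ),
    ∃ U : ℝ → ℝ≥0∞, Measurable U ∧
      (∀ t, ∀ x ∈ tubeSlice ξ m t, ‖cellInv i u n (pt x t)‖ₑ ≤ U t) ∧
      ∫⁻ t in Icc (l : ℝ) (l + 1), U t ^ 2 ≤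
        ENNReal.ofReal (C / 2 ^ j) * modNorm (cellPart i u n) ^ 2 := by
  obtain ⟨C, hC, H⟩ := exists_majorant R
  refine ⟨C, hC, fun i j hi hij ξ hξ u n m l => ?_⟩
  obtain ⟨U, h1, h2, h3⟩ := H i j hi hij ξ hξ n (cellPart i u n) (measurable_cellPart i u n)
    (integrable_cellPart i u n) (fun ζ hζ => cellPart_support hζ) m l
  refine ⟨U, h1, fun t x hx => le_trans ?_ (h2 t x hx), h3⟩
  rw [cellInv, enorm_mul]
  refine mul_le_of_le_one_left zero_le ?_
  rw [← ofReal_norm, Complex.norm_real, Real.norm_of_nonneg (by positivity),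
    ENNReal.ofReal_le_one]
  refine inv_le_one_of_one_le₀ (one_le_pow₀ ?_)
  linarith [Real.pi_gt_three]

/-- The square of the norm of `Y_ξ`. -/
def packetSq (ξ : Plane) (f : L2) : ℝ≥0∞ :=
  ∑' (m : Fin 2 → ℤ) (l : ℤ), tubeNormSup ξ m l f ^ 2

/-- The part of `v̂` near the paraboloid at frequencies `≳ 2^j`. -/
def nearPart (i j : ℕ) (v : L2) : SpaceTime → ℂ :=
  {ζ | 2 ^ (j - 1) ≤ parabolicSize ζ ∧ |modulation ζ| ≤ 2 * 2 ^ (j - i)}.indicator (hat v)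

theorem nearPart_support {i j : ℕ} {v : L2} {ζ : SpaceTime} (h : nearPart i j v ζ ≠ 0) :
    2 ^ (j - 1) ≤ parabolicSize ζ ∧ |modulation ζ| ≤ 2 * 2 ^ (j - i) :=
  mem_of_indicator_ne_zero
    (s := {ζ | 2 ^ (j - 1) ≤ parabolicSize ζ ∧ |modulation ζ| ≤ 2 * 2 ^ (j - i)}) h

theorem hat_ae_eq_nearPart (h : IsBasicCutoff φ₀) {i j : ℕ} (hj : 1 ≤ j) (hij : i ≤ j) {v : L2}
    (hv : FourierSupportedIn v (regionBelow φ₀ j (-(i : ℤ)))) :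
    hat v =ᵐ[volume] nearPart i j v := by
  filter_upwards [hv] with ζ hζ
  by_cases h1 : ζ ∈ {ζ | 2 ^ (j - 1) ≤ parabolicSize ζ ∧ |modulation ζ| ≤ 2 * 2 ^ (j - i)}
  · rw [nearPart, indicator_of_mem h1]
  · rw [nearPart, indicator_of_notMem h1]
    refine hζ fun h2 => h1 ?_
    have := regionBelow_subset h hj hij h2
    exact ⟨this.1, this.2.2⟩

/-- The convolution formula for the Fourier transform of a product, with prescribed versions. -/
theorem hat_mul_congr {v u w : L2} {F G : SpaceTime → ℂ} (hu : hat u =ᵐ[volume] F)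
    (hF : Integrable F volume) (hv : hat v =ᵐ[volume] G) (hw : w =ᵐ[volume] fun x => v x * u x) :
    hat w =ᵐ[volume] fun ζ => (((2 * Real.pi) ^ 3)⁻¹ : ℝ) * ∫ ζ', F ζ' * G (ζ - ζ') := by
  filter_upwards [hat_mul (hF.congr hu.symm) hw] with ζ hζ
  rw [hζ]
  congr 1
  refine integral_congr_ae ?_
  have h2 := (Measure.measurePreserving_sub_left volume ζ).quasiMeasurePreserving.ae hv
  filter_upwards [hu, h2] with ζ' h3 h4
  rw [h3, h4]

theorem integrable_mul_sub {F G : SpaceTime → ℂ} (hF : MemLp F 2 volume) (hG : MemLp G 2 volume)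
    (ζ : SpaceTime) : Integrable (fun ζ' => F ζ' * G (ζ - ζ')) volume :=
  memLp_two_mul_integrable hF (hG.comp_measurePreserving (Measure.measurePreserving_sub_left volume ζ))

/-- Cells and packets both partition unity. Where the product is nonzero, `ζ'` itself witnesses that
each contributing pair interacts at `ζ` (with `ε = -1`), so the sum over all pairs reduces to a
finite set depending on `ζ` only. -/
theorem sum_cellPart_mul (hφ : IsLatticePartition φ) {R : ℝ}
    (hR : ∀ (ξ : lattice) (x : Plane), R < dist x ξ → φ ξ x = 0) {i j : ℕ}
    {u v : L2} {ζ : SpaceTime} {S : Finset (lattice × (Fin 2 → ℤ))}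
    (hS : ∀ p : lattice × (Fin 2 → ℤ), Interacts R i j (-1) ζ p.1 p.2 → p ∈ S) (ζ' : SpaceTime) :
    lowPart i u ζ' * nearPart i j v (ζ - ζ') = ∑ p ∈ S, cellPart i u p.2 ζ' *
      ((φ p.1 (spatial (ζ - ζ')) : ℂ) * nearPart i j v (ζ - ζ')) := by
  by_cases hz : lowPart i u ζ' = 0
  · have : ∀ n, cellPart i u n ζ' = 0 := fun n => by
      exact (indicator_apply_eq_zero (s := cell n)).2 fun _ => hz
    simp [this, hz]
  by_cases hz' : nearPart i j v (ζ - ζ') = 0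
  · simp [hz']
  have h7 := hasSum_cell_packet hφ (spatial ζ') (spatial (ζ - ζ'))
  have h8 : ∑ p ∈ S, (unitCube p.2).indicator (fun _ => φ p.1 (spatial (ζ - ζ'))) (spatial ζ')
      = 1 := by
    refine (hasSum_sum_of_ne_finset_zero ?_).unique h7
    intro p hp
    by_contra hne
    refine hp (hS p ?_)
    have h9 := mem_of_indicator_ne_zero hne
    rw [indicator_of_mem h9] at hne
    have e : ζ + (-1 : ℝ) • ζ' = ζ - ζ' := by rw [neg_one_smul, sub_eq_add_neg]
    refine ⟨ζ', mem_of_indicator_ne_zero (s := {ζ | parabolicSize ζ ≤ 2 ^ (i + 1)}) hz,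
      abs_le_of_mem_unitCube h9, ?_⟩
    rw [e]
    refine ⟨(nearPart_support hz').1, (nearPart_support hz').2, ?_⟩
    by_contra hcon
    push Not at hcon
    exact hne (hR _ _ hcon)
  have h10 : ∀ p : lattice × (Fin 2 → ℤ), cellPart i u p.2 ζ' *
      ((φ p.1 (spatial (ζ - ζ')) : ℂ) * nearPart i j v (ζ - ζ')) =
      (((unitCube p.2).indicator (fun _ => φ p.1 (spatial (ζ - ζ'))) (spatial ζ') : ℝ) : ℂ) *
        (lowPart i u ζ' * nearPart i j v (ζ - ζ')) := by
    intro p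
    by_cases hc : spatial ζ' ∈ unitCube p.2
    · rw [indicator_of_mem hc, cellPart, indicator_of_mem (show ζ' ∈ cell p.2 from hc)]; ring
    · rw [indicator_of_notMem hc, cellPart, indicator_of_notMem (show ζ' ∉ cell p.2 from hc)]
      simp
  rw [Finset.sum_congr rfl fun p _ => h10 p, ← Finset.sum_mul, ← Complex.ofReal_sum, h8]
  simp

/-- The Fourier transform of a product is pointwise controlled by those of the interactions of
packets with cells. -/
theorem enorm_hat_mul_sq_le (hφ : IsLatticePartition φ) {R : ℝ}
    (hR : ∀ (ξ : lattice) (x : Plane), R < dist x ξ → φ ξ x = 0) {K : ℕ} {i j : ℕ}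
    (hi : 1 ≤ i) (hij : 5 * i ≤ j)
    (hK : ∀ ζ : SpaceTime, ∀ S : Finset (lattice × (Fin 2 → ℤ)),
      (∀ p ∈ S, Interacts R i j (-1) ζ p.1 p.2) → S.card ≤ K * 2 ^ i)
    {u v w : L2} (hu : hat u =ᵐ[volume] lowPart i u) (hv : hat v =ᵐ[volume] nearPart i j v)
    (hw : w =ᵐ[volume] fun z => v z * u z) {W : lattice × (Fin 2 → ℤ) → L2}
    (hW : ∀ p, W p =ᵐ[volume] fun z => packet φ p.1 v z * cellPiece i u p.2 z) :
    ∀ᵐ ζ, ‖hat w ζ‖ₑ ^ 2 ≤ (K * 2 ^ i : ℕ) * ∑' p, ‖hat (W p) ζ‖ₑ ^ 2 := by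
  have h1 := hat_mul_congr hu (integrable_lowPart i u) hv hw
  have h2 : ∀ p : lattice × (Fin 2 → ℤ), hat (packet φ p.1 v) =ᵐ[volume]
      fun ζ => (φ p.1 (spatial ζ) : ℂ) * nearPart i j v ζ := fun p => by
    filter_upwards [hat_packet hφ p.1 v, hv] with ζ h3 h4
    rw [h3, h4]
  have h2' : ∀ p : lattice × (Fin 2 → ℤ), hat (W p) =ᵐ[volume]
      fun ζ => (((2 * Real.pi) ^ 3)⁻¹ : ℝ) * ∫ ζ', cellPart i u p.2 ζ' *
        ((φ p.1 (spatial (ζ - ζ')) : ℂ) * nearPart i j v (ζ - ζ')) := by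
    intro p
    have h4 := hat_mul_congr (hat_cellPiece i u p.2) (integrable_cellPart i u p.2) (h2 p) (hW p)
    exact h4
  have h3 := ae_all_iff.2 h2'
  filter_upwards [h1, h3] with ζ h4 h5
  -- At a fixed output frequency the decomposition is finite, so sum and integral commute and
  -- Cauchy–Schwarz costs only the number of interacting pairs.
  obtain ⟨S, hmem⟩ : ∃ S : Finset (lattice × (Fin 2 → ℤ)),
      ∀ p, p ∈ S ↔ Interacts R i j (-1) ζ p.1 p.2 :=
    ⟨(finite_interacts R hi hij (ε := -1) (by simp) ζ).toFinset, fun p => by simp⟩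
  have h6 : hat w ζ = ∑ p ∈ S, hat (W p) ζ := by
    rw [h4, Finset.sum_congr rfl fun p _ => h5 p, ← Finset.mul_sum, ← integral_finsetSum]
    · congr 1
      refine integral_congr_ae (Filter.Eventually.of_forall fun ζ' => ?_)
      exact sum_cellPart_mul hφ hR (fun p hp => (hmem p).2 hp) ζ'
    · intro p _
      refine integrable_mul_sub (memLp_cellPart i u p.2)
        (G := fun z => (φ p.1 (spatial z) : ℂ) * nearPart i j v z) ?_ ζ
      exact (memLp_congr_ae (h2 p)).1 (memLp_hat _)
  rw [h6]
  refine (enorm_sum_sq_le S _).trans ?_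
  gcongr
  · exact hK ζ S fun p hp => (hmem p).1 hp
  · exact ENNReal.sum_le_tsum S

/-- Near the paraboloid spatial frequencies are at least `2^j / 4`, out of reach of such a packet.
Thus the tube estimate is needed only for fast tubes. -/
theorem hat_packet_eq_zero (hφ : IsLatticePartition φ) {R : ℝ}
    (hR : ∀ (ξ : lattice) (x : Plane), R < dist x ξ → φ ξ x = 0) {i j : ℕ}
    (hi : 1 ≤ i) (hij : 5 * i ≤ j) {ξ : lattice} (hξ : ‖(ξ : Plane)‖ < 2 ^ j / 4 - R) {v : L2}
    (hv : hat v =ᵐ[volume] nearPart i j v) : hat (packet φ ξ v) =ᵐ[volume] 0 := by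
  filter_upwards [hat_packet hφ ξ v, hv] with ζ h1 h2
  rw [h1, h2]
  by_cases hz : nearPart i j v ζ = 0
  · simp [hz]
  have h3 := norm_spatial_ge hi hij (nearPart_support hz).1 (nearPart_support hz).2
  rw [hR ξ (spatial ζ)]
  · simp
  · rw [dist_eq_norm]
    have := norm_sub_norm_le (spatial ζ) (ξ : Plane)
    linarith

theorem ae_eq_zero_of_hat {f : L2} (h : hat f =ᵐ[volume] 0) : f =ᵐ[volume] 0 := by
  have h1 : ∫⁻ ζ, ‖hat f ζ‖ₑ ^ 2 = 0 := by
    rw [lintegral_eq_zero_iff ((measurable_hat f).enorm.pow_const 2)]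
    filter_upwards [h] with ζ hζ
    simp [hζ]
  rw [lintegral_hat_sq, mul_eq_zero, lintegral_eq_zero_iff ((measurable_coe_L2 f).enorm.pow_const 2)] at h1
  rcases h1 with h1 | h1
  · rw [ENNReal.ofReal_eq_zero] at h1
    have : (0 : ℝ) < (2 * Real.pi) ^ 3 := by positivity
    linarith
  · filter_upwards [h1] with z hz
    simpa using hz

/-- Space-time is tiled by the tubes with the velocity of the packet; on each the majorant applies
with the same gain, and the sum over tubes rebuilds the norm of `Y_ξ`. -/
theorem lintegral_packet_mul_cell_le (hφ : IsLatticePartition φ) {R : ℝ}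
    (hR : ∀ (ξ : lattice) (x : Plane), R < dist x ξ → φ ξ x = 0) : ∃ C : ℝ, 0 < C ∧
    ∀ i j : ℕ, 1 ≤ i → 5 * i ≤ j → ∀ (ξ : lattice) (n : Fin 2 → ℤ) (u v w : L2),
    hat v =ᵐ[volume] nearPart i j v →
    (w =ᵐ[volume] fun z => packet φ ξ v z * cellPiece i u n z) →
    ∫⁻ ζ, ‖hat w ζ‖ₑ ^ 2 ≤ ENNReal.ofReal (C / 2 ^ j) *
      (packetSq ξ (packet φ ξ v) * modNorm (cellPart i u n) ^ 2) := by
  obtain ⟨C, hC, H⟩ := exists_cellInv_majorant R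
  refine ⟨(2 * Real.pi) ^ 3 * C, by positivity, fun i j hi hij ξ n u v w hv hw => ?_⟩
  have hg : Measurable fun z => ‖w z‖ₑ ^ 2 := (measurable_coe_L2 w).enorm.pow_const 2
  rw [lintegral_hat_sq, mul_div_assoc, ENNReal.ofReal_mul (by positivity), mul_assoc]
  refine mul_le_mul_right ?_ _
  by_cases hξ : 2 ^ j / 4 - R ≤ ‖(ξ : Plane)‖
  · rw [← tsum_lintegral_tube ξ hg]
    calc _ ≤ ∑' (m : Fin 2 → ℤ) (l : ℤ), ENNReal.ofReal (C / 2 ^ j) * (tubeNormSup ξ m l (packet φ ξ v) ^ 2 *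
          modNorm (cellPart i u n) ^ 2) := by
          refine ENNReal.tsum_le_tsum fun m => ENNReal.tsum_le_tsum fun l => ?_
          obtain ⟨U, h1, h2, h3⟩ := H i j hi hij ξ hξ u n m l
          refine (lintegral_tube_mul_le hw (cellPiece_ae_eq i u n) h1 h2).trans ?_
          calc _ ≤ tubeNormSup ξ m l (packet φ ξ v) ^ 2 * (ENNReal.ofReal (C / 2 ^ j) *
                modNorm (cellPart i u n) ^ 2) := by gcongr
            _ = _ := by ring
      _ = _ := by
          simp_rw [ENNReal.tsum_mul_left, ENNReal.tsum_mul_right]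
          rfl
  · push Not at hξ
    have h0 := ae_eq_zero_of_hat (hat_packet_eq_zero hφ hR hi hij hξ hv)
    refine le_of_eq_of_le ?_ zero_le
    rw [lintegral_eq_zero_iff hg]
    filter_upwards [hw, h0] with z h1 h2
    simp [h1, h2]

/-- The bilinear estimate for a high-frequency factor near the paraboloid. -/
theorem exists_normX0On_mul_le (h : IsBasicCutoff φ₀) (hφ : IsLatticePartition φ) :
    ∃ C : ℝ, 0 < C ∧ ∀ i j : ℕ, 1 ≤ i → 5 * i ≤ j → ∀ u v w : L2,
      FourierSupportedIn u (regionA φ₀ i) → FourierSupportedIn v (regionBelow φ₀ j (-(i : ℤ))) →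
      (w =ᵐ[volume] fun z => v z * u z) →
      normX0On (-(1 / 2)) (regionAbove φ₀ j (-(i : ℤ))) w ≤
        ENNReal.ofReal (C * 2 ^ ((i : ℝ) - (j : ℝ))) * normY φ v * normX φ₀ u := by
  obtain ⟨R, hR⟩ := hφ.support
  obtain ⟨K, hK⟩ := card_interacts_le R
  obtain ⟨C, hC, hCw⟩ := lintegral_packet_mul_cell_le hφ hR
  -- `72` compares `modNorm` with the `X` norm; `K + 1` instead of `K` keeps the constant positive.
  refine ⟨72 * Real.sqrt ((K + 1) * C), by positivity, fun i j hi hij u v w hu hv hw => ?_⟩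
  have hu' := hat_ae_eq_lowPart h hi hu
  have hv' := hat_ae_eq_nearPart h (by omega) (by omega) hv
  choose W hW using fun p : lattice × (Fin 2 → ℤ) =>
    exists_mul_L2 (hat_cellPiece i u p.2) (integrable_cellPart i u p.2) (packet φ p.1 v)
  have h1 := enorm_hat_mul_sq_le hφ hR hi hij
    (fun ζ S hS => hK i j hi hij (-1) (by simp) ζ S hS) hu' hv' hw hW
  have h2 : ∫⁻ ζ, ‖hat w ζ‖ₑ ^ 2 ≤ (K * 2 ^ i : ℕ) * (ENNReal.ofReal (C / 2 ^ j) *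
      (normY φ v ^ 2 * (72 * normX φ₀ u) ^ 2)) := by
    refine (lintegral_mono_ae h1).trans ?_
    rw [lintegral_const_mul' _ _ (ENNReal.natCast_ne_top _),
      lintegral_tsum fun p => ((measurable_hat _).enorm.pow_const 2).aemeasurable]
    refine mul_le_mul_right ?_ _
    calc ∑' p, ∫⁻ ζ, ‖hat (W p) ζ‖ₑ ^ 2 ≤ ∑' p : lattice × (Fin 2 → ℤ), ENNReal.ofReal (C / 2 ^ j) *
          (packetSq p.1 (packet φ p.1 v) * modNorm (cellPart i u p.2) ^ 2) :=
          ENNReal.tsum_le_tsum fun p => hCw i j hi hij p.1 p.2 u v (W p) hv' (hW p)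
      _ = ENNReal.ofReal (C / 2 ^ j) * (normY φ v ^ 2 * ∑' n, modNorm (cellPart i u n) ^ 2) := by
          rw [ENNReal.tsum_mul_left, ENNReal.tsum_prod (f := fun (ξ : lattice) (n : Fin 2 → ℤ) =>
            packetSq ξ (packet φ ξ v) * modNorm (cellPart i u n) ^ 2)]
          simp_rw [ENNReal.tsum_mul_left, ENNReal.tsum_mul_right]
          rw [normY, ENNReal_rpow_half_sq]
          rfl
      _ ≤ _ := by
          gcongr
          refine (tsum_modNorm_cell_sq_le (measurable_lowPart i u)).trans ?_
          rw [← modNorm_congr hu']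
          gcongr
          exact modNorm_hat_le h hi hu
  rw [normX0On, ENNReal_rpow_half_le_iff]
  have hl : (0 : ℝ) < 2 ^ (j - i) := by positivity
  -- The squared weight is `⟨τ - |ξ|²⟩^{-1}`, at most `2^{-(j-i)}` on this region.
  have h3 : ∫⁻ ζ in regionAbove φ₀ j (-(i : ℤ)),
      ENNReal.ofReal ((1 + modulation ζ ^ 2) ^ (-(1 / 2) : ℝ)) * ‖hat w ζ‖ₑ ^ 2 ≤
      ENNReal.ofReal (1 / 2 ^ (j - i)) * ∫⁻ ζ, ‖hat w ζ‖ₑ ^ 2 := by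
    rw [← lintegral_const_mul' _ _ ENNReal.ofReal_ne_top]
    refine le_trans ?_ (setLIntegral_le_lintegral (regionAbove φ₀ j (-(i : ℤ))) _)
    refine setLIntegral_mono' (isClosed_tsupport _).measurableSet fun ζ hζ => ?_
    gcongr
    have h4 := (regionAbove_subset h (by omega) (by omega) hζ).2.2
    rw [Real.rpow_neg (by positivity), ← Real.sqrt_eq_rpow, one_div]
    refine inv_anti₀ hl (h4.trans (Real.le_sqrt_of_sq_le ?_))
    rw [sq_abs]; linarith
  refine (h3.trans (mul_le_mul_right h2 _)).trans ?_
  -- The powers of two: `2^i` from counting, `2^{-j}` from smoothing and `2^{-(j-i)}` from the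
  -- weight multiply to `(2^{i-j})²`.
  calc _ = ENNReal.ofReal (72 ^ 2 * ((K * C) * (2 ^ i / 2 ^ j) * (1 / 2 ^ (j - i)))) *
        normY φ v ^ 2 * normX φ₀ u ^ 2 := ?_
    _ ≤ ENNReal.ofReal ((72 * Real.sqrt ((K + 1) * C) * 2 ^ ((i : ℝ) - (j : ℝ))) ^ 2) *
        normY φ v ^ 2 * normX φ₀ u ^ 2 := by
      refine mul_le_mul_left (mul_le_mul_left (ENNReal.ofReal_le_ofReal ?_) _) _
      have e1 : (2 : ℝ) ^ ((i : ℝ) - (j : ℝ)) = 2 ^ i / 2 ^ j := by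
        rw [Real.rpow_sub (by norm_num), Real.rpow_natCast, Real.rpow_natCast]
      have e2 : (1 : ℝ) / 2 ^ (j - i) = 2 ^ i / 2 ^ j := by
        rw [div_eq_div_iff (by positivity) (by positivity), one_mul, ← pow_add]
        congr 1; omega
      rw [e1, e2, mul_pow, mul_pow, Real.sq_sqrt (by positivity)]
      have : 0 ≤ 72 ^ 2 * (C * (2 ^ i / 2 ^ j) ^ 2) := by positivity
      nlinarith
    _ = _ := ?_
  · rw [← ENNReal.ofReal_natCast, mul_pow 72, show (72 : ℝ≥0∞) = ENNReal.ofReal 72 by simp,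
      ← ENNReal.ofReal_pow (by norm_num)]
    have e : ENNReal.ofReal (72 ^ 2 * ((K * C) * (2 ^ i / 2 ^ j) * (1 / 2 ^ (j - i)))) =
        ENNReal.ofReal (1 / 2 ^ (j - i)) * ENNReal.ofReal ((K * 2 ^ i : ℕ) : ℝ) *
          ENNReal.ofReal (C / 2 ^ j) * ENNReal.ofReal (72 ^ 2) := by
      rw [← ENNReal.ofReal_mul (by positivity), ← ENNReal.ofReal_mul (by positivity),
        ← ENNReal.ofReal_mul (by positivity)]
      congr 1
      push_cast
      ring
    rw [e]
    ring
  · rw [ENNReal.ofReal_pow (by positivity), ← mul_pow, ← mul_pow]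

end NearParaboloid

/-! ### Translations and superpositions in `𝒴_ξ`. -/

section Translation

/-- The square of the norm of `𝒴_ξ`, for a nonnegative function. -/
def calSq (ξ : Plane) (g : SpaceTime → ℝ≥0∞) : ℝ≥0∞ :=
  ∑' q : (Fin 2 → ℤ) × ℤ, (∫⁻ t in Icc (q.2 : ℝ) (q.2 + 1),
    (∫⁻ x in tubeSlice ξ q.1 t, g (pt x t) ^ 2) ^ (1 / 2 : ℝ)) ^ 2

theorem tsum_tubeNormOne_sq (ξ : Plane) (f : L2) :
    ∑' (m : Fin 2 → ℤ) (l : ℤ), tubeNormOne ξ m l f ^ 2 = calSq ξ fun z => ‖f z‖ₑ :=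
  (ENNReal.tsum_prod (f := fun (m : Fin 2 → ℤ) (l : ℤ) => tubeNormOne ξ m l f ^ 2)).symm

theorem calSq_mono_ae {ξ : Plane} {g h : SpaceTime → ℝ≥0∞} (H : ∀ᵐ z, g z ≤ h z) :
    calSq ξ g ≤ calSq ξ h := by
  refine ENNReal.tsum_le_tsum fun q => pow_le_pow_left' ?_ 2
  refine lintegral_mono_ae (ae_restrict_of_ae ?_)
  filter_upwards [ae_ae_of_ae_spaceTime H] with t ht
  refine ENNReal.rpow_le_rpow ?_ (by norm_num)
  refine lintegral_mono_ae (ae_restrict_of_ae ?_)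
  filter_upwards [ht] with x hx
  gcongr

theorem calSq_const_mul (ξ : Plane) {c : ℝ≥0∞} {g : SpaceTime → ℝ≥0∞} (hc : c ≠ ⊤) :
    calSq ξ (fun z => c * g z) = c ^ 2 * calSq ξ g := by
  unfold calSq
  rw [← ENNReal.tsum_mul_left]
  refine tsum_congr fun q => ?_
  rw [← mul_pow, ← lintegral_const_mul' _ _ hc]
  congr 1
  refine lintegral_congr fun t => ?_
  simp_rw [mul_pow]
  rw [lintegral_const_mul' _ _ (by finiteness), ENNReal.mul_rpow_of_nonneg _ _ (by norm_num),
    ENNReal_sq_rpow_half]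

theorem measurable_slice {g : SpaceTime → ℝ≥0∞} (hg : Measurable g) (ξ : Plane) (m : Fin 2 → ℤ) :
    Measurable fun t => (∫⁻ x in tubeSlice ξ m t, g (pt x t) ^ 2) ^ (1 / 2 : ℝ) :=
  (measurable_setLIntegral_tubeSlice ξ m (hg.pow_const 2)).pow_const _

theorem lintegral_rpow_half_sum_le {ι : Type*} [Fintype ι] {S : Set Plane} {T : ι → Set Plane}
    {f : Plane → ℝ≥0∞} (hST : S ⊆ ⋃ e, T e) :
    (∫⁻ x in S, f x) ^ (1 / 2 : ℝ) ≤ ∑ e, (∫⁻ x in T e, f x) ^ (1 / 2 : ℝ) := by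
  have h1 : ∫⁻ x in S, f x ≤ ∑ e, ∫⁻ x in T e, f x := by
    refine (lintegral_mono_set hST).trans ((lintegral_iUnion_le _ _).trans_eq ?_)
    rw [tsum_fintype]
  refine (ENNReal.rpow_le_rpow h1 (by norm_num)).trans ?_
  have h2 : ∀ s : Finset ι, (∑ e ∈ s, ∫⁻ x in T e, f x) ^ (1 / 2 : ℝ) ≤
      ∑ e ∈ s, (∫⁻ x in T e, f x) ^ (1 / 2 : ℝ) := by
    classical
    intro s
    induction s using Finset.induction_on with
    | empty => simp
    | insert a s ha ih =>
      rw [Finset.sum_insert ha, Finset.sum_insert ha]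
      exact (ENNReal.rpow_add_le_add_rpow _ _ (by norm_num) (by norm_num)).trans (by gcongr)
  exact h2 _

/-- A translate of a unit cube meets at most four unit cubes. -/
theorem mem_unitCube_of_add {z c : Plane} {m : Fin 2 → ℤ} (h : z + c ∈ unitCube m) :
    ∃ e : Fin 2 → Fin 2, z ∈ unitCube fun k => m k - ⌊c k⌋ - (e k : ℕ) := by
  have h1 : ∀ k, ∃ e : Fin 2, z k ∈ Ico (((m k - ⌊c k⌋ - (e : ℕ) : ℤ) : ℝ) - 1 / 2)
      (((m k - ⌊c k⌋ - (e : ℕ) : ℤ) : ℝ) + 1 / 2) := by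
    intro k
    have h2 := h k
    rw [PiLp.add_apply] at h2
    have h3 := Int.floor_le (c k)
    have h4 := Int.lt_floor_add_one (c k)
    by_cases h5 : (m k : ℝ) - ⌊c k⌋ - 1 / 2 ≤ z k
    · refine ⟨0, ?_, ?_⟩
      · push_cast; simp; linarith
      · push_cast; simp; linarith [h2.2]
    · push Not at h5
      refine ⟨1, ?_, ?_⟩
      · push_cast; simp; linarith [h2.1]
      · push_cast; simp; linarith
  choose e he using h1
  exact ⟨e, fun k => he k⟩

/-- In coordinates moving with the tubes, translation by `p` shifts space by `spatial p + 2 p₂ ξ`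
and time by `p₂`. A shifted cube is covered by four lattice cubes and a shifted unit time interval
by two lattice intervals. -/
theorem tube_translate_le {ξ : Plane} {g : SpaceTime → ℝ≥0∞} (hg : Measurable g) (p : SpaceTime)
    (m : Fin 2 → ℤ) (l : ℤ) :
    ∫⁻ t in Icc (l : ℝ) (l + 1),
      (∫⁻ x in tubeSlice ξ m t, g (pt x t - p) ^ 2) ^ (1 / 2 : ℝ) ≤
    ∑ e : (Fin 2 → Fin 2) × Fin 2,
      ∫⁻ t in Icc ((l - ⌈p 2⌉ + (e.2 : ℕ) : ℤ) : ℝ) (((l - ⌈p 2⌉ + (e.2 : ℕ) : ℤ) : ℝ) + 1),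
        (∫⁻ x in tubeSlice ξ (fun k => m k - ⌊(spatial p + (2 * p 2) • ξ) k⌋ - (e.1 k : ℕ)) t,
          g (pt x t) ^ 2) ^ (1 / 2 : ℝ) := by
  set c : Plane := spatial p + (2 * p 2) • ξ with hc
  set T : (Fin 2 → Fin 2) → ℝ → ℝ≥0∞ := fun e t =>
    (∫⁻ x in tubeSlice ξ (fun k => m k - ⌊c k⌋ - (e k : ℕ)) t, g (pt x t) ^ 2) ^ (1 / 2 : ℝ) with hT
  have hTm : ∀ e, Measurable (T e) := fun e => measurable_slice hg ξ _
  have h1 : ∀ t, (∫⁻ x in tubeSlice ξ m t, g (pt x t - p) ^ 2) ^ (1 / 2 : ℝ) ≤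
      ∑ e, T e (t - p 2) := by
    intro t
    have h2 : ∫⁻ x in tubeSlice ξ m t, g (pt x t - p) ^ 2 =
        ∫⁻ x in {x | x + spatial p ∈ tubeSlice ξ m t}, g (pt x (t - p 2)) ^ 2 := by
      have hS : MeasurableSet {x | x + spatial p ∈ tubeSlice ξ m t} :=
        (measurable_add_const (spatial p)) (measurableSet_tubeSlice ξ m t)
      rw [← lintegral_indicator (measurableSet_tubeSlice ξ m t), ← lintegral_indicator hS,
        ← lintegral_add_right_eq_self _ (spatial p)]
      refine lintegral_congr fun x => ?_
      have e : pt (x + spatial p) t - p = pt x (t - p 2) := by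
        ext k; fin_cases k <;> simp
      by_cases hx : x + spatial p ∈ tubeSlice ξ m t
      · rw [indicator_of_mem hx, indicator_of_mem (show x ∈ {x | x + spatial p ∈ tubeSlice ξ m t} from hx), e]
      · rw [indicator_of_notMem hx, indicator_of_notMem (show x ∉ {x | x + spatial p ∈ tubeSlice ξ m t} from hx)]
    rw [h2]
    refine lintegral_rpow_half_sum_le fun x hx => ?_
    have hx' : x + spatial p + (2 * t) • ξ ∈ unitCube m := hx
    have h3 : x + spatial p + (2 * t) • ξ = (x + (2 * (t - p 2)) • ξ) + c := by
      rw [hc, mul_sub, sub_smul]; abel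
    rw [h3] at hx'
    obtain ⟨e, he⟩ := mem_unitCube_of_add hx'
    exact mem_iUnion.2 ⟨e, he⟩
  have h4 : ∀ e, ∫⁻ t in Icc (l : ℝ) (l + 1), T e (t - p 2) ≤ ∑ d : Fin 2,
      ∫⁻ t in Icc ((l - ⌈p 2⌉ + (d : ℕ) : ℤ) : ℝ) (((l - ⌈p 2⌉ + (d : ℕ) : ℤ) : ℝ) + 1), T e t := by
    intro e
    have h5 : ∫⁻ t in Icc (l : ℝ) (l + 1), T e (t - p 2) =
        ∫⁻ t in Icc (l - p 2) (l + 1 - p 2), T e t := by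
      rw [← lintegral_indicator measurableSet_Icc, ← lintegral_indicator measurableSet_Icc,
        ← lintegral_sub_right_eq_self ((Icc (l - p 2) (l + 1 - p 2)).indicator (T e)) (p 2)]
      refine lintegral_congr fun t => ?_
      simp only [indicator_apply, mem_Icc, sub_le_sub_iff_right]
    rw [h5]
    refine (lintegral_mono_set (t := ⋃ d : Fin 2, Icc ((l - ⌈p 2⌉ + (d : ℕ) : ℤ) : ℝ)
      (((l - ⌈p 2⌉ + (d : ℕ) : ℤ) : ℝ) + 1)) fun t ht => ?_).trans
      ((lintegral_iUnion_le _ _).trans_eq (tsum_fintype _))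
    have h6 := Int.le_ceil (p 2)
    have h7 := Int.ceil_lt_add_one (p 2)
    rw [mem_Icc] at ht
    rw [mem_iUnion]
    by_cases h8 : t ≤ l - ⌈p 2⌉ + 1
    · refine ⟨0, ?_, ?_⟩
      · push_cast; simp; linarith
      · push_cast; simp; linarith
    · push Not at h8
      refine ⟨1, ?_, ?_⟩
      · push_cast; simp; linarith
      · push_cast; simp; linarith
  calc _ ≤ ∫⁻ t in Icc (l : ℝ) (l + 1), ∑ e, T e (t - p 2) := lintegral_mono fun t => h1 t
    _ = ∑ e, ∫⁻ t in Icc (l : ℝ) (l + 1), T e (t - p 2) :=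
      lintegral_finsetSum _ fun e _ => (hTm e).comp (measurable_sub_const _)
    _ ≤ ∑ e, ∑ d : Fin 2, ∫⁻ t in Icc ((l - ⌈p 2⌉ + (d : ℕ) : ℤ) : ℝ)
        (((l - ⌈p 2⌉ + (d : ℕ) : ℤ) : ℝ) + 1), T e t := Finset.sum_le_sum fun e _ => h4 e
    _ = _ := by rw [Fintype.sum_prod_type]

theorem ENNReal_sq_sum_le {ι : Type*} (s : Finset ι) (f : ι → ℝ≥0∞) :
    (∑ e ∈ s, f e) ^ 2 ≤ s.card * ∑ e ∈ s, f e ^ 2 := by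
  have h := ENNReal.rpow_sum_le_const_mul_sum_rpow s f (p := 2) (by norm_num)
  norm_num at h
  exact h

/-- The norm of `𝒴_ξ` of a translate. -/
theorem calSq_translate_le (ξ : Plane) {g : SpaceTime → ℝ≥0∞} (hg : Measurable g) (p : SpaceTime) :
    calSq ξ (fun z => g (z - p)) ≤ 64 * calSq ξ g := by
  set N : (Fin 2 → ℤ) × ℤ → ℝ≥0∞ := fun q => (∫⁻ t in Icc (q.2 : ℝ) (q.2 + 1),
    (∫⁻ x in tubeSlice ξ q.1 t, g (pt x t) ^ 2) ^ (1 / 2 : ℝ)) ^ 2 with hN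
  set σ : (Fin 2 → Fin 2) × Fin 2 → (Fin 2 → ℤ) × ℤ → (Fin 2 → ℤ) × ℤ := fun e q =>
    (fun k => q.1 k - ⌊(spatial p + (2 * p 2) • ξ) k⌋ - (e.1 k : ℕ), q.2 - ⌈p 2⌉ + (e.2 : ℕ)) with hσ
  have hinj : ∀ e, Function.Injective (σ e) := by
    rintro e ⟨m, l⟩ ⟨m', l'⟩ h
    simp only [hσ, Prod.mk.injEq] at h
    refine Prod.ext (funext fun k => ?_) ?_
    · have := congrFun h.1 k
      dsimp only
      omega
    · dsimp only; omega
  have h1 : ∀ q : (Fin 2 → ℤ) × ℤ, (∫⁻ t in Icc (q.2 : ℝ) (q.2 + 1),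
      (∫⁻ x in tubeSlice ξ q.1 t, g (pt x t - p) ^ 2) ^ (1 / 2 : ℝ)) ^ 2 ≤
      8 * ∑ e, N (σ e q) := by
    intro q
    refine (pow_le_pow_left' (tube_translate_le hg p q.1 q.2) 2).trans ?_
    have h3 : (Finset.univ : Finset ((Fin 2 → Fin 2) × Fin 2)).card = 8 := by decide
    refine (ENNReal_sq_sum_le _ _).trans_eq ?_
    rw [h3]
    rfl
  -- `64 = 8 * 8`: Cauchy–Schwarz over the eight tubes, then eight index maps, each injective and so
  -- counting every tube at most once.
  calc _ ≤ ∑' q, 8 * ∑ e, N (σ e q) := ENNReal.tsum_le_tsum h1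
    _ = 8 * ∑ e, ∑' q, N (σ e q) := by
      rw [ENNReal.tsum_mul_left, Summable.tsum_finsetSum fun _ _ => ENNReal.summable]
    _ ≤ 8 * ∑ _e : (Fin 2 → Fin 2) × Fin 2, calSq ξ g := by
      gcongr with e
      exact ENNReal.tsum_comp_le_tsum_of_injective (hinj e) N
    _ = 64 * calSq ξ g := by
      rw [Finset.sum_const, show (Finset.univ : Finset ((Fin 2 → Fin 2) × Fin 2)).card = 8 by decide,
        nsmul_eq_mul, ← mul_assoc]
      norm_num

/-- Minkowski's inequality for the norm of `𝒴_ξ`. -/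
theorem calSq_lintegral_le (ξ : Plane) {F : SpaceTime → SpaceTime → ℝ≥0∞}
    (hF : Measurable (Function.uncurry F)) :
    calSq ξ (fun w => ∫⁻ z, F z w) ^ (1 / 2 : ℝ) ≤ ∫⁻ z, calSq ξ (F z) ^ (1 / 2 : ℝ) := by
  have hF1 : ∀ m, Measurable fun q : SpaceTime × ℝ × Plane =>
      {q : ℝ × Plane | q.2 ∈ tubeSlice ξ m q.1}.indicator (fun r => F q.1 (pt r.2 r.1)) q.2 := by
    intro m
    have h1 : Measurable fun q : SpaceTime × ℝ × Plane => F q.1 (pt q.2.2 q.2.1) :=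
      hF.comp (by fun_prop : Measurable fun q : SpaceTime × ℝ × Plane => (q.1, pt q.2.2 q.2.1))
    exact h1.indicator (s := {q : SpaceTime × ℝ × Plane | q.2.2 ∈ tubeSlice ξ m q.2.1})
      (measurable_snd (measurableSet_tube ξ m))
  have hS : ∀ m, Measurable fun q : SpaceTime × ℝ =>
      (∫⁻ x in tubeSlice ξ m q.2, F q.1 (pt x q.2) ^ 2) ^ (1 / 2 : ℝ) := by
    intro m
    refine Measurable.pow_const ?_ _
    have h2 := ((hF1 m).pow_const 2).comp
      (by fun_prop : Measurable fun q : (SpaceTime × ℝ) × Plane => (q.1.1, q.1.2, q.2))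
    convert! h2.lintegral_prod_right' (ν := (volume : Measure Plane)) using 2 with q
    rw [← lintegral_indicator (measurableSet_tubeSlice ξ m q.2)]
    refine lintegral_congr fun x => ?_
    by_cases hx : x ∈ tubeSlice ξ m q.2
    · rw [indicator_of_mem hx]
      simp [indicator_of_mem (show (q.2, x) ∈ {q : ℝ × Plane | q.2 ∈ tubeSlice ξ m q.1} from hx)]
    · rw [indicator_of_notMem hx]
      simp [indicator_of_notMem (show (q.2, x) ∉ {q : ℝ × Plane | q.2 ∈ tubeSlice ξ m q.1} from hx)]
  -- Minkowski in space at each time and Fubini in time; the `ℓ²` sum over tubes follows by a second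
  -- use of Minkowski.
  have h1 : ∀ q : (Fin 2 → ℤ) × ℤ, ∫⁻ t in Icc (q.2 : ℝ) (q.2 + 1),
      (∫⁻ x in tubeSlice ξ q.1 t, (∫⁻ z, F z (pt x t)) ^ 2) ^ (1 / 2 : ℝ) ≤
      ∫⁻ z, ∫⁻ t in Icc (q.2 : ℝ) (q.2 + 1),
        (∫⁻ x in tubeSlice ξ q.1 t, F z (pt x t) ^ 2) ^ (1 / 2 : ℝ) := by
    intro q
    rw [lintegral_lintegral_swap (hS q.1).aemeasurable]
    refine lintegral_mono fun t => ?_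
    exact lintegral_minkowski (F := fun (x : Plane) (z : SpaceTime) => F z (pt x t))
      (hF.comp (by fun_prop : Measurable fun r : Plane × SpaceTime => (r.2, pt r.1 t)))
  have h2 : ∀ q : (Fin 2 → ℤ) × ℤ, Measurable fun z => ∫⁻ t in Icc (q.2 : ℝ) (q.2 + 1),
        (∫⁻ x in tubeSlice ξ q.1 t, F z (pt x t) ^ 2) ^ (1 / 2 : ℝ) :=
    fun q => (hS q.1).lintegral_prod_right'
  refine le_trans ?_ (tsum_lintegral_minkowski h2)
  refine ENNReal.rpow_le_rpow ?_ (by norm_num)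
  exact ENNReal.tsum_le_tsum fun q => pow_le_pow_left' (h1 q) 2

/-- The norm of `𝒴_ξ` of a superposition of translates. -/
theorem calSq_superposition_le (ξ : Plane) {κ : SpaceTime → ℂ} (hκ : Measurable κ)
    {p : SpaceTime → SpaceTime} (hp : Measurable p) {f g : L2}
    (hg : g =ᵐ[volume] fun x => ∫ z, κ z * f (x - p z)) :
    calSq ξ (fun z => ‖g z‖ₑ) ≤ 64 * (∫⁻ z, ‖κ z‖ₑ) ^ 2 * calSq ξ fun z => ‖f z‖ₑ := by
  have hf := measurable_coe_L2 f
  have h1 : calSq ξ (fun z => ‖g z‖ₑ) ≤ calSq ξ fun w => ∫⁻ z, ‖κ z‖ₑ * ‖f (w - p z)‖ₑ := by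
    refine calSq_mono_ae ?_
    filter_upwards [hg] with x hx
    rw [hx]
    refine (enorm_integral_le_lintegral_enorm _).trans_eq ?_
    simp_rw [enorm_mul]
  refine h1.trans ?_
  rw [← ENNReal_rpow_half_sq (calSq ξ fun w => ∫⁻ z, ‖κ z‖ₑ * ‖f (w - p z)‖ₑ)]
  have h2 : calSq ξ (fun w => ∫⁻ z, ‖κ z‖ₑ * ‖f (w - p z)‖ₑ) ^ (1 / 2 : ℝ) ≤
      (∫⁻ z, ‖κ z‖ₑ) * (64 * calSq ξ fun z => ‖f z‖ₑ) ^ (1 / 2 : ℝ) := by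
    refine (calSq_lintegral_le ξ (F := fun z w => ‖κ z‖ₑ * ‖f (w - p z)‖ₑ) ?_).trans ?_
    · have : Measurable fun r : SpaceTime × SpaceTime => ‖κ r.1‖ₑ * ‖f (r.2 - p r.1)‖ₑ := by
        fun_prop
      exact this
    · rw [← lintegral_mul_const _ hκ.enorm]
      refine lintegral_mono fun z => ?_
      dsimp only
      rw [calSq_const_mul ξ enorm_ne_top, ENNReal.mul_rpow_of_nonneg _ _ (by norm_num),
        ENNReal_sq_rpow_half]
      gcongr
      exact calSq_translate_le ξ hf.enorm (p z)
  refine (pow_le_pow_left' h2 2).trans_eq ?_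
  rw [mul_pow, ENNReal_rpow_half_sq]
  ring

end Translation

/-! ### Smooth symbols as superpositions of characters, with uniform `L¹` bounds. -/

section Kernels

open SchwartzMap

/-- A compactly supported smooth function is a superposition of characters, with an `L¹` bound
depending only on the size of its support and of its derivatives. -/
theorem exists_kernel_bound (ρ : ℝ) (B : ℕ → ℝ) : ∃ C : ℝ, ∀ g : SpaceTime → ℂ, ContDiff ℝ ∞ g →
    (∀ w, g w ≠ 0 → ‖w‖ ≤ ρ) → (∀ n w, ‖w‖ ≤ ρ → ‖iteratedFDeriv ℝ n g w‖ ≤ B n) →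
    ∃ κ : SpaceTime → ℂ, Measurable κ ∧ Integrable κ volume ∧ ∫⁻ z, ‖κ z‖ₑ ≤ ENNReal.ofReal C ∧
      ∀ w, ∫ z, κ z * expi (2 * Real.pi * -inner ℝ z w) = g w := by
  -- The inverse transform is continuous from Schwartz space to `L¹`. Finitely many seminorms thus
  -- bound the norm of the kernel, and these are controlled by `ρ` and `B` alone; this gives the
  -- uniformity.
  set T : 𝓢(SpaceTime, ℂ) →L[ℂ] Lp ℂ 1 (volume : Measure SpaceTime) :=
    (toLpCLM ℂ ℂ 1 volume).comp (FourierTransform.fourierInvCLM ℂ 𝓢(SpaceTime, ℂ)) with hT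
  set q : Seminorm ℂ 𝓢(SpaceTime, ℂ) := (normSeminorm ℂ _).comp T.toLinearMap with hq
  have hqc : Continuous q := (continuous_norm.comp T.continuous)
  obtain ⟨s, C, _, hsC⟩ := Seminorm.bound_of_continuous (schwartz_withSeminorms ℂ SpaceTime ℂ) q hqc
  refine ⟨C * ∑ a ∈ s, |ρ| ^ a.1 * |B a.2|, fun g hg hs hB => ?_⟩
  have htsup : tsupport g ⊆ Metric.closedBall 0 ρ :=
    closure_minimal (fun w hw => by simpa using hs w hw) Metric.isClosed_closedBall
  have hc : HasCompactSupport g := (isCompact_closedBall (0 : SpaceTime) ρ).of_isClosed_subset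
    (isClosed_tsupport g) htsup
  set G : 𝓢(SpaceTime, ℂ) := hc.toSchwartzMap hg with hG
  have hGg : ∀ w, G w = g w := fun w => rfl
  have hsem : ∀ a : ℕ × ℕ, schwartzSeminormFamily ℂ SpaceTime ℂ a G ≤ |ρ| ^ a.1 * |B a.2| := by
    intro a
    refine seminorm_le_bound ℂ a.1 a.2 G (by positivity) fun w => ?_
    by_cases hw : ‖w‖ ≤ ρ
    · gcongr
      · exact hw.trans (le_abs_self ρ)
      · exact (hB a.2 w hw).trans (le_abs_self _)
    · have : iteratedFDeriv ℝ a.2 (⇑G) w = 0 := by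
        by_contra hne
        exact hw (by simpa using htsup (support_iteratedFDeriv_subset (𝕜 := ℝ) (f := g) a.2 hne))
      rw [this]
      simp
      positivity
  have h1 : ‖(𝓕⁻ G).toLp 1 (volume : Measure SpaceTime)‖ ≤ C * ∑ a ∈ s, |ρ| ^ a.1 * |B a.2| := by
    refine (hsC G).trans ?_
    rw [smul_apply]
    refine mul_le_mul_of_nonneg_left ?_ C.2
    refine Seminorm.finset_sup_apply_le (Finset.sum_nonneg fun _ _ => by positivity) fun a ha => ?_
    exact (hsem a).trans (Finset.single_le_sum (f := fun a : ℕ × ℕ => |ρ| ^ a.1 * |B a.2|)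
      (fun _ _ => by positivity) ha)
  set H : 𝓢(SpaceTime, ℂ) := 𝓕⁻ G with hH
  refine ⟨H, H.continuous.measurable, H.integrable, ?_, fun w => ?_⟩
  · rw [norm_toLp] at h1
    have h2 : eLpNorm H 1 (volume : Measure SpaceTime) = ∫⁻ z, ‖H z‖ₑ :=
      eLpNorm_one_eq_lintegral_enorm
    rw [h2] at h1
    exact (ENNReal.le_ofReal_iff_toReal_le H.integrable.2.ne (by positivity)).2 h1
  · rw [← fourier_eq_integral_expi, ← SchwartzMap.fourier_coe, hH, FourierTransform.fourier_fourierInv_eq,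
      hGg]

/-- The derivatives of a smooth function depending smoothly on parameters are bounded uniformly
for parameters in bounded sets. -/
theorem exists_iteratedFDeriv_bound {P V : Type*} [NormedAddCommGroup P] [NormedSpace ℝ P]
    [ProperSpace P] [NormedAddCommGroup V] [NormedSpace ℝ V] [ProperSpace V] {Ψ : P × V → ℝ}
    (hΨ : ContDiff ℝ ∞ Ψ) (A ρ : ℝ) (n : ℕ) : ∃ B : ℝ, ∀ a : P, ‖a‖ ≤ A → ∀ w : V, ‖w‖ ≤ ρ →
      ‖iteratedFDeriv ℝ n (fun w => Ψ (a, w)) w‖ ≤ B := by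
  have hK : IsCompact (Metric.closedBall (0 : P) A ×ˢ Metric.closedBall (0 : V) ρ) :=
    (isCompact_closedBall _ _).prod (isCompact_closedBall _ _)
  have hcont : Continuous fun p => ‖iteratedFDeriv ℝ n Ψ p‖ :=
    (hΨ.continuous_iteratedFDeriv (by exact_mod_cast le_top)).norm
  obtain ⟨B, hB⟩ := (hK.image hcont).bddAbove
  refine ⟨B * ∏ _i : Fin n, ‖ContinuousLinearMap.inr ℝ P V‖, fun a ha w hw => ?_⟩
  -- Freezing the parameter is composition with an affine embedding, so derivatives in `w` are
  -- restrictions of joint derivatives, which are bounded on a compact set.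
  have h1 : (fun w => Ψ (a, w)) = (fun p => Ψ ((a, 0) + p)) ∘ ContinuousLinearMap.inr ℝ P V := by
    ext w; simp
  have h2 : ContDiff ℝ ∞ fun p => Ψ ((a, 0) + p) := hΨ.comp (contDiff_const.add contDiff_id)
  rw [h1, ContinuousLinearMap.iteratedFDeriv_comp_right _ h2 _ (by exact_mod_cast le_top),
    iteratedFDeriv_comp_add_left]
  refine (ContinuousMultilinearMap.norm_compContinuousLinearMap_le _ _).trans ?_
  gcongr
  refine hB ⟨(a, w), ?_, by simp⟩
  simp [ha, hw]

/-- Uniform bounds for the derivatives of a product. -/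
theorem exists_iteratedFDeriv_mul_bound {V : Type*} [NormedAddCommGroup V] [NormedSpace ℝ V]
    (B₁ B₂ : ℕ → ℝ) (n : ℕ) : ∃ B : ℝ, ∀ f g : V → ℝ, ContDiff ℝ ∞ f → ContDiff ℝ ∞ g → ∀ w : V,
      (∀ k, ‖iteratedFDeriv ℝ k f w‖ ≤ B₁ k) → (∀ k, ‖iteratedFDeriv ℝ k g w‖ ≤ B₂ k) →
      ‖iteratedFDeriv ℝ n (fun w => f w * g w) w‖ ≤ B := by
  refine ⟨∑ k ∈ Finset.range (n + 1), (n.choose k : ℝ) * |B₁ k| * |B₂ (n - k)|,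
    fun f g hf hg w h1 h2 => ?_⟩
  refine (norm_iteratedFDeriv_mul_le hf hg w (n := n) (by exact_mod_cast le_top)).trans ?_
  gcongr with k hk
  · exact (h1 k).trans (le_abs_self _)
  · exact (h2 _).trans (le_abs_self _)

/-- The linear map `ζ ↦ spatial ζ`. -/
def spatialCLM : SpaceTime →L[ℝ] Plane :=
  LinearMap.toContinuousLinearMap
    { toFun := spatial
      map_add' := fun x y => by ext k; fin_cases k <;> simp
      map_smul' := fun c x => by ext k; fin_cases k <;> simp }

theorem contDiff_spatial : ContDiff ℝ ∞ spatial := spatialCLM.contDiff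

end Kernels

/-! ### Smoothness of the cut-offs as functions on the line. -/

section SmoothCutoffs

variable {φ₀ : ℝ → ℝ}

/-- The cut-off is constant near `0`, where the absolute value fails to be smooth. -/
theorem IsBasicCutoff.contDiff_abs (h : IsBasicCutoff φ₀) : ContDiff ℝ ∞ fun r : ℝ => φ₀ |r| := by
  rw [contDiff_iff_contDiffAt]
  intro r
  rcases eq_or_ne r 0 with rfl | hr
  · have : (fun r : ℝ => φ₀ |r|) =ᶠ[nhds 0] fun _ => 1 := by
      filter_upwards [Metric.ball_mem_nhds (0 : ℝ) one_pos] with x hx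
      have : |x| < 1 := by simpa using hx
      exact h.eq_one _ (abs_nonneg _) this.le
    exact contDiffAt_const.congr_of_eventuallyEq this
  · have h1 : ContDiffAt ℝ ∞ φ₀ |r| := h.smooth.contDiffAt (Ici_mem_nhds (abs_pos.2 hr))
    exact h1.comp r (contDiffAt_abs hr)

/-- The cut-off `φ₀(√r) - φ₀(2√r)` to `r` of size one. -/
def annulus (φ₀ : ℝ → ℝ) (r : ℝ) : ℝ := φ₀ (Real.sqrt r) - φ₀ (2 * Real.sqrt r)

theorem annulus_eq_zero_of_le (h : IsBasicCutoff φ₀) {r : ℝ} (hr : r ≤ 1 / 4) : annulus φ₀ r = 0 := by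
  have h1 : Real.sqrt r ≤ 1 / 2 := by
    rw [show (1 : ℝ) / 2 = Real.sqrt (1 / 4) by
      rw [show (1 : ℝ) / 4 = (1 / 2) ^ 2 by norm_num, Real.sqrt_sq (by norm_num)]]
    exact Real.sqrt_le_sqrt hr
  have h0 := Real.sqrt_nonneg r
  rw [annulus, h.eq_one _ h0 (by linarith), h.eq_one _ (by positivity) (by linarith), sub_self]

/-- The function vanishes for `r ≤ 1/4`, so the square root is only met where it is smooth. -/
theorem contDiff_annulus (h : IsBasicCutoff φ₀) : ContDiff ℝ ∞ (annulus φ₀) := by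
  rw [contDiff_iff_contDiffAt]
  intro r
  rcases lt_or_ge r (1 / 4) with hr | hr
  · have : annulus φ₀ =ᶠ[nhds r] fun _ => 0 := by
      filter_upwards [Iio_mem_nhds hr] with x hx
      exact annulus_eq_zero_of_le h (le_of_lt hx)
    exact contDiffAt_const.congr_of_eventuallyEq this
  · have hr0 : 0 < r := by linarith
    have hs : 0 < Real.sqrt r := Real.sqrt_pos.2 hr0
    have h1 : ContDiffAt ℝ ∞ φ₀ (Real.sqrt r) := h.smooth.contDiffAt (Ici_mem_nhds hs)
    have h2 : ContDiffAt ℝ ∞ φ₀ (2 * Real.sqrt r) := h.smooth.contDiffAt (Ici_mem_nhds (by positivity))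
    have h3 : ContDiffAt ℝ ∞ Real.sqrt r := Real.contDiffAt_sqrt hr0.ne'
    exact (h1.comp r h3).sub (h2.comp r (contDiffAt_const.mul h3))

end SmoothCutoffs

/-! ### Kernels of the localizations to packets near the paraboloid. -/

section PacketKernel

variable {φ₀ : ℝ → ℝ} {φ : lattice → Plane → ℝ}

/-- The symbol of `S_{j,≤2^{-i}}` in rescaled variables; the parameters are the coefficients of
the quadratic polynomials involved. -/
def profile (φ₀ : ℝ → ℝ) (p : (ℝ × Plane × ℝ × ℝ × ℝ) × SpaceTime) : ℝ :=
  φ₀ |p.2 2 - p.1.2.2.2.2 * ‖spatial p.2‖ ^ 2| *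
    annulus φ₀ (p.1.1 + inner ℝ p.1.2.1 (spatial p.2) + p.1.2.2.1 * ‖spatial p.2‖ ^ 2 +
      p.1.2.2.2.1 * p.2 2)

theorem contDiff_profile (h : IsBasicCutoff φ₀) : ContDiff ℝ ∞ (profile φ₀) := by
  have hs : ContDiff ℝ ∞ fun p : (ℝ × Plane × ℝ × ℝ × ℝ) × SpaceTime => spatial p.2 :=
    contDiff_spatial.comp contDiff_snd
  have ht : ContDiff ℝ ∞ fun p : (ℝ × Plane × ℝ × ℝ × ℝ) × SpaceTime => p.2 2 := by fun_prop
  have hn := hs.norm_sq ℝ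
  refine ContDiff.mul (h.contDiff_abs.comp (ht.sub (ContDiff.mul (by fun_prop) hn)))
    ((contDiff_annulus h).comp ?_)
  exact ((ContDiff.add (by fun_prop) (ContDiff.inner ℝ (by fun_prop) hs)).add
    (ContDiff.mul (by fun_prop) hn)).add (ContDiff.mul (by fun_prop) ht)

/-- Replaces `|τ|` by `τ`, so that the argument is a polynomial. If `τ < 0`, a modulation `≲
2^{j-i}` forces `|τ|` and `|ξ|²` to be that small; the point is then below the dyadic shell and both
sides vanish. -/
theorem symbBelow_eq_annulus (h : IsBasicCutoff φ₀) {i j : ℕ} (hi : 1 ≤ i) (hij : 5 * i ≤ j)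
    (ζ : SpaceTime) : symbBelow φ₀ j (-(i : ℤ)) ζ =
      φ₀ |modulation ζ / 2 ^ (j - i)| * annulus φ₀ ((ζ 2 + ‖spatial ζ‖ ^ 2) / 4 ^ j) := by
  have hl : (0 : ℝ) < 2 ^ (j - i) := by positivity
  rw [symbBelow_eq (by omega), abs_div, abs_of_pos hl, mul_comm]
  by_cases hm : φ₀ (|modulation ζ| / 2 ^ (j - i)) = 0
  · rw [hm, zero_mul, zero_mul]
  congr 1
  obtain ⟨l, rfl⟩ : ∃ l, j = l + 1 := ⟨j - 1, by omega⟩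
  have h4 : (4 : ℝ) ^ (l + 1) = (2 ^ (l + 1)) ^ 2 := by
    rw [← pow_mul, mul_comm, pow_mul]; norm_num
  rcases le_or_gt 0 (ζ 2) with h0 | h0
  · have h1 : Real.sqrt ((ζ 2 + ‖spatial ζ‖ ^ 2) / 4 ^ (l + 1)) = parabolicSize ζ / 2 ^ (l + 1) := by
      rw [Real.sqrt_div' _ (by positivity), h4, Real.sqrt_sq (by positivity), parabolicSize,
        abs_of_nonneg h0]
    rw [annulus, h1, symb, dyadic]
    congr 2
    rw [pow_succ]
    field_simp
  · have hm2 : |modulation ζ| ≤ 2 * 2 ^ (l + 1 - i) := by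
      by_contra hcon
      push Not at hcon
      exact hm (h.eq_zero _ (by rw [le_div_iff₀ hl]; exact hcon.le))
    have h5 := abs_le.1 hm2
    rw [modulation] at h5
    have h6 : (2 : ℝ) ^ (l + 1 - i) ≤ 2 ^ l := pow_le_pow_right₀ (by norm_num) (by omega)
    have h7 : (2 : ℝ) ^ 4 ≤ 2 ^ l := pow_le_pow_right₀ (by norm_num) (by omega)
    have hsq := sq_nonneg ‖spatial ζ‖
    have h8 : parabolicSize ζ ≤ 2 ^ l := by
      refine abs_le_of_sq_le_sq' ?_ (by positivity) |>.2
      rw [parabolicSize_sq, abs_of_neg h0]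
      nlinarith
    rw [symb, h.dyadic_eq_zero_of_le (by omega) (parabolicSize_nonneg ζ) (by simpa using h8),
      annulus_eq_zero_of_le h]
    rw [div_le_iff₀ (by positivity), h4, pow_succ (2 : ℝ) l]
    nlinarith

/-- The rescaled frequency variables around the frequency `ξ`. -/
def rescale (ξ : Plane) (lam : ℝ) (ζ : SpaceTime) : SpaceTime :=
  pt (spatial ζ - ξ) ((ζ 2 + ‖ξ‖ ^ 2 - 2 * inner ℝ ξ (spatial ζ)) / lam)

/-- The coefficients of the rescaled symbol. -/
def coeffs (ξ : Plane) (j : ℕ) (lam : ℝ) : ℝ × Plane × ℝ × ℝ × ℝ :=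
  (2 * ‖ξ‖ ^ 2 / 4 ^ j, (4 / 4 ^ j : ℝ) • ξ, 1 / 4 ^ j, lam / 4 ^ j, 1 / lam)

/-- Galilean change of frequency: with `y = η - ξ` and `λ w₂ = τ + |ξ|² - 2 ξ·η`, the modulation is
`λ w₂ - |y|²` and `τ + |η|² = 2|ξ|² + 4 ξ·y + |y|² + λ w₂`. -/
theorem profile_rescale (h : IsBasicCutoff φ₀) {i j : ℕ} (hi : 1 ≤ i) (hij : 5 * i ≤ j) (ξ : Plane)
    (ζ : SpaceTime) : profile φ₀ (coeffs ξ j (2 ^ (j - i)), rescale ξ (2 ^ (j - i)) ζ) =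
      symbBelow φ₀ j (-(i : ℤ)) ζ := by
  have hl : (0 : ℝ) < 2 ^ (j - i) := by positivity
  rw [symbBelow_eq_annulus h hi hij, profile]
  simp only [rescale, coeffs, spatial_pt, pt_two]
  have e : ‖spatial ζ - ξ‖ ^ 2 = ‖spatial ζ‖ ^ 2 - 2 * inner ℝ ξ (spatial ζ) + ‖ξ‖ ^ 2 := by
    rw [norm_sub_sq_real, real_inner_comm]
  congr 2
  · rw [e, modulation]
    congr 1
    field_simp
    ring
  · rw [e, inner_smul_left, inner_sub_right, real_inner_self_eq_norm_sq]
    simp only [conj_trivial]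
    field_simp
    ring

/-- Keeps the parameters of `profile` in a fixed ball, whatever `ξ`, `j` and `lam` are; compactness
then gives uniform kernels. -/
theorem norm_coeffs_le {ξ : Plane} {j : ℕ} {lam D : ℝ} (hD : 1 ≤ D) (hξ : ‖ξ‖ ≤ D * 2 ^ j)
    (h1 : 1 ≤ lam) (h2 : lam ≤ 4 ^ j) : ‖coeffs ξ j lam‖ ≤ 4 * D ^ 2 := by
  have h4 : (4 : ℝ) ^ j = (2 ^ j) ^ 2 := by rw [← pow_mul, mul_comm, pow_mul]; norm_num
  have h4' : (0 : ℝ) < 4 ^ j := by positivity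
  have hp : (1 : ℝ) ≤ 2 ^ j := one_le_pow₀ (by norm_num)
  have h0 := norm_nonneg ξ
  have hD2 : 1 ≤ D ^ 2 := one_le_pow₀ hD
  have h5 : ‖ξ‖ ^ 2 ≤ D ^ 2 * 4 ^ j := by
    rw [h4, ← mul_pow]; exact pow_le_pow_left₀ h0 hξ 2
  have h6 : ‖ξ‖ ≤ D ^ 2 * 4 ^ j := by
    rw [h4]
    calc ‖ξ‖ ≤ D * 2 ^ j := hξ
      _ ≤ D ^ 2 * (2 ^ j) ^ 2 := by
        gcongr
        · nlinarith
        · nlinarith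
  simp only [coeffs, Prod.norm_def, norm_smul, Real.norm_eq_abs]
  refine max_le ?_ (max_le ?_ (max_le ?_ (max_le ?_ ?_)))
  · rw [abs_of_nonneg (by positivity), div_le_iff₀ h4']; nlinarith
  · rw [abs_of_nonneg (by positivity), div_mul_eq_mul_div, div_le_iff₀ h4']; nlinarith
  · rw [abs_of_nonneg (by positivity), div_le_iff₀ h4']
    have : (1 : ℝ) ≤ 4 ^ j := one_le_pow₀ (by norm_num)
    nlinarith
  · rw [abs_of_nonneg (by positivity), div_le_iff₀ h4']; nlinarith
  · rw [abs_of_nonneg (by positivity), div_le_iff₀ (by linarith)]; nlinarith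

/-- In rescaled variables the symbols of the localizations to wave packets near the paraboloid
have uniformly bounded kernels. -/
theorem exists_rescaled_kernel (h : IsBasicCutoff φ₀) (hφ : IsLatticePartition φ) (A : ℝ) :
    ∃ C : ℝ, ∀ a : ℝ × Plane × ℝ × ℝ × ℝ, ‖a‖ ≤ A → 0 ≤ a.2.2.2.2 → a.2.2.2.2 ≤ 1 → ∀ ξ : lattice,
    ∃ κ : SpaceTime → ℂ, Measurable κ ∧ Integrable κ volume ∧ ∫⁻ z, ‖κ z‖ₑ ≤ ENNReal.ofReal C ∧
      ∀ w, ∫ z, κ z * expi (2 * Real.pi * -inner ℝ z w) =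
        ((φ ξ ((ξ : Plane) + spatial w) * profile φ₀ (a, w) : ℝ) : ℂ) := by
  obtain ⟨R, hR⟩ := hφ.support
  choose B₁ hB₁ using hφ.deriv_bound
  -- On the support `|spatial w| ≤ |R|` and `|w₂ - a |spatial w|²| ≤ 2` with `0 ≤ a ≤ 1`, so `|w₂| ≤
  -- 2 + R²`.
  set ρ := |R| + (2 + R ^ 2) with hρ
  choose B₂ hB₂ using exists_iteratedFDeriv_bound (contDiff_profile h) A ρ
  choose B hB using exists_iteratedFDeriv_mul_bound (V := SpaceTime)
    (fun k => B₁ k * ∏ _i : Fin k, ‖spatialCLM‖) B₂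
  obtain ⟨C, hC⟩ := exists_kernel_bound ρ B
  refine ⟨C, fun a ha ha0 ha1 ξ => hC (fun w => ((φ ξ ((ξ : Plane) + spatial w) *
    profile φ₀ (a, w) : ℝ) : ℂ)) ?_ ?_ ?_⟩
  · refine Complex.ofRealCLM.contDiff.comp (ContDiff.mul ?_ ?_)
    · exact (hφ.smooth ξ).comp (contDiff_const.add contDiff_spatial)
    · exact (contDiff_profile h).comp (contDiff_const.prodMk contDiff_id)
  · intro w hw
    rw [Complex.ofReal_ne_zero] at hw
    have h1 : ‖spatial w‖ ≤ |R| := by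
      refine le_trans ?_ (le_abs_self R)
      by_contra hcon
      push Not at hcon
      refine left_ne_zero_of_mul hw (hR _ _ ?_)
      rwa [dist_eq_norm, add_sub_cancel_left]
    have h2 : |w 2 - a.2.2.2.2 * ‖spatial w‖ ^ 2| ≤ 2 := by
      by_contra hcon
      push Not at hcon
      refine right_ne_zero_of_mul hw ?_
      rw [profile, h.eq_zero _ hcon.le, zero_mul]
    have h3 : ‖spatial w‖ ^ 2 ≤ R ^ 2 := by
      rw [← sq_abs R]; exact pow_le_pow_left₀ (norm_nonneg _) h1 2
    have h4 : |w 2| ≤ 2 + R ^ 2 := by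
      have h5 := abs_le.1 h2
      have h6 : 0 ≤ a.2.2.2.2 * ‖spatial w‖ ^ 2 := by positivity
      have h7 : a.2.2.2.2 * ‖spatial w‖ ^ 2 ≤ R ^ 2 := by nlinarith [sq_nonneg ‖spatial w‖]
      rw [abs_le]; constructor <;> linarith [h5.1, h5.2, sq_nonneg R]
    have h5 : ‖w‖ ^ 2 = ‖spatial w‖ ^ 2 + |w 2| ^ 2 := by
      rw [norm_sq_plane, EuclideanSpace.norm_sq_eq]
      simp [Fin.sum_univ_succ]
      ring
    refine abs_le_of_sq_le_sq' ?_ (by positivity) |>.2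
    rw [h5, hρ]
    nlinarith [abs_nonneg R, abs_nonneg (w 2), norm_nonneg (spatial w), sq_nonneg R]
  · intro n w hw
    have e : (fun w => ((φ ξ ((ξ : Plane) + spatial w) * profile φ₀ (a, w) : ℝ) : ℂ)) =
        Complex.ofRealLI ∘ fun w => φ ξ ((ξ : Plane) + spatial w) * profile φ₀ (a, w) := rfl
    have s1 : ContDiff ℝ ∞ fun w => φ ξ ((ξ : Plane) + spatial w) :=
      (hφ.smooth ξ).comp (contDiff_const.add contDiff_spatial)
    have s2 : ContDiff ℝ ∞ fun w => profile φ₀ (a, w) :=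
      (contDiff_profile h).comp (contDiff_const.prodMk contDiff_id)
    rw [e, LinearIsometry.norm_iteratedFDeriv_comp_left _ (s1.mul s2).contDiffAt
      (by exact_mod_cast le_top)]
    refine hB n _ _ s1 s2 w (fun k => ?_) (fun k => hB₂ k a ha w hw)
    have e2 : (fun w => φ ξ ((ξ : Plane) + spatial w)) =
        (fun x => φ ξ ((ξ : Plane) + x)) ∘ spatialCLM := rfl
    have s3 : ContDiff ℝ ∞ fun x => φ ξ ((ξ : Plane) + x) :=
      (hφ.smooth ξ).comp (contDiff_const.add contDiff_id)
    rw [e2, ContinuousLinearMap.iteratedFDeriv_comp_right _ s3 _ (by exact_mod_cast le_top),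
      iteratedFDeriv_comp_add_left]
    refine (ContinuousMultilinearMap.norm_compContinuousLinearMap_le _ _).trans ?_
    gcongr
    exact hB₁ k ξ _

/-- The localizations to wave packets near the paraboloid are superpositions of translations, with
uniformly bounded kernels. -/
theorem exists_packet_kernel (h : IsBasicCutoff φ₀) (hφ : IsLatticePartition φ) :
    ∃ C : ℝ, ∀ i j : ℕ, 1 ≤ i → 5 * i ≤ j → ∀ ξ : lattice,
    ∃ (κ : SpaceTime → ℂ) (p : SpaceTime → SpaceTime), Measurable κ ∧ Integrable κ volume ∧
      Measurable p ∧ ∫⁻ z, ‖κ z‖ₑ ≤ ENNReal.ofReal C ∧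
      ∀ ζ, ∫ z, κ z * expi (-inner ℝ (p z) ζ) =
        ((φ ξ (spatial ζ) * symbBelow φ₀ j (-(i : ℤ)) ζ : ℝ) : ℂ) := by
  obtain ⟨R, hR⟩ := hφ.support
  obtain ⟨C, hC⟩ := exists_rescaled_kernel h hφ (4 * (2 + |R|) ^ 2)
  refine ⟨C, fun i j hi hij ξ => ?_⟩
  by_cases hξ : ‖(ξ : Plane)‖ ≤ (2 + |R|) * 2 ^ j
  · set lam : ℝ := 2 ^ (j - i) with hlam
    have hl1 : 1 ≤ lam := one_le_pow₀ (by norm_num)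
    have hl4 : lam ≤ 4 ^ j :=
      (pow_le_pow_right₀ (by norm_num) (by omega : j - i ≤ j)).trans
        (pow_le_pow_left₀ (by norm_num) (by norm_num) j)
    obtain ⟨κ, hκ, hκi, hκC, hκg⟩ := hC (coeffs ξ j lam)
      (norm_coeffs_le (by linarith [abs_nonneg R]) hξ hl1 hl4)
      (by simp only [coeffs]; positivity)
      (by simp only [coeffs]; rw [div_le_one (by linarith)]; exact hl1) ξ
    -- The affine map `rescale` is transposed onto `z`: its linear part turns characters into
    -- translations by `p z`, and its constant part leaves the unimodular factor `expi (-b z)`,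
    -- which does not change the mass of the kernel.
    set b : SpaceTime → ℝ := fun z =>
      2 * Real.pi * (-inner ℝ (spatial z) (ξ : Plane) + z 2 * ‖(ξ : Plane)‖ ^ 2 / lam) with hb
    have hbm : Measurable b := by
      have : Continuous b := by
        have := continuous_spatial
        simp only [hb]
        fun_prop
      exact this.measurable
    refine ⟨fun z => κ z * expi (-b z), fun z => (2 * Real.pi) •
      pt (spatial z - (2 * z 2 / lam) • (ξ : Plane)) (z 2 / lam), ?_, ?_, ?_, ?_, ?_⟩
    · fun_prop
    · refine hκi.mul_bdd (c := 1) (by fun_prop) (Filter.Eventually.of_forall fun z => ?_)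
      rw [norm_expi]
    · fun_prop
    · simpa only [enorm_mul, enorm_expi, mul_one] using hκC
    · intro ζ
      have h1 := hκg (rescale ξ lam ζ)
      rw [hlam, profile_rescale h hi hij, ← hlam] at h1
      have e : (ξ : Plane) + spatial (rescale ξ lam ζ) = spatial ζ := by
        rw [rescale, spatial_pt]; abel
      rw [e] at h1
      rw [← h1]
      refine integral_congr_ae (Filter.Eventually.of_forall fun z => ?_)
      dsimp only
      rw [mul_assoc, ← expi_add]
      congr 2
      rw [inner_smul_left, inner_spaceTime, inner_spaceTime]
      simp only [hb, rescale, spatial_pt, pt_two, inner_sub_left, inner_sub_right, inner_smul_left,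
        conj_trivial]
      field_simp
      ring
  -- For larger `ξ` the symbol is identically zero: its frequencies are at most `2 * 2 ^ j` in space
  -- and must lie within `R` of `ξ`.
  · refine ⟨0, 0, measurable_zero, integrable_zero _ _ _, measurable_zero, by simp, fun ζ => ?_⟩
    have h0 : φ ξ (spatial ζ) * symbBelow φ₀ j (-(i : ℤ)) ζ = 0 := by
      by_contra hne
      have h1 := norm_spatial_le (symbBelow_ne_zero h (by omega) (by omega)
        (right_ne_zero_of_mul hne)).2.1
      refine left_ne_zero_of_mul hne (hR _ _ ?_)
      rw [dist_eq_norm, norm_sub_rev]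
      have h2 := norm_sub_norm_le (ξ : Plane) (spatial ζ)
      have h3 : (1 : ℝ) ≤ 2 ^ j := one_le_pow₀ (by norm_num)
      have h4 := le_abs_self R
      have h5 := abs_nonneg R
      nlinarith
    rw [h0]
    simp

end PacketKernel

/-! ### Interaction sets and sums over cells on a tube. -/

section FarFromParaboloid

variable {φ₀ : ℝ → ℝ} {φ : lattice → Plane → ℝ}

theorem hat_add (f g : L2) : hat (f + g) =ᵐ[volume] fun ζ => hat f ζ + hat g ζ := by
  have h1 : (𝓕 (f + g) : L2) = 𝓕 f + 𝓕 g := FourierTransform.fourier_add f g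
  have h2 := (measurePreserving_smul_two_pi two_pi_inv_pos.ne').ae
    (Lp.coeFn_add (𝓕 f : L2) (𝓕 g : L2))
  filter_upwards [h2] with ζ hζ
  unfold hat
  rw [h1, hζ, Pi.add_apply]

theorem hat_zero : hat 0 =ᵐ[volume] 0 := by
  have h1 : (𝓕 (0 : L2) : L2) = 0 := FourierTransform.fourier_zero
  have h2 := (measurePreserving_smul_two_pi two_pi_inv_pos.ne').ae
    (Lp.coeFn_zero ℂ 2 (volume : Measure SpaceTime))
  filter_upwards [h2] with ζ hζ
  unfold hat
  rw [h1, hζ]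
  rfl

theorem hat_sum {ι : Type*} (S : Finset ι) (f : ι → L2) :
    hat (∑ s ∈ S, f s) =ᵐ[volume] fun ζ => ∑ s ∈ S, hat (f s) ζ := by
  classical
  induction S using Finset.induction_on with
  | empty => simpa using! hat_zero
  | insert a S ha ih =>
    rw [Finset.sum_insert ha]
    filter_upwards [hat_add (f a) (∑ s ∈ S, f s), ih] with ζ h1 h2
    rw [h1, h2, Finset.sum_insert ha]

theorem coeFn_sum {ι : Type*} (S : Finset ι) (f : ι → L2) :
    (∑ s ∈ S, f s : L2) =ᵐ[volume] fun z => ∑ s ∈ S, f s z := by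
  classical
  induction S using Finset.induction_on with
  | empty => simpa using! Lp.coeFn_zero ℂ 2 (volume : Measure SpaceTime)
  | insert a S ha ih =>
    rw [Finset.sum_insert ha]
    filter_upwards [Lp.coeFn_add (f a) (∑ s ∈ S, f s), ih] with z h1 h2
    rw [h1, Pi.add_apply, h2, Finset.sum_insert ha]

-- The set is the sum of a closed set, where `ζ + ζᵤ` must lie, and the negative of the compact set
-- of admissible `ζᵤ`. This provides the measurability needed to cut off `v̂`.
open scoped Pointwise in
theorem isClosed_interacts (R : ℝ) (i j : ℕ) (ξ : lattice) (n : Fin 2 → ℤ) :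
    IsClosed {ζ : SpaceTime | Interacts R i j 1 ζ ξ n} := by
  set K : Set SpaceTime := {y | parabolicSize y ≤ 2 ^ (i + 1) ∧ ∀ k, |spatial y k - n k| ≤ 1 / 2} with hK
  set T : Set SpaceTime := {y | 2 ^ (j - 1) ≤ parabolicSize y ∧ |modulation y| ≤ 2 * 2 ^ (j - i) ∧
    dist (spatial y) ξ ≤ R} with hT
  have hKc : IsCompact K := by
    refine Metric.isCompact_of_isClosed_isBounded ?_
      ((isBounded_parabolicSize_le (2 ^ (i + 1))).subset fun y hy => hy.1)
    refine (isClosed_le continuous_parabolicSize continuous_const).inter ?_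
    have : {y : SpaceTime | ∀ k, |spatial y k - n k| ≤ 1 / 2} =
        ⋂ k, {y : SpaceTime | |spatial y k - n k| ≤ 1 / 2} := by ext; simp
    change IsClosed {y : SpaceTime | ∀ k, |spatial y k - n k| ≤ 1 / 2}
    rw [this]
    exact isClosed_iInter fun k => isClosed_le (by fun_prop) continuous_const
  have hTc : IsClosed T := (isClosed_le continuous_const continuous_parabolicSize).inter
    ((isClosed_le continuous_modulation.abs continuous_const).inter
      (isClosed_le (continuous_spatial.dist continuous_const) continuous_const))
  have h : {ζ : SpaceTime | Interacts R i j 1 ζ ξ n} = T + -K := by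
    ext ζ
    rw [Set.mem_add]
    constructor
    · rintro ⟨y, h1, h2, h3, h4, h5⟩
      rw [one_smul] at h3 h4 h5
      exact ⟨ζ + y, ⟨h3, h4, h5⟩, -y, Set.neg_mem_neg.2 ⟨h1, h2⟩, by abel⟩
    · rintro ⟨x, hx, y, hy, rfl⟩
      have hy' := Set.mem_neg.1 hy
      have e : x + y + (1 : ℝ) • -y = x := by rw [one_smul]; abel
      exact ⟨-y, hy'.1, hy'.2, by rw [e]; exact hx.1, by rw [e]; exact hx.2.1,
        by rw [e]; exact hx.2.2⟩
  rw [h]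
  exact hTc.add_right_of_isCompact hKc.neg

/-- The cells of parabolic size `≲ 2^i`. -/
def lowCells (i : ℕ) : Finset (Fin 2 → ℤ) :=
  Fintype.piFinset fun _ => Finset.Icc (-(2 * 2 ^ i + 1)) (2 * 2 ^ i + 1)

theorem sum_cellPart (i : ℕ) (u : L2) (ζ : SpaceTime) :
    ∑ n ∈ lowCells i, cellPart i u n ζ = lowPart i u ζ := by
  by_cases hz : lowPart i u ζ = 0
  · rw [hz]
    refine Finset.sum_eq_zero fun n _ => ?_
    exact (indicator_apply_eq_zero (s := cell n)).2 fun _ => hz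
  rw [Finset.sum_eq_single (cubeIndex (spatial ζ))]
  · exact indicator_of_mem (s := cell (cubeIndex (spatial ζ))) (mem_unitCube_iff.2 rfl) _
  · intro n _ hn
    exact indicator_of_notMem (s := cell n) (fun hc => hn (mem_unitCube_iff.1 hc)) _
  · intro hn
    refine absurd ?_ hn
    rw [lowCells, Fintype.mem_piFinset]
    intro k
    have h1 := norm_spatial_le
      (mem_of_indicator_ne_zero (s := {ζ | parabolicSize ζ ≤ 2 ^ (i + 1)}) hz)
    have h2 := abs_le.1 ((PiLp.norm_apply_le (spatial ζ) k).trans h1)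
    have h3 := abs_le.1 (abs_le_of_mem_unitCube (mem_unitCube_iff.2 rfl : spatial ζ ∈
      unitCube (cubeIndex (spatial ζ))) k)
    rw [Finset.mem_Icc]
    constructor
    · have : (-(2 * 2 ^ i + 1) : ℝ) ≤ cubeIndex (spatial ζ) k := by linarith [h2.1, h3.2]
      exact_mod_cast this
    · have : (cubeIndex (spatial ζ) k : ℝ) ≤ 2 * 2 ^ i + 1 := by linarith [h2.2, h3.1]
      exact_mod_cast this

theorem enorm_sum_mul_sq_le {ι : Type*} (S : Finset ι) (a b : ι → ℂ) :
    ‖∑ s ∈ S, a s * b s‖ₑ ^ 2 ≤ (∑ s ∈ S, ‖a s‖ₑ ^ 2) * ∑ s ∈ S, ‖b s‖ₑ ^ 2 := by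
  have h1 : ‖∑ s ∈ S, a s * b s‖ ^ 2 ≤ (∑ s ∈ S, ‖a s‖ ^ 2) * ∑ s ∈ S, ‖b s‖ ^ 2 := by
    refine (pow_le_pow_left₀ (norm_nonneg _) (norm_sum_le _ _) 2).trans ?_
    simp_rw [norm_mul]
    exact Finset.sum_mul_sq_le_sq_mul_sq _ _ _
  have h2 := ENNReal.ofReal_le_ofReal h1
  rw [ENNReal.ofReal_mul (Finset.sum_nonneg fun _ _ => by positivity),
    ENNReal.ofReal_sum_of_nonneg fun _ _ => by positivity,
    ENNReal.ofReal_sum_of_nonneg fun _ _ => by positivity] at h2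
  simpa [ENNReal.ofReal_pow, ofReal_norm] using h2

/-- Cauchy–Schwarz over `s` at each point, then in time, so that the `L¹_t` norm is bounded by two
`L²_t` norms; the smoothing gain sits in the factor with `U`. -/
theorem tubeNormOne_sum_mul_le {ι : Type*} {S : Finset ι} {ξ : Plane} {m : Fin 2 → ℤ} {l : ℤ}
    {w : L2} {v g : ι → L2} {G : ι → SpaceTime → ℂ} {U : ι → ℝ → ℝ≥0∞}
    (hw : w =ᵐ[volume] fun z => ∑ s ∈ S, v s z * g s z)
    (hg : ∀ᵐ z, ∀ s ∈ S, g s z = G s z) (hUm : ∀ s, Measurable (U s))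
    (hU : ∀ s t, ∀ x ∈ tubeSlice ξ m t, ‖G s (pt x t)‖ₑ ≤ U s t) :
    tubeNormOne ξ m l w ^ 2 ≤ (∑ s ∈ S, ∫⁻ t in Icc (l : ℝ) (l + 1), U s t ^ 2) *
      ∑ s ∈ S, ∫⁻ t in Icc (l : ℝ) (l + 1), ∫⁻ x in tubeSlice ξ m t, ‖v s (pt x t)‖ₑ ^ 2 := by
  have hvm : ∀ s, Measurable fun t => ∫⁻ x in tubeSlice ξ m t, ‖v s (pt x t)‖ₑ ^ 2 := fun s =>
    measurable_setLIntegral_tubeSlice ξ m (g := fun z => ‖v s z‖ₑ ^ 2)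
      ((measurable_coe_L2 (v s)).enorm.pow_const 2)
  rw [← lintegral_finsetSum _ fun s _ => (hUm s).pow_const 2, ← lintegral_finsetSum _ fun s _ => hvm s]
  have hslice : ∀ᵐ t, sliceNorm ξ m w t ≤ (∑ s ∈ S, U s t ^ 2) ^ (1 / 2 : ℝ) *
      (∑ s ∈ S, ∫⁻ x in tubeSlice ξ m t, ‖v s (pt x t)‖ₑ ^ 2) ^ (1 / 2 : ℝ) := by
    filter_upwards [ae_ae_of_ae_spaceTime (hw.and hg)] with t ht
    rw [sliceNorm, ENNReal_rpow_half_le_iff, mul_pow, ENNReal_rpow_half_sq, ENNReal_rpow_half_sq]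
    have hm : ∀ s, Measurable fun x : Plane => ‖v s (pt x t)‖ₑ ^ 2 := fun s => by
      have := measurable_coe_L2 (v s)
      fun_prop
    rw [← lintegral_finsetSum _ fun s _ => hm s, ← lintegral_const_mul _ (by fun_prop)]
    refine setLIntegral_mono_ae (by fun_prop) ?_
    filter_upwards [ht] with x hx hxm
    rw [hx.1, mul_comm]
    refine (enorm_sum_mul_sq_le S _ _).trans (mul_le_mul_right (Finset.sum_le_sum fun s hs => ?_) _)
    rw [hx.2 s hs]
    exact pow_le_pow_left' (hU s t x hxm) 2
  refine (pow_le_pow_left' (lintegral_mono_ae (ae_restrict_of_ae hslice)) 2).trans ?_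
  refine (sq_lintegral_mul_le (by fun_prop) ((Finset.measurable_sum S fun s _ =>
    hvm s).pow_const _).aemeasurable).trans_eq ?_
  simp_rw [ENNReal_rpow_half_sq]

/-- Estimate of the norm of `𝒴_ξ` of a sum of products with functions localized to cells. -/
theorem exists_calSq_sum_le (R : ℝ) : ∃ C : ℝ, 0 < C ∧ ∀ i j : ℕ, 1 ≤ i → 5 * i ≤ j →
    ∀ ξ : Plane, 2 ^ j / 4 - R ≤ ‖ξ‖ → ∀ (u w : L2) (v : (Fin 2 → ℤ) → L2),
    (w =ᵐ[volume] fun z => ∑ n ∈ lowCells i, v n z * cellPiece i u n z) →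
    calSq ξ (fun z => ‖w z‖ₑ) ≤ ENNReal.ofReal (C / 2 ^ j) * modNorm (lowPart i u) ^ 2 *
      ∑ n ∈ lowCells i, ∫⁻ z, ‖v n z‖ₑ ^ 2 := by
  obtain ⟨C, hC, H⟩ := exists_cellInv_majorant R
  refine ⟨C, hC, fun i j hi hij ξ hξ u w v hw => ?_⟩
  have hg : ∀ᵐ z, ∀ n ∈ lowCells i, cellPiece i u n z = cellInv i u n z := by
    have := ae_all_iff.2 fun n => cellPiece_ae_eq i u n
    filter_upwards [this] with z hz n _ using hz n
  have hcells : ∑ n ∈ lowCells i, modNorm (cellPart i u n) ^ 2 ≤ modNorm (lowPart i u) ^ 2 :=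
    (ENNReal.sum_le_tsum _).trans (tsum_modNorm_cell_sq_le (measurable_lowPart i u))
  rw [← tsum_tubeNormOne_sq]
  calc _ ≤ ∑' (m : Fin 2 → ℤ) (l : ℤ), ENNReal.ofReal (C / 2 ^ j) * modNorm (lowPart i u) ^ 2 *
        ∑ n ∈ lowCells i, ∫⁻ t in Icc (l : ℝ) (l + 1), ∫⁻ x in tubeSlice ξ m t,
          ‖v n (pt x t)‖ₑ ^ 2 := by
        refine ENNReal.tsum_le_tsum fun m => ENNReal.tsum_le_tsum fun l => ?_
        choose U hU1 hU2 hU3 using fun n => H i j hi hij ξ hξ u n m l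
        refine (tubeNormOne_sum_mul_le hw hg hU1 hU2).trans (mul_le_mul_left ?_ _)
        refine (Finset.sum_le_sum fun n _ => hU3 n).trans ?_
        rw [← Finset.mul_sum]
        gcongr
    _ = _ := by
        simp_rw [ENNReal.tsum_mul_left]
        congr 1
        rw [← tsum_congr fun m => (Summable.tsum_finsetSum fun _ _ => ENNReal.summable).symm,
          Summable.tsum_finsetSum fun _ _ => ENNReal.summable]
        refine Finset.sum_congr rfl fun n _ => ?_
        exact tsum_lintegral_tube ξ (g := fun z => ‖v n z‖ₑ ^ 2)
          ((measurable_coe_L2 (v n)).enorm.pow_const 2)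

end FarFromParaboloid

/-! ### Second estimate: the high-frequency factor is away from the paraboloid. -/

section CalYEstimate

variable {φ₀ : ℝ → ℝ} {φ : lattice → Plane → ℝ}

theorem hat_packet_fourierMul (h : IsBasicCutoff φ₀) (hφ : IsLatticePartition φ) {i j : ℕ}
    (hij : i ≤ j) (ξ : lattice) (f : L2) :
    hat (packet φ ξ (fourierMul (symbBelow φ₀ j (-(i : ℤ))) f)) =ᵐ[volume]
      fun ζ => ((φ ξ (spatial ζ) * symbBelow φ₀ j (-(i : ℤ)) ζ : ℝ) : ℂ) * hat f ζ := by
  obtain ⟨B, _, hB⟩ := h.exists_symbBelow_bound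
  filter_upwards [hat_packet hφ ξ (fourierMul (symbBelow φ₀ j (-(i : ℤ))) f),
    hat_fourierMul (continuous_symbBelow h j (-(i : ℤ))).measurable (hB i j hij) f] with ζ h1 h2
  rw [h1, h2]
  push_cast
  ring

/-- The interaction of `v` with a cell, localized to a packet near the paraboloid, only depends on
the part of `v` at interacting frequencies. -/
theorem integral_cell_eq (h : IsBasicCutoff φ₀) {R : ℝ}
    (hR : ∀ (ξ : lattice) (x : Plane), R < dist x ξ → φ ξ x = 0) {i j : ℕ} (hi : 1 ≤ i)
    (hij : 5 * i ≤ j) (ξ : lattice) (u v : L2) {ζ : SpaceTime}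
    (hm : φ ξ (spatial ζ) * symbBelow φ₀ j (-(i : ℤ)) ζ ≠ 0) :
    ∫ ζ', lowPart i u ζ' * hat v (ζ - ζ') = ∑ n ∈ lowCells i, ∫ ζ', cellPart i u n ζ' *
      {ζ | Interacts R i j 1 ζ ξ n}.indicator (hat v) (ζ - ζ') := by
  rw [← integral_finsetSum]
  · refine integral_congr_ae (Filter.Eventually.of_forall fun ζ' => ?_)
    dsimp only
    rw [← sum_cellPart i u ζ', Finset.sum_mul]
    refine Finset.sum_congr rfl fun n _ => ?_
    by_cases hz : cellPart i u n ζ' = 0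
    · rw [hz, zero_mul, zero_mul]
    congr 1
    refine (indicator_of_mem (s := {ζ | Interacts R i j 1 ζ ξ n}) ?_ _).symm
    have e : ζ - ζ' + (1 : ℝ) • ζ' = ζ := by rw [one_smul]; abel
    have h1 := cellPart_support hz
    have h2 := symbBelow_ne_zero h (by omega) (by omega) (right_ne_zero_of_mul hm)
    refine ⟨ζ', h1.2, abs_le_of_mem_unitCube h1.1, ?_⟩
    rw [e]
    refine ⟨h2.1, h2.2.2, ?_⟩
    by_contra hcon
    push Not at hcon
    exact left_ne_zero_of_mul hm (hR _ _ hcon)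
  · intro n _
    exact integrable_mul_sub (memLp_cellPart i u n)
      ((memLp_hat v).indicator (isClosed_interacts R i j ξ n).measurableSet) ζ

/-- The part of `v` at the frequencies interacting with a given packet and a given cell. -/
def interactPart (R : ℝ) (i j : ℕ) (v : L2) (p : lattice × (Fin 2 → ℤ)) : L2 :=
  (exists_hat_eq ((memLp_hat v).indicator (isClosed_interacts R i j p.1 p.2).measurableSet)).choose

theorem hat_interactPart (R : ℝ) (i j : ℕ) (v : L2) (p : lattice × (Fin 2 → ℤ)) :
    hat (interactPart R i j v p) =ᵐ[volume]
      {ζ | Interacts R i j 1 ζ p.1 p.2}.indicator (hat v) :=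
  (exists_hat_eq ((memLp_hat v).indicator
    (isClosed_interacts R i j p.1 p.2).measurableSet)).choose_spec

theorem lintegral_interactPart_le (R : ℝ) (i j : ℕ) (v : L2) (p : lattice × (Fin 2 → ℤ)) :
    ∫⁻ z, ‖interactPart R i j v p z‖ₑ ^ 2 ≤
      ∫⁻ ζ, {ζ | Interacts R i j 1 ζ p.1 p.2}.indicator (fun ζ => ‖hat v ζ‖ₑ ^ 2) ζ := by
  calc ∫⁻ z, ‖interactPart R i j v p z‖ₑ ^ 2 ≤ ENNReal.ofReal ((2 * Real.pi) ^ 3) *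
        ∫⁻ z, ‖interactPart R i j v p z‖ₑ ^ 2 := by
        refine le_mul_of_one_le_left zero_le ?_
        rw [ENNReal.one_le_ofReal]
        refine one_le_pow₀ ?_
        linarith [Real.pi_gt_three]
    _ = ∫⁻ ζ, ‖hat (interactPart R i j v p) ζ‖ₑ ^ 2 := (lintegral_hat_sq _).symm
    _ = _ := by
        refine lintegral_congr_ae ?_
        filter_upwards [hat_interactPart R i j v p] with ζ hζ
        rw [hζ]
        by_cases hm : ζ ∈ {ζ | Interacts R i j 1 ζ p.1 p.2}
        · rw [indicator_of_mem hm, indicator_of_mem hm]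
        · rw [indicator_of_notMem hm, indicator_of_notMem hm]; simp

/-- Almost orthogonality: by the count of interactions with `ε = 1`, at most `K * 2 ^ i` of the
cut-offs are nonzero at any `ζ`. -/
theorem tsum_lintegral_interactPart_le {R : ℝ} {K : ℕ} {i j : ℕ} (hi : 1 ≤ i) (hij : 5 * i ≤ j)
    (hK : ∀ ζ : SpaceTime, ∀ S : Finset (lattice × (Fin 2 → ℤ)),
      (∀ p ∈ S, Interacts R i j 1 ζ p.1 p.2) → S.card ≤ K * 2 ^ i) (v : L2) :
    ∑' p, ∫⁻ z, ‖interactPart R i j v p z‖ₑ ^ 2 ≤ (K * 2 ^ i : ℕ) * ∫⁻ ζ, ‖hat v ζ‖ₑ ^ 2 := by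
  have h1 := lintegral_interactPart_le R i j v
  have hvm : Measurable fun ζ => ‖hat v ζ‖ₑ ^ 2 := (measurable_hat v).enorm.pow_const 2
  refine (ENNReal.tsum_le_tsum h1).trans ?_
  have hm : ∀ p : lattice × (Fin 2 → ℤ), AEMeasurable
      ({ζ | Interacts R i j 1 ζ p.1 p.2}.indicator fun ζ => ‖hat v ζ‖ₑ ^ 2) volume := by
    intro p
    have h2 := (isClosed_interacts R i j p.1 p.2).measurableSet
    exact (hvm.indicator h2).aemeasurable
  rw [← lintegral_tsum hm, ← lintegral_const_mul _ hvm]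
  refine lintegral_mono fun ζ => ?_
  obtain ⟨S, hS⟩ : ∃ S : Finset (lattice × (Fin 2 → ℤ)),
      ∀ p, p ∈ S ↔ Interacts R i j 1 ζ p.1 p.2 :=
    ⟨(finite_interacts R hi hij (ε := 1) (by simp) ζ).toFinset, fun p => by simp⟩
  have hS0 : ∀ p, p ∉ S →
      {ζ | Interacts R i j 1 ζ p.1 p.2}.indicator (fun ζ => ‖hat v ζ‖ₑ ^ 2) ζ = 0 := by
    intro p hp
    exact indicator_of_notMem (s := {ζ | Interacts R i j 1 ζ p.1 p.2})
      (fun hm => hp ((hS p).2 hm)) _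
  have hcard : (S.card : ℝ≥0∞) ≤ (K * 2 ^ i : ℕ) :=
    Nat.cast_le.2 (hK ζ S fun p hp => (hS p).1 hp)
  rw [tsum_eq_sum hS0]
  refine (Finset.sum_le_card_nsmul S _ (‖hat v ζ‖ₑ ^ 2) fun p _ => ?_).trans ?_
  · exact indicator_le_self {ζ | Interacts R i j 1 ζ p.1 p.2} (fun ζ => ‖hat v ζ‖ₑ ^ 2) ζ
  · rw [nsmul_eq_mul]
    exact mul_le_mul_left hcard _

/-- On the support of the output symbol the product `v u` may be replaced by the sum over cells of
`interactPart` times the cell piece. The kernel of the localization costs a constant in `𝒴_ξ`, and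
the tube estimate applies to that sum. -/
theorem exists_calSq_packet_le (h : IsBasicCutoff φ₀) (hφ : IsLatticePartition φ) {R : ℝ}
    (hR : ∀ (ξ : lattice) (x : Plane), R < dist x ξ → φ ξ x = 0) : ∃ C : ℝ, 0 < C ∧
    ∀ i j : ℕ, 1 ≤ i → 5 * i ≤ j → ∀ u v w : L2, hat u =ᵐ[volume] lowPart i u →
      (w =ᵐ[volume] fun z => v z * u z) → ∀ ξ : lattice,
      calSq ξ (fun z => ‖packet φ ξ (fourierMul (symbBelow φ₀ j (-(i : ℤ))) w) z‖ₑ) ≤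
        ENNReal.ofReal (C / 2 ^ j) * modNorm (lowPart i u) ^ 2 *
          ∑ n ∈ lowCells i, ∫⁻ z, ‖interactPart R i j v (ξ, n) z‖ₑ ^ 2 := by
  obtain ⟨C₁, hC₁⟩ := exists_packet_kernel h hφ
  obtain ⟨C₂, hC₂, H⟩ := exists_calSq_sum_le R
  refine ⟨64 * (|C₁| + 1) ^ 2 * C₂, by positivity, fun i j hi hij u v w hu hw ξ => ?_⟩
  set m : SpaceTime → ℝ := fun ζ => φ ξ (spatial ζ) * symbBelow φ₀ j (-(i : ℤ)) ζ with hm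
  have hP := hat_packet_fourierMul h hφ (by omega : i ≤ j) ξ w
  by_cases hξ : 2 ^ j / 4 - R ≤ ‖(ξ : Plane)‖
  · obtain ⟨κ, p, hκ, hκi, hp, hκC, hκm⟩ := hC₁ i j hi hij ξ
    choose W hW using fun n : Fin 2 → ℤ =>
      exists_mul_L2 (hat_cellPiece i u n) (integrable_cellPart i u n) (interactPart R i j v (ξ, n))
    have hWhat : ∀ n, hat (W n) =ᵐ[volume] fun ζ => (((2 * Real.pi) ^ 3)⁻¹ : ℝ) *
        ∫ ζ', cellPart i u n ζ' * {ζ | Interacts R i j 1 ζ ξ n}.indicator (hat v) (ζ - ζ') := by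
      intro n
      have h4 := hat_mul_congr (hat_cellPiece i u n) (integrable_cellPart i u n)
        (hat_interactPart R i j v (ξ, n)) (hW n)
      exact h4
    set V : L2 := ∑ n ∈ lowCells i, W n with hV
    have hVae : V =ᵐ[volume] fun z => ∑ n ∈ lowCells i,
        interactPart R i j v (ξ, n) z * cellPiece i u n z := by
      filter_upwards [coeFn_sum (lowCells i) W, ae_all_iff.2 hW] with z h1 h2
      rw [hV, h1]
      exact Finset.sum_congr rfl fun n _ => h2 n
    have hg := memLp_superposition hκ hκi (measurable_coe_L2 V) (Lp.memLp V) hp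
    -- Equality of Fourier transforms: where the symbol vanishes both are zero, and elsewhere the
    -- convolution sees only interacting frequencies of `v`.
    have hPeq : packet φ ξ (fourierMul (symbBelow φ₀ j (-(i : ℤ))) w) = hg.toLp _ := by
      refine L2_ext_hat ?_
      filter_upwards [hP, hat_superposition hκ hκi hp V _ hg.coeFn_toLp, hat_sum (lowCells i) W,
        ae_all_iff.2 hWhat, hat_mul_congr hu (integrable_lowPart i u) (Filter.EventuallyEq.refl _ _)
          hw] with ζ h1 h2 h3 h4 h5
      rw [h1, h2, hκm, hV, h3, h5, Finset.sum_congr rfl fun n _ => h4 n, ← Finset.mul_sum]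
      by_cases hmz : φ ξ (spatial ζ) * symbBelow φ₀ j (-(i : ℤ)) ζ = 0
      · rw [hmz]; simp
      · rw [integral_cell_eq h hR hi hij ξ u v hmz]
    rw [hPeq]
    refine (calSq_superposition_le ξ hκ hp hg.coeFn_toLp).trans ?_
    calc _ ≤ 64 * ENNReal.ofReal (|C₁| + 1) ^ 2 * (ENNReal.ofReal (C₂ / 2 ^ j) *
          modNorm (lowPart i u) ^ 2 *
          ∑ n ∈ lowCells i, ∫⁻ z, ‖interactPart R i j v (ξ, n) z‖ₑ ^ 2) := by
          gcongr
          · refine hκC.trans (ENNReal.ofReal_le_ofReal ?_)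
            linarith [le_abs_self C₁]
          · exact H i j hi hij ξ hξ u V _ hVae
      _ = _ := by
          rw [show (64 : ℝ≥0∞) = ENNReal.ofReal 64 by simp, ← ENNReal.ofReal_pow (by positivity),
            ← mul_assoc, ← mul_assoc, ← ENNReal.ofReal_mul (by positivity),
            ← ENNReal.ofReal_mul (by positivity), mul_div_assoc]
  · push Not at hξ
    have h0 : hat (packet φ ξ (fourierMul (symbBelow φ₀ j (-(i : ℤ))) w)) =ᵐ[volume] 0 := by
      filter_upwards [hP] with ζ h1
      rw [h1]
      have : φ ξ (spatial ζ) * symbBelow φ₀ j (-(i : ℤ)) ζ = 0 := by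
        by_contra hne
        have h2 := symbBelow_ne_zero h (by omega) (by omega) (right_ne_zero_of_mul hne)
        have h3 := norm_spatial_ge hi hij h2.1 h2.2.2
        refine left_ne_zero_of_mul hne (hR _ _ ?_)
        rw [dist_eq_norm]
        have := norm_sub_norm_le (spatial ζ) (ξ : Plane)
        linarith
      rw [this]
      simp
    have h1 := ae_eq_zero_of_hat h0
    calc _ ≤ calSq ξ fun _ => 0 := calSq_mono_ae (by filter_upwards [h1] with z hz; simp [hz])
      _ = 0 := by simp [calSq]
      _ ≤ _ := zero_le

/-- The bilinear estimate for a high-frequency factor away from the paraboloid. -/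
theorem exists_normCalY_mul_le (h : IsBasicCutoff φ₀) (hφ : IsLatticePartition φ) :
    ∃ C : ℝ, 0 < C ∧ ∀ i j : ℕ, 1 ≤ i → 5 * i ≤ j → ∀ u v w : L2,
      FourierSupportedIn u (regionA φ₀ i) → FourierSupportedIn v (regionAbove φ₀ j (-(i : ℤ))) →
      (w =ᵐ[volume] fun z => v z * u z) →
      normCalY φ (fourierMul (symbBelow φ₀ j (-(i : ℤ))) w) ≤
        ENNReal.ofReal (C * 2 ^ ((i : ℝ) - (j : ℝ))) * normX φ₀ v * normX φ₀ u := by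
  obtain ⟨R, hR⟩ := hφ.support
  obtain ⟨K, hK⟩ := card_interacts_le R
  obtain ⟨C, hC, hCw⟩ := exists_calSq_packet_le h hφ hR
  refine ⟨Real.sqrt (192 * 72 ^ 2 * ((K + 1) * C)), by positivity, fun i j hi hij u v w hu hv hw => ?_⟩
  have hu' := hat_ae_eq_lowPart h hi hu
  have hl : (0 : ℝ) < 2 ^ (j - i) := by positivity
  -- The gain `2^{-(j-i)}` comes here from the modulation of `v`, in place of the weight of the
  -- output in the first estimate.
  have hvL : ∫⁻ ζ, ‖hat v ζ‖ₑ ^ 2 ≤ ENNReal.ofReal (192 / 2 ^ (j - i)) * normX φ₀ v ^ 2 := by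
    have h1 := lintegral_hat_sq_le_of_modulation_ge h (j := j) (lam := 2 ^ (j - i)) (v := v) (by
      filter_upwards [hv] with ζ hζ hne
      refine regionAbove_subset h (by omega) (by omega) ?_
      by_contra hcon
      exact hne (hζ hcon))
    calc ∫⁻ ζ, ‖hat v ζ‖ₑ ^ 2 = ENNReal.ofReal (1 / 2 ^ (j - i)) *
          (ENNReal.ofReal (2 ^ (j - i)) * ∫⁻ ζ, ‖hat v ζ‖ₑ ^ 2) := by
          rw [← mul_assoc, ← ENNReal.ofReal_mul (by positivity), one_div_mul_cancel hl.ne',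
            ENNReal.ofReal_one, one_mul]
      _ ≤ ENNReal.ofReal (1 / 2 ^ (j - i)) * (192 * normX φ₀ v ^ 2) := by gcongr
      _ = _ := by
          rw [← mul_assoc, show (192 : ℝ≥0∞) = ENNReal.ofReal 192 by simp,
            ← ENNReal.ofReal_mul (by positivity)]
          congr 2
          ring
  have huN : modNorm (lowPart i u) ≤ 72 * normX φ₀ u := by
    rw [← modNorm_congr hu']
    exact modNorm_hat_le h hi hu
  have hsum : ∑' ξ : lattice, ∑ n ∈ lowCells i, ∫⁻ z, ‖interactPart R i j v (ξ, n) z‖ₑ ^ 2 ≤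
      (K * 2 ^ i : ℕ) * ∫⁻ ζ, ‖hat v ζ‖ₑ ^ 2 := by
    refine le_trans ?_ (tsum_lintegral_interactPart_le hi hij
      (fun ζ S hS => hK i j hi hij 1 (by simp) ζ S hS) v)
    rw [ENNReal.tsum_prod (f := fun (ξ : lattice) (n : Fin 2 → ℤ) =>
      ∫⁻ z, ‖interactPart R i j v (ξ, n) z‖ₑ ^ 2)]
    exact ENNReal.tsum_le_tsum fun ξ => ENNReal.sum_le_tsum _
  rw [normCalY, ENNReal_rpow_half_le_iff]
  simp_rw [tsum_tubeNormOne_sq]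
  refine (ENNReal.tsum_le_tsum fun ξ => hCw i j hi hij u v w hu' hw ξ).trans ?_
  rw [ENNReal.tsum_mul_left]
  -- The same balance as before: smoothing `2^{-j}`, overlap `2^i` and modulation `2^{-(j-i)}`.
  calc _ ≤ ENNReal.ofReal (C / 2 ^ j) * (72 * normX φ₀ u) ^ 2 *
        ((K * 2 ^ i : ℕ) * (ENNReal.ofReal (192 / 2 ^ (j - i)) * normX φ₀ v ^ 2)) := by
        gcongr
        exact hsum.trans (by gcongr)
    _ = ENNReal.ofReal (192 * 72 ^ 2 * ((K * C) * (2 ^ i / 2 ^ j) * (1 / 2 ^ (j - i)))) *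
        normX φ₀ v ^ 2 * normX φ₀ u ^ 2 := by
        rw [← ENNReal.ofReal_natCast, mul_pow 72, show (72 : ℝ≥0∞) = ENNReal.ofReal 72 by simp,
          ← ENNReal.ofReal_pow (by norm_num)]
        have e : ENNReal.ofReal (192 * 72 ^ 2 * ((K * C) * (2 ^ i / 2 ^ j) * (1 / 2 ^ (j - i)))) =
            ENNReal.ofReal (192 / 2 ^ (j - i)) * ENNReal.ofReal ((K * 2 ^ i : ℕ) : ℝ) *
              ENNReal.ofReal (C / 2 ^ j) * ENNReal.ofReal (72 ^ 2) := by
          rw [← ENNReal.ofReal_mul (by positivity), ← ENNReal.ofReal_mul (by positivity),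
            ← ENNReal.ofReal_mul (by positivity)]
          congr 1
          push_cast
          ring
        rw [e]
        ring
    _ ≤ ENNReal.ofReal ((Real.sqrt (192 * 72 ^ 2 * ((K + 1) * C)) * 2 ^ ((i : ℝ) - (j : ℝ))) ^ 2) *
        normX φ₀ v ^ 2 * normX φ₀ u ^ 2 := by
        refine mul_le_mul_left (mul_le_mul_left (ENNReal.ofReal_le_ofReal ?_) _) _
        have e1 : (2 : ℝ) ^ ((i : ℝ) - (j : ℝ)) = 2 ^ i / 2 ^ j := by
          rw [Real.rpow_sub (by norm_num), Real.rpow_natCast, Real.rpow_natCast]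
        have e2 : (1 : ℝ) / 2 ^ (j - i) = 2 ^ i / 2 ^ j := by
          rw [div_eq_div_iff (by positivity) (by positivity), one_mul, ← pow_add]
          congr 1; omega
        rw [e1, e2, mul_pow, Real.sq_sqrt (by positivity)]
        have : 0 ≤ 192 * 72 ^ 2 * (C * (2 ^ i / 2 ^ j) ^ 2) := by positivity
        nlinarith
    _ = _ := by rw [ENNReal.ofReal_pow (by positivity), ← mul_pow, ← mul_pow]

end CalYEstimate

end DNLS

end

/-! ### Conclusion. -/

theorem mainTheorem12 (φ₀ : ℝ → ℝ) (hφ₀ : DNLS.IsBasicCutoff φ₀)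
    (φ : DNLS.lattice → DNLS.Plane → ℝ) (hφ : DNLS.IsLatticePartition φ) :
    ∃ C : ℝ, 0 < C ∧ ∀ i j : ℕ, 1 ≤ i → 5 * i ≤ j →
      ∀ u : DNLS.L2, DNLS.FourierSupportedIn u (DNLS.regionA φ₀ i) →
        (∀ v : DNLS.L2, DNLS.FourierSupportedIn v (DNLS.regionBelow φ₀ j (-(i : ℤ))) →
          ∃ w : DNLS.L2, (w =ᵐ[volume] fun z => v z * u z) ∧
            DNLS.normX0On (-(1 / 2)) (DNLS.regionAbove φ₀ j (-(i : ℤ))) w ≤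
              ENNReal.ofReal (C * 2 ^ ((i : ℝ) - (j : ℝ)) * (i : ℝ) ^ (1 / 2 : ℝ)) *
                DNLS.normY φ v * DNLS.normX φ₀ u) ∧
        (∀ v : DNLS.L2, DNLS.FourierSupportedIn v (DNLS.regionAbove φ₀ j (-(i : ℤ))) →
          ∃ w : DNLS.L2, (w =ᵐ[volume] fun z => v z * u z) ∧
            DNLS.normCalY φ (DNLS.fourierMul (DNLS.symbBelow φ₀ j (-(i : ℤ))) w) ≤
              ENNReal.ofReal (C * 2 ^ ((i : ℝ) - (j : ℝ)) * (i : ℝ) ^ (1 / 2 : ℝ)) *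
                DNLS.normX φ₀ v * DNLS.normX φ₀ u) := by
  obtain ⟨C₁, hC₁, H₁⟩ := DNLS.exists_normX0On_mul_le hφ₀ hφ
  obtain ⟨C₂, hC₂, H₂⟩ := DNLS.exists_normCalY_mul_le hφ₀ hφ
  refine ⟨max C₁ C₂, lt_max_of_lt_left hC₁, fun i j hi hij u hu => ?_⟩
  have hmul := DNLS.exists_mul_L2 (DNLS.hat_ae_eq_lowPart hφ₀ hi hu) (DNLS.integrable_lowPart i u)
  -- Both estimates hold with the factor `2^{i-j}` alone, and `i^{1/2} ≥ 1` turns them into the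
  -- stated form.
  have hi1 : (1 : ℝ) ≤ (i : ℝ) ^ (1 / 2 : ℝ) :=
    Real.one_le_rpow (by exact_mod_cast hi) (by norm_num)
  have hle : ∀ C : ℝ, C ≤ max C₁ C₂ → ENNReal.ofReal (C * 2 ^ ((i : ℝ) - (j : ℝ))) ≤
      ENNReal.ofReal (max C₁ C₂ * 2 ^ ((i : ℝ) - (j : ℝ)) * (i : ℝ) ^ (1 / 2 : ℝ)) := by
    intro C hC
    have h0 : 0 ≤ max C₁ C₂ * (2 : ℝ) ^ ((i : ℝ) - (j : ℝ)) :=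
      mul_nonneg (hC₁.le.trans (le_max_left _ _)) (by positivity)
    refine ENNReal.ofReal_le_ofReal ?_
    calc C * (2 : ℝ) ^ ((i : ℝ) - (j : ℝ)) ≤ max C₁ C₂ * 2 ^ ((i : ℝ) - (j : ℝ)) := by gcongr
      _ ≤ _ := le_mul_of_one_le_right h0 hi1
  refine ⟨fun v hv => ?_, fun v hv => ?_⟩
  · obtain ⟨w, hw⟩ := hmul v
    refine ⟨w, hw, (H₁ i j hi hij u v w hu hv hw).trans ?_⟩
    exact mul_le_mul_left (mul_le_mul_left (hle C₁ (le_max_left _ _)) _) _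
  · obtain ⟨w, hw⟩ := hmul v
    refine ⟨w, hw, (H₂ i j hi hij u v w hu hv hw).trans ?_⟩
    exact mul_le_mul_left (mul_le_mul_left (hle C₂ (le_max_right _ _)) _) _
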